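/- Let $n\ge 2$, $s\in(\tfrac12,1)$, $0<\sigma<s$, $0<\lambda\le\Lambda$, $T>0$, $b\in\mathbb R^n$, $r\in\mathbb R$. Let $\psi:\mathbb R^n\to[0,\infty)$ be of class $C^2\cap W^{2,\infty}$. For $\delta v(x,y):=v(x+y)+v(x-y)-2v(x)$ put $$M^+v(x)=\int_{\mathbb R^n}\frac{\Lambda(\delta v(x,y))^+-\lambda(\delta v(x,y))^-}{|y|^{n+2\sigma}}\,dy,\qquad M^-v(x)=\int_{\mathbb R^n}\frac{\lambda(\delta v(x,y))^+-\Lambda(\delta v(x,y))^-}{|y|^{n+2\sigma}}\,dy .$$ Let $\mathcal I$ be a convex, translation-invariant operator with $\mathcal I(0)=0$ such that $M^-(v-w)(x)\le \mathcal Iv(x)-\mathcal Iw(x)\le M^+(v-w)(x)$ for all $x$ and all $v,w$ that are punctually $C^{2\sigma+0^+}$ at $x$ and satisfy $\int_{\mathbb R^n} (|v(y)|+|w(y)|)(1+|y|^{n+2\sigma})^{-1}dy<\infty$. Here $v$ is punctually $C^{2\sigma+0^+}$ at $x$ if, for some $\varepsilon>0$, one has for small $y$, up to an error $O(|y|^{2\sigma+\varepsilon})$,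 $v(x+y)=v(x)$ if $2\sigma+\varepsilon\le1$, and $v(x+y)=v(x)+p\cdot y$ for some $p\in\mathbb R^n$ if $2\sigma+\varepsilon>1$. Put $\mathcal Rv=\mathcal Iv+b\cdot\nabla v+rv$, acting in the space variable. Let $u$ be the bounded continuous viscosity solution on $[0,T]\times\mathbb R^n$ of $$\min\{\partial_tu+(-\Delta)^su-\mathcal Ru,\;u-\psi\}=0\ \text{ in }(0,T]\times\mathbb R^n,\qquad u(0,\cdot)=\psi .$$ That is, $u\ge\psi$, $u(0,\cdot)=\psi$, and the following holds at every $(t_0,x_0)\in(0,T]\times\mathbb R^n$, for every $R>0$ and every $\phi\in C^{1,2}$ ($C^1$ in $t$, $C^2$ in $x$) on the closed ball $\overline{B_R(t_0,x_0)}$ with $\phi(t_0,x_0)=u(t_0,x_0)$, where $v:=\phi$ in $B_R(t_0,x_0)$ and $v:=u$ elsewhere: if $\phi<u$ at all other points of $B_R(t_0,x_0)\cap((0,T]\times\mathbb R^n)$, then $(\partial_tv+(-\Delta)^sv-\mathcal Rv)(t_0,x_0)\ge0$; if $u(t_0,x_0)>\psi(x_0)$ and $\phi>u$ at all those points, then $(\partial_tv+(-\Delta)^sv-\mathcal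 Rv)(t_0,x_0)\le0$. For exponents $a,\beta\in(0,1)$, $C^{a,\beta}_{t,x}((0,T]\times\mathbb R^n)$ is the space of bounded functions $f$ with $|f(t,x)-f(\tau,y)|\le C(|t-\tau|^a+|x-y|^\beta)$, normed by the supremum and the best $C$. Let $\alpha\in\big(0,\tfrac{1-s}{2s}\big)$ and assume that $$\partial_tu\in C^{\alpha,1-s}_{t,x}((0,T]\times\mathbb R^n)\quad\text{and}\quad(-\Delta)^su\in L^\infty((0,T];C^{1-s}(\mathbb R^n)),$$ the latter in the sense of distributions in $x$ for almost every $t$. Then, for all $(t,x)\in(0,T]\times\mathbb R^n$, the function $u(t,\cdot)$ is differentiable at $x$ and punctually $C^{2\sigma+0^+}$ at $x$, and $(-\Delta)^su(t,x)$ is given by the absolutely convergent integral $-\frac{c_{n,s}}2\int_{\mathbb R^n}\frac{\delta u(t,\cdot)(x,y)}{|y|^{n+2s}}dy$ (which, for almost every $t$, agrees with the distributional one), where $c_{n,s}$ is the usual normalization constant of $(-\Delta)^s$. Moreover, $$\big[(-\Delta)^su-\mathcal Ru\big]\chi_{\{u=\psi\}}\in C^{(1+\alpha)\frac{1-s}{1+s},\,1-s}_{t,x}((0,T]\times\mathbb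 R^n),$$ with norm bounded by a constant that depends only on $n,s,\sigma,\lambda,\Lambda,T,b,r,\alpha$ and on an upper bound $M$ for $\|\psi\|_{W^{2,\infty}}$, $\|\partial_tu\|_{C^{\alpha,1-s}_{t,x}}$ and $\|(-\Delta)^su\|_{L^\infty((0,T];C^{1-s})}$. -/

import Mathlib

open MeasureTheory Set
open scoped ContDiff Topology

noncomputable section

namespace NonlocalObstacle

/-- `ℝⁿ` with its Euclidean norm. -/
abbrev E (n : ℕ) : Type := EuclideanSpace ℝ (Fin n)

/-- Second difference `δf(x,y) = f(x+y) + f(x-y) - 2 f(x)`. -/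
def secondDiff {n : ℕ} (f : E n → ℝ) (x y : E n) : ℝ :=
  f (x + y) + f (x - y) - 2 * f x

/-- The normalization constant `c_{n,s} = s 4^s Γ(n/2+s) / (π^{n/2} Γ(1-s))`. -/
def fracConst (n : ℕ) (s : ℝ) : ℝ :=
  s * (4 : ℝ) ^ s * Real.Gamma ((n : ℝ) / 2 + s) /
    (Real.pi ^ ((n : ℝ) / 2) * Real.Gamma (1 - s))

/-- The singular integral of `(-Δ)^s f` at `x`, symmetrized in `y ↦ -y`
(this takes care of the principal value), converges absolutely. -/
def FracLapConverges {n : ℕ} (s : ℝ) (f : E n → ℝ) (x : E n) : Prop :=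
  Integrable (fun y : E n => secondDiff f x y / ‖y‖ ^ ((n : ℝ) + 2 * s))

/-- `(-Δ)^s f(x) = c_{n,s} PV ∫ (f(x) - f(y)) / |x-y|^{n+2s} dy`, in its symmetrized form
`-(c_{n,s}/2) ∫ δf(x,y) / |y|^{n+2s} dy`. -/
def fracLap {n : ℕ} (s : ℝ) (f : E n → ℝ) (x : E n) : ℝ :=
  -(fracConst n s / 2) * ∫ y : E n, secondDiff f x y / ‖y‖ ^ ((n : ℝ) + 2 * s)

/-- `(-Δ)^s f = g` in the sense of distributions on `ℝⁿ` (used for `f`, `g` bounded and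
continuous): `∫ f (-Δ)^s φ = ∫ g φ` for every test function `φ ∈ C_c^∞(ℝⁿ)`. -/
def IsDistribFracLap {n : ℕ} (s : ℝ) (f g : E n → ℝ) : Prop :=
  ∀ φ : E n → ℝ, ContDiff ℝ ∞ φ → HasCompactSupport φ →
    ∫ x : E n, f x * fracLap s φ x = ∫ x : E n, g x * φ x

/-- Extremal operator `M⁺` of the class of kernels `lam |y|^{-n-2σ} ≤ K(y) = K(-y) ≤ Lam |y|^{-n-2σ}`. -/
def extremalSup {n : ℕ} (σ lam Lam : ℝ) (f : E n → ℝ) (x : E n) : ℝ :=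
  ∫ y : E n, (Lam * max (secondDiff f x y) 0 - lam * max (-secondDiff f x y) 0) /
    ‖y‖ ^ ((n : ℝ) + 2 * σ)

/-- Extremal operator `M⁻` of the same class of kernels. -/
def extremalInf {n : ℕ} (σ lam Lam : ℝ) (f : E n → ℝ) (x : E n) : ℝ :=
  ∫ y : E n, (lam * max (secondDiff f x y) 0 - Lam * max (-secondDiff f x y) 0) /
    ‖y‖ ^ ((n : ℝ) + 2 * σ)

/-- `f` is punctually `C^{2σ+0⁺}` at `x`: for some `ε > 0`, it is approximated near `x` up to an
error `M |y|^{2σ+ε}` by a constant if `2σ+ε ≤ 1`, and by an affine function if `2σ+ε > 1`. -/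
def PunctuallyRegular {n : ℕ} (σ : ℝ) (f : E n → ℝ) (x : E n) : Prop :=
  ∃ ε : ℝ, 0 < ε ∧ ∃ p : E n, ∃ M : ℝ, (2 * σ + ε ≤ 1 → p = 0) ∧
    ∀ᶠ y in 𝓝 (0 : E n), |f (x + y) - f x - inner ℝ p y| ≤ M * ‖y‖ ^ (2 * σ + ε)

/-- The functions at which an operator of order `2σ` has to be defined at the point `x`. -/
structure InDomain {n : ℕ} (σ : ℝ) (f : E n → ℝ) (x : E n) : Prop where
  regular : PunctuallyRegular σ f x
  weight : Integrable (fun y : E n => f y / (1 + ‖y‖ ^ ((n : ℝ) + 2 * σ)))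

/-- `J` is a convex, translation-invariant operator with `J 0 = 0` which is uniformly elliptic
with respect to the class of kernels of order `2σ` with bounds `lam`, `Lam`.
Values `J f x` with `f` not in the domain at `x` are irrelevant. -/
structure IsNonlocalOp {n : ℕ} (σ lam Lam : ℝ) (J : (E n → ℝ) → E n → ℝ) : Prop where
  elliptic : ∀ (v w : E n → ℝ) (x : E n), InDomain σ v x → InDomain σ w x →
    extremalInf σ lam Lam (v - w) x ≤ J v x - J w x ∧
      J v x - J w x ≤ extremalSup σ lam Lam (v - w) x
  convex : ∀ (v w : E n → ℝ) (x : E n) (θ : ℝ), InDomain σ v x → InDomain σ w x →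
    0 ≤ θ → θ ≤ 1 →
      J (fun z => θ * v z + (1 - θ) * w z) x ≤ θ * J v x + (1 - θ) * J w x
  translation : ∀ (v : E n → ℝ) (x h : E n), InDomain σ v (x + h) →
    J (fun z => v (z + h)) x = J v (x + h)
  map_zero : ∀ x : E n, J (fun _ => 0) x = 0

/-- The lower order operator `R f = J f + b · ∇f + r f`. -/
def lowerOp {n : ℕ} (b : E n) (r : ℝ) (J : (E n → ℝ) → E n → ℝ) (f : E n → ℝ) (x : E n) : ℝ :=
  J f x + fderiv ℝ f x b + r * f x

/-- The parabolic operator `∂ₜv + (-Δ)^s v - b · ∇v - J v - r v`, evaluated classically. -/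
def parabolicOp {n : ℕ} (s : ℝ) (b : E n) (r : ℝ) (J : (E n → ℝ) → E n → ℝ)
    (v : ℝ → E n → ℝ) (t : ℝ) (x : E n) : ℝ :=
  deriv (fun τ => v τ x) t + fracLap s (v t) x - lowerOp b r J (v t) x

/-- Open Euclidean ball of space-time. -/
def stBall {n : ℕ} (t₀ : ℝ) (x₀ : E n) (R : ℝ) : Set (ℝ × E n) :=
  {p | (p.1 - t₀) ^ 2 + ‖p.2 - x₀‖ ^ 2 < R ^ 2}

/-- Closed Euclidean ball of space-time. -/
def stClosedBall {n : ℕ} (t₀ : ℝ) (x₀ : E n) (R : ℝ) : Set (ℝ × E n) :=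
  {p | (p.1 - t₀) ^ 2 + ‖p.2 - x₀‖ ^ 2 ≤ R ^ 2}

/-- `φ` is of class `C^{1,2}` (`C¹` in time, `C²` in space) on the closed ball: `φ` and the
derivatives `∂ₜφ`, `Dφ`, `D²φ` taken in the open ball are continuous up to the boundary. -/
def IsC12 {n : ℕ} (φ : ℝ → E n → ℝ) (t₀ : ℝ) (x₀ : E n) (R : ℝ) : Prop :=
  ∃ (φt : ℝ × E n → ℝ) (φx : ℝ × E n → (E n →L[ℝ] ℝ))
    (φxx : ℝ × E n → (E n →L[ℝ] E n →L[ℝ] ℝ)),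
    ContinuousOn (fun p : ℝ × E n => φ p.1 p.2) (stClosedBall t₀ x₀ R) ∧
    ContinuousOn φt (stClosedBall t₀ x₀ R) ∧
    ContinuousOn φx (stClosedBall t₀ x₀ R) ∧
    ContinuousOn φxx (stClosedBall t₀ x₀ R) ∧
    ∀ p ∈ stBall t₀ x₀ R,
      HasDerivAt (fun τ => φ τ p.2) (φt p) p.1 ∧
      HasFDerivAt (φ p.1) (φx p) p.2 ∧
      HasFDerivAt (fun z => φx (p.1, z)) (φxx p) p.2

open Classical in
/-- The function equal to `φ` in the ball and to `u` outside of it. -/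
def glue {n : ℕ} (φ u : ℝ → E n → ℝ) (t₀ : ℝ) (x₀ : E n) (R : ℝ) : ℝ → E n → ℝ :=
  fun t x => if (t, x) ∈ stBall t₀ x₀ R then φ t x else u t x

/-- `∂ₜu + (-Δ)^s u - R u ≤ 0` in the viscosity sense at `(t₀, x₀)`, for `u` on `(0,T] × ℝⁿ`. -/
def ViscositySubAt {n : ℕ} (s : ℝ) (b : E n) (r : ℝ) (J : (E n → ℝ) → E n → ℝ) (T : ℝ)
    (u : ℝ → E n → ℝ) (t₀ : ℝ) (x₀ : E n) : Prop :=
  ∀ (R : ℝ) (φ : ℝ → E n → ℝ), 0 < R → IsC12 φ t₀ x₀ R → u t₀ x₀ = φ t₀ x₀ →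
    (∀ t ∈ Ioc 0 T, ∀ x : E n, (t, x) ∈ stBall t₀ x₀ R → (t, x) ≠ (t₀, x₀) → u t x < φ t x) →
      parabolicOp s b r J (glue φ u t₀ x₀ R) t₀ x₀ ≤ 0

/-- `∂ₜu + (-Δ)^s u - R u ≥ 0` in the viscosity sense at `(t₀, x₀)`, for `u` on `(0,T] × ℝⁿ`. -/
def ViscositySuperAt {n : ℕ} (s : ℝ) (b : E n) (r : ℝ) (J : (E n → ℝ) → E n → ℝ) (T : ℝ)
    (u : ℝ → E n → ℝ) (t₀ : ℝ) (x₀ : E n) : Prop :=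
  ∀ (R : ℝ) (φ : ℝ → E n → ℝ), 0 < R → IsC12 φ t₀ x₀ R → u t₀ x₀ = φ t₀ x₀ →
    (∀ t ∈ Ioc 0 T, ∀ x : E n, (t, x) ∈ stBall t₀ x₀ R → (t, x) ≠ (t₀, x₀) → φ t x < u t x) →
      0 ≤ parabolicOp s b r J (glue φ u t₀ x₀ R) t₀ x₀

/-- `u` is bounded on `[0,T] × ℝⁿ`. -/
def BoundedST {n : ℕ} (T : ℝ) (u : ℝ → E n → ℝ) : Prop :=
  ∃ B : ℝ, ∀ t ∈ Icc 0 T, ∀ x : E n, |u t x| ≤ B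

/-- Viscosity subsolution of the obstacle problem. -/
structure IsSubsolution {n : ℕ} (s : ℝ) (b : E n) (r : ℝ) (J : (E n → ℝ) → E n → ℝ) (T : ℝ)
    (ψ : E n → ℝ) (u : ℝ → E n → ℝ) : Prop where
  usc : UpperSemicontinuousOn (fun p : ℝ × E n => u p.1 p.2) (Icc 0 T ×ˢ univ)
  bounded : BoundedST T u
  visc : ∀ t ∈ Ioc 0 T, ∀ x : E n, ψ x < u t x → ViscositySubAt s b r J T u t x
  initial : ∀ x : E n, u 0 x ≤ ψ x

/-- Viscosity supersolution of the obstacle problem. -/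
structure IsSupersolution {n : ℕ} (s : ℝ) (b : E n) (r : ℝ) (J : (E n → ℝ) → E n → ℝ) (T : ℝ)
    (ψ : E n → ℝ) (u : ℝ → E n → ℝ) : Prop where
  lsc : LowerSemicontinuousOn (fun p : ℝ × E n => u p.1 p.2) (Icc 0 T ×ˢ univ)
  bounded : BoundedST T u
  above : ∀ t ∈ Ioc 0 T, ∀ x : E n, ψ x ≤ u t x
  visc : ∀ t ∈ Ioc 0 T, ∀ x : E n, ViscositySuperAt s b r J T u t x
  initial : ∀ x : E n, ψ x ≤ u 0 x

/-- Bounded continuous viscosity solution of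
`min {∂ₜu + (-Δ)^s u - b · ∇u - J u - r u, u - ψ} = 0` in `(0,T] × ℝⁿ`, `u(0,·) = ψ`. -/
structure IsSolution {n : ℕ} (s : ℝ) (b : E n) (r : ℝ) (J : (E n → ℝ) → E n → ℝ) (T : ℝ)
    (ψ : E n → ℝ) (u : ℝ → E n → ℝ) : Prop where
  cont : ContinuousOn (fun p : ℝ × E n => u p.1 p.2) (Icc 0 T ×ˢ univ)
  sub : IsSubsolution s b r J T ψ u
  super : IsSupersolution s b r J T ψ u

/-- A non-negative obstacle of class `C² ∩ W^{2,∞}`, with `ψ`, `Dψ`, `D²ψ` bounded by `M`. -/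
structure IsObstacle {n : ℕ} (M : ℝ) (ψ : E n → ℝ) : Prop where
  nonneg : ∀ x, 0 ≤ ψ x
  smooth : ContDiff ℝ 2 ψ
  bound : ∀ x, |ψ x| ≤ M
  bound_fst : ∀ x, ‖fderiv ℝ ψ x‖ ≤ M
  bound_snd : ∀ x, ‖iteratedFDeriv ℝ 2 ψ x‖ ≤ M

/-- `g ∈ C^β(ℝⁿ)`, with supremum and Hölder seminorm bounded by `M`. -/
structure HolderX {n : ℕ} (β M : ℝ) (g : E n → ℝ) : Prop where
  bound : ∀ x, |g x| ≤ M
  holder : ∀ x y, |g x - g y| ≤ M * ‖x - y‖ ^ β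

/-- `f ∈ C^{a,β}_{t,x}((0,T] × ℝⁿ)`, with supremum and Hölder seminorm bounded by `M`. -/
structure HolderTX {n : ℕ} (T a β M : ℝ) (f : ℝ → E n → ℝ) : Prop where
  bound : ∀ t ∈ Ioc 0 T, ∀ x, |f t x| ≤ M
  holder : ∀ t ∈ Ioc 0 T, ∀ τ ∈ Ioc 0 T, ∀ x y,
    |f t x - f τ y| ≤ M * (|t - τ| ^ a + ‖x - y‖ ^ β)

open Classical in
/-- The free boundary term `[(-Δ)^s u - R u] χ_{u = ψ}`. -/
def freeBoundaryTerm {n : ℕ} (s : ℝ) (b : E n) (r : ℝ) (J : (E n → ℝ) → E n → ℝ)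
    (ψ : E n → ℝ) (u : ℝ → E n → ℝ) : ℝ → E n → ℝ :=
  fun t x => if u t x = ψ x then fracLap s (u t) x - lowerOp b r J (u t) x else 0

end NonlocalObstacle

end

noncomputable section

namespace NonlocalObstacle

/-! Write F = ∂ₜu + (-Δ)^s u - Ru. The free boundary term turns out to be F itself on all of (0,T] ×
ℝⁿ. The function F is C^{1-s} in x, and at contact points its time increments reduce to those of
(-Δ)^s u - Ju, which can be interpolated.

Regularity in space. For almost every t, u(t) is bounded and (-Δ)^s u(t) lies in C^{1-s}, so u(t)
lies in C^{1,s} (`exists_holderC1_of_isDistribFracLap`). This rests on a pair of kernels Θ, K for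
which (-Δ)^s K is Θ minus its dyadic dilate: the averages of u at scales a and 2a against Θ differ
by a^{2s} times an average of (-Δ)^s u against K, which is O(a^{1+s}) because K has mean zero.
Dyadic summation gives an expansion with error |h|^{1+s}. The Lipschitz bound in time and
compactness of gradients carry it to every t (`exists_regularEvolution`). As 1+s exceeds 2s and 2σ,
all operators are classical. Moreover Ru(t) is in C^{1-s} (`exists_holderX_lowerOp`), and F is
jointly continuous (`RegularEvolution.continuousOn_evolOp`).

From viscosity to classical inequalities. Near any point u is touched strictly by paraboloids.
Gluing such a paraboloid into u on a ball of radius R changes the operators by o(1) as R → 0, so F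
has the right sign at the touching points, which accumulate at the given point. Continuity of F
yields F ≥ 0 everywhere and F ≤ 0 off the contact set
(`RegularEvolution.evolOp_nonneg_of_viscosity`).

Monotonicity. Comparing u with its time shift u(·+δ), at a maximum point made attainable by a small
bump, shows that u is non-decreasing in time (`RegularEvolution.monotone`). Hence for fixed x the
contact times form an initial segment, and ∂ₜu = 0 at contact. Off contact F = 0. This identifies F
with the free boundary term.

Regularity in time. At two contact times of the same x, the values and gradients of u are those of
ψ, so only (-Δ)^s u - Ju changes. Its second differences change by at most C|t-τ||y|^{1-s}, since
∂ₜu is C^{1-s} in x, and by at most C|y|^{1+s}. A geometric mean with weight θ has exponent 1+s-2sθ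
in |y|, which exceeds 2s exactly when θ < (1-s)/(2s); the exponent in the theorem satisfies this
(`exists_nonlocal_time_holder`). If only the earlier time is a contact time, the last contact time m
in between satisfies F(m) = 0 by continuity and replaces the later one (`holder_of_contact`). -/

/-! ### Truncated singular kernels and the operators they bound -/

lemma integrable_truncKernel {n : ℕ} (hn : 1 ≤ n) {p κ : ℝ} (hp : 0 < p) (hκ : p < κ) :
    Integrable (fun y : E n => min (‖y‖ ^ κ) 1 / ‖y‖ ^ ((n : ℝ) + p)) := by
  have : Nonempty (Fin n) := ⟨⟨0, hn⟩⟩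
  have : Nontrivial (E n) := inferInstance
  have key := integrable_fun_norm_addHaar (E := E n) (volume : Measure (E n))
    (f := fun t : ℝ => min (t ^ κ) 1 / t ^ ((n : ℝ) + p))
  rw [key]
  simp only [finrank_euclideanSpace, Fintype.card_fin]
  have hpow : ∀ t : ℝ, 0 < t → (t ^ (n - 1) : ℝ) = t ^ ((n : ℝ) - 1) := by
    intro t ht
    rw [← Real.rpow_natCast, Nat.cast_sub hn, Nat.cast_one]
  -- The radial density is t^{κ-p-1} up to 1 and t^{-p-1} beyond, so p < κ and 0 < p are the two
  -- integrability conditions.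
  have hunion : (Ioi 0 : Set ℝ) = Ioc 0 1 ∪ Ioi 1 := (Ioc_union_Ioi_eq_Ioi zero_le_one).symm
  rw [hunion]
  refine IntegrableOn.union ?_ ?_
  · have h1 : IntegrableOn (fun t : ℝ => t ^ (κ - p - 1)) (Ioc 0 1) := by
      have := intervalIntegral.intervalIntegrable_rpow' (a := 0) (b := 1) (r := κ - p - 1)
        (by linarith)
      rwa [intervalIntegrable_iff_integrableOn_Ioc_of_le zero_le_one] at this
    refine h1.congr_fun ?_ measurableSet_Ioc
    intro t ht
    have h2 : t ^ κ ≤ 1 := Real.rpow_le_one ht.1.le ht.2 (by linarith)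
    simp only [smul_eq_mul]
    rw [min_eq_left h2, hpow t ht.1, ← Real.rpow_sub ht.1, ← Real.rpow_add ht.1]
    congr 1; ring
  · have h1 : IntegrableOn (fun t : ℝ => t ^ (-p - 1)) (Ioi 1) :=
      integrableOn_Ioi_rpow_of_lt (by linarith) zero_lt_one
    refine h1.congr_fun ?_ measurableSet_Ioi
    intro t ht
    have ht1 : (1 : ℝ) < t := ht
    have ht0 : 0 < t := by linarith
    have h2 : 1 ≤ t ^ κ := Real.one_le_rpow ht1.le (by linarith)
    simp only [smul_eq_mul]
    rw [min_eq_right h2, hpow t ht0, one_div, ← Real.rpow_neg ht0.le, ← Real.rpow_add ht0]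
    congr 1; ring

/-- The integral `∫ min (|y|^κ, 1) |y|^{-n-p} dy`. -/
def truncConst (n : ℕ) (p κ : ℝ) : ℝ := ∫ y : E n, min (‖y‖ ^ κ) 1 / ‖y‖ ^ ((n : ℝ) + p)

lemma truncConst_nonneg (n : ℕ) (p κ : ℝ) : 0 ≤ truncConst n p κ := by
  refine integral_nonneg fun y => ?_
  have := norm_nonneg y
  positivity

lemma abs_div_kernel_le {n : ℕ} {p κ a B : ℝ} {y : E n} (h : |a| ≤ B * min (‖y‖ ^ κ) 1) :
    ‖a / ‖y‖ ^ ((n : ℝ) + p)‖ ≤ B * (min (‖y‖ ^ κ) 1 / ‖y‖ ^ ((n : ℝ) + p)) := by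
  have h0 : 0 ≤ ‖y‖ ^ ((n : ℝ) + p) := by positivity
  rw [Real.norm_eq_abs, abs_div, abs_of_nonneg h0, ← mul_div_assoc]
  exact div_le_div_of_nonneg_right h h0

lemma integrable_div_kernel {n : ℕ} (hn : 1 ≤ n) {p κ : ℝ} (hp : 0 < p) (hκ : p < κ)
    {f : E n → ℝ} (hf : Measurable f) {B : ℝ} (hB : ∀ y, |f y| ≤ B * min (‖y‖ ^ κ) 1) :
    Integrable (fun y : E n => f y / ‖y‖ ^ ((n : ℝ) + p)) := by
  refine ((integrable_truncKernel hn hp hκ).const_mul B).mono' ?_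
    (Filter.Eventually.of_forall fun y => abs_div_kernel_le (hB y))
  exact (hf.div (measurable_norm.pow_const _)).aestronglyMeasurable

lemma abs_integral_div_kernel_le {n : ℕ} (hn : 1 ≤ n) {p κ : ℝ} (hp : 0 < p) (hκ : p < κ)
    {f : E n → ℝ} {B : ℝ} (hB : ∀ y, |f y| ≤ B * min (‖y‖ ^ κ) 1) :
    |∫ y : E n, f y / ‖y‖ ^ ((n : ℝ) + p)| ≤ B * truncConst n p κ := by
  rw [truncConst, ← integral_const_mul, ← Real.norm_eq_abs]
  exact norm_integral_le_of_norm_le ((integrable_truncKernel hn hp hκ).const_mul B)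
    (Filter.Eventually.of_forall fun y => abs_div_kernel_le (hB y))

lemma measurable_secondDiff {n : ℕ} {f : E n → ℝ} (hf : Measurable f) (x : E n) :
    Measurable (secondDiff f x) := by
  unfold secondDiff
  exact ((hf.comp (measurable_const_add x)).add (hf.comp (measurable_id.const_sub x))).sub_const _

lemma secondDiff_sub {n : ℕ} (f g : E n → ℝ) (x y : E n) :
    secondDiff (f - g) x y = secondDiff f x y - secondDiff g x y := by
  simp only [secondDiff, Pi.sub_apply]; ring

lemma fracConst_pos {n : ℕ} {s : ℝ} (hs : 0 < s) (hs1 : s < 1) : 0 < fracConst n s := by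
  unfold fracConst
  have h1 : 0 < Real.Gamma ((n : ℝ) / 2 + s) := Real.Gamma_pos_of_pos (by positivity)
  have h2 : 0 < Real.Gamma (1 - s) := Real.Gamma_pos_of_pos (by linarith)
  have := Real.pi_pos
  positivity

lemma fracLap_sub {n : ℕ} {s : ℝ} {f g : E n → ℝ} {x : E n} (hf : FracLapConverges s f x)
    (hg : FracLapConverges s g x) : fracLap s (f - g) x = fracLap s f x - fracLap s g x := by
  unfold fracLap
  rw [← mul_sub, ← integral_sub hf hg]
  congr 1
  refine integral_congr_ae (Filter.Eventually.of_forall fun y => ?_)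
  simp only [secondDiff_sub, sub_div]

lemma abs_fracLap_le {n : ℕ} (hn : 1 ≤ n) {s κ : ℝ} (hs : 0 < s) (hs1 : s < 1) (hκ : 2 * s < κ)
    {f : E n → ℝ} {x : E n} {B : ℝ} (hB : ∀ y, |secondDiff f x y| ≤ B * min (‖y‖ ^ κ) 1) :
    |fracLap s f x| ≤ fracConst n s / 2 * truncConst n (2 * s) κ * B := by
  have hc := fracConst_pos (n := n) hs hs1
  have h := abs_integral_div_kernel_le hn (p := 2 * s) (by linarith) hκ hB
  rw [fracLap, abs_mul, abs_neg, abs_of_pos (by linarith), mul_assoc, mul_comm (truncConst _ _ _)]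
  exact mul_le_mul_of_nonneg_left h (by linarith)

lemma abs_extremal_integrand_le {lam Lam a : ℝ} (h0 : 0 < lam) (h1 : lam ≤ Lam) :
    |Lam * max a 0 - lam * max (-a) 0| ≤ Lam * |a| ∧
      |lam * max a 0 - Lam * max (-a) 0| ≤ Lam * |a| := by
  rcases le_total 0 a with h | h
  · rw [max_eq_left h, max_eq_right (by linarith), abs_of_nonneg h, mul_zero, sub_zero,
      mul_zero, sub_zero, abs_of_nonneg (by nlinarith), abs_of_nonneg (by nlinarith)]
    exact ⟨le_rfl, by nlinarith⟩
  · rw [max_eq_right h, max_eq_left (by linarith), abs_of_nonpos h, mul_zero, zero_sub, mul_zero,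
      zero_sub, abs_neg, abs_neg, abs_of_nonneg (by nlinarith), abs_of_nonneg (by nlinarith)]
    exact ⟨by nlinarith, le_rfl⟩

lemma abs_extremalSup_le {n : ℕ} (hn : 1 ≤ n) {σ κ lam Lam : ℝ} (hσ : 0 < σ) (hκ : 2 * σ < κ)
    (h0 : 0 < lam) (h1 : lam ≤ Lam)
    {f : E n → ℝ} {x : E n} {B : ℝ} (hB : ∀ y, |secondDiff f x y| ≤ B * min (‖y‖ ^ κ) 1) :
    |extremalSup σ lam Lam f x| ≤ Lam * truncConst n (2 * σ) κ * B := by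
  have h := abs_integral_div_kernel_le hn (p := 2 * σ) (κ := κ) (B := Lam * B)
    (f := fun y => Lam * max (secondDiff f x y) 0 - lam * max (-secondDiff f x y) 0)
    (by linarith) hκ (fun y => by
      refine (abs_extremal_integrand_le h0 h1).1.trans ?_
      rw [mul_assoc]
      exact mul_le_mul_of_nonneg_left (hB y) (by linarith))
  calc _ ≤ _ := h
    _ = _ := by ring

lemma abs_extremalInf_le {n : ℕ} (hn : 1 ≤ n) {σ κ lam Lam : ℝ} (hσ : 0 < σ) (hκ : 2 * σ < κ)
    (h0 : 0 < lam) (h1 : lam ≤ Lam)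
    {f : E n → ℝ} {x : E n} {B : ℝ} (hB : ∀ y, |secondDiff f x y| ≤ B * min (‖y‖ ^ κ) 1) :
    |extremalInf σ lam Lam f x| ≤ Lam * truncConst n (2 * σ) κ * B := by
  have h := abs_integral_div_kernel_le hn (p := 2 * σ) (κ := κ) (B := Lam * B)
    (f := fun y => lam * max (secondDiff f x y) 0 - Lam * max (-secondDiff f x y) 0)
    (by linarith) hκ (fun y => by
      refine (abs_extremal_integrand_le h0 h1).2.trans ?_
      rw [mul_assoc]
      exact mul_le_mul_of_nonneg_left (hB y) (by linarith))
  calc _ ≤ _ := h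
    _ = _ := by ring

/-- Ellipticity is two-sided, so the operator inherits any bound on second differences that
integrates against the kernel of order 2σ. The exponent κ is left free because different
interpolations supply different powers of |y|. -/
lemma IsNonlocalOp.abs_sub_le {n : ℕ} (hn : 1 ≤ n) {σ κ lam Lam : ℝ} (hσ : 0 < σ)
    (hκ : 2 * σ < κ) (h0 : 0 < lam) (h1 : lam ≤ Lam) {J : (E n → ℝ) → E n → ℝ}
    (hJ : IsNonlocalOp σ lam Lam J) {v w : E n → ℝ} {x : E n} (hv : InDomain σ v x)
    (hw : InDomain σ w x) {B : ℝ}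
    (hB : ∀ y, |secondDiff v x y - secondDiff w x y| ≤ B * min (‖y‖ ^ κ) 1) :
    |J v x - J w x| ≤ Lam * truncConst n (2 * σ) κ * B := by
  have hB' : ∀ y, |secondDiff (v - w) x y| ≤ B * min (‖y‖ ^ κ) 1 := fun y => by
    rw [secondDiff_sub]; exact hB y
  obtain ⟨hl, hu⟩ := hJ.elliptic v w x hv hw
  have hl' := abs_extremalInf_le hn hσ hκ h0 h1 hB'
  have hu' := abs_extremalSup_le hn hσ hκ h0 h1 hB'
  rw [abs_le] at hl' hu' ⊢
  constructor <;> linarith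

lemma mul_min_of_le {a κ B r : ℝ} (ha : |a| ≤ B) (hr : 0 ≤ r) (hκ : 0 < κ)
    (hab : r ≤ 1 → |a| ≤ B * r ^ κ) : |a| ≤ B * min (r ^ κ) 1 := by
  have hB : 0 ≤ B := (abs_nonneg a).trans ha
  rcases le_total r 1 with h | h
  · rw [min_eq_left (Real.rpow_le_one hr h hκ.le)]; exact hab h
  · rw [min_eq_right (Real.one_le_rpow h hκ.le), mul_one]; exact ha

/-! ### The Fourier symbol of the fractional Laplacian -/

section CosTransform

open scoped RealInnerProductSpace

lemma abs_two_sub_two_cos_le {n : ℕ} (ξ y : E n) :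
    |2 - 2 * Real.cos (2 * Real.pi * ⟪ξ, y⟫)| ≤
      (4 + (2 * Real.pi * ‖ξ‖) ^ 2) * min (‖y‖ ^ (2 : ℝ)) 1 := by
  have hc := Real.neg_one_le_cos (2 * Real.pi * ⟪ξ, y⟫)
  have hc' := Real.cos_le_one (2 * Real.pi * ⟪ξ, y⟫)
  have hsq := sq_nonneg (2 * Real.pi * ‖ξ‖)
  refine mul_min_of_le ?_ (norm_nonneg y) two_pos fun _ => ?_
  · rw [abs_of_nonneg (by linarith)]; linarith
  · have h1 := Real.one_sub_sq_div_two_le_cos (x := 2 * Real.pi * ⟪ξ, y⟫)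
    have h2 : ⟪ξ, y⟫ ^ 2 ≤ (‖ξ‖ * ‖y‖) ^ 2 := by
      rw [← sq_abs]
      exact pow_le_pow_left₀ (abs_nonneg _) (abs_real_inner_le_norm ξ y) 2
    rw [abs_of_nonneg (by linarith), Real.rpow_two]
    have h3 : (2 * Real.pi * ⟪ξ, y⟫) ^ 2 ≤ (2 * Real.pi * ‖ξ‖) ^ 2 * ‖y‖ ^ 2 := by
      have : 0 ≤ (2 * Real.pi) ^ 2 := by positivity
      calc _ = (2 * Real.pi) ^ 2 * ⟪ξ, y⟫ ^ 2 := by ring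
        _ ≤ (2 * Real.pi) ^ 2 * (‖ξ‖ * ‖y‖) ^ 2 := mul_le_mul_of_nonneg_left h2 this
        _ = _ := by ring
    nlinarith [sq_nonneg ‖y‖]

/-- The symbol of `-(∫ δ(·)(x,y) |y|^{-n-2s} dy)`. -/
def symbolInt {n : ℕ} (s : ℝ) (ξ : E n) : ℝ :=
  ∫ y : E n, (2 - 2 * Real.cos (2 * Real.pi * ⟪ξ, y⟫)) / ‖y‖ ^ ((n : ℝ) + 2 * s)

lemma integrable_symbol {n : ℕ} (hn : 1 ≤ n) {s : ℝ} (hs : 0 < s) (hs1 : s < 1) (ξ : E n) :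
    Integrable (fun y : E n =>
      (2 - 2 * Real.cos (2 * Real.pi * ⟪ξ, y⟫)) / ‖y‖ ^ ((n : ℝ) + 2 * s)) :=
  integrable_div_kernel hn (κ := 2) (by linarith) (by linarith)
    (Continuous.measurable (by fun_prop)) (abs_two_sub_two_cos_le ξ)

lemma symbolInt_pos {n : ℕ} (hn : 1 ≤ n) {s : ℝ} (hs : 0 < s) (hs1 : s < 1) {ξ : E n}
    (hξ : ‖ξ‖ = 1) : 0 < symbolInt s ξ := by
  have hnn : ∀ y : E n,
      0 ≤ (2 - 2 * Real.cos (2 * Real.pi * ⟪ξ, y⟫)) / ‖y‖ ^ ((n : ℝ) + 2 * s) := fun y => by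
    have := Real.cos_le_one (2 * Real.pi * ⟪ξ, y⟫)
    exact div_nonneg (by linarith) (by positivity)
  rw [symbolInt, integral_pos_iff_support_of_nonneg hnn (integrable_symbol hn hs hs1 ξ)]
  have hopen : IsOpen {y : E n | Real.cos (2 * Real.pi * ⟪ξ, y⟫) ≠ 1} :=
    isOpen_ne_fun (by fun_prop) continuous_const
  have hne : ({y : E n | Real.cos (2 * Real.pi * ⟪ξ, y⟫) ≠ 1}).Nonempty := by
    -- For a unit vector ξ the phase at ξ/2 equals π.
    refine ⟨(1 / 2 : ℝ) • ξ, ?_⟩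
    simp only [mem_ofPred_eq, inner_smul_right, real_inner_self_eq_norm_sq, hξ]
    rw [show 2 * Real.pi * (1 / 2 * 1 ^ 2) = Real.pi by ring, Real.cos_pi]
    norm_num
  refine (hopen.measure_pos volume hne).trans_le (measure_mono fun y hy => ?_)
  have hy0 : y ≠ 0 := fun h => hy (by simp [h])
  have : 0 < ‖y‖ ^ ((n : ℝ) + 2 * s) := Real.rpow_pos_of_pos (norm_pos_iff.2 hy0) _
  refine div_ne_zero (fun h => hy ?_) this.ne'
  linarith

/-- The reflection in the hyperplane orthogonal to ξ - η exchanges ξ and η and preserves volume and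
norms. -/
lemma symbolInt_eq_of_norm_eq {n : ℕ} {s : ℝ} {ξ η : E n} (h : ‖ξ‖ = ‖η‖) :
    symbolInt s ξ = symbolInt s η := by
  let R : E n ≃ₗᵢ[ℝ] E n := (Submodule.span ℝ {ξ - η})ᗮ.reflection
  have hR : R ξ = η := Submodule.reflection_sub h
  unfold symbolInt
  rw [← (R.measurePreserving).integral_comp R.toHomeomorph.measurableEmbedding
    (fun y : E n => (2 - 2 * Real.cos (2 * Real.pi * ⟪η, y⟫)) / ‖y‖ ^ ((n : ℝ) + 2 * s))]
  refine integral_congr_ae (Filter.Eventually.of_forall fun y => ?_)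
  simp only [R.norm_map]
  rw [← hR, R.inner_map_map]

lemma symbolInt_smul {n : ℕ} {s : ℝ} {ξ : E n} {ρ : ℝ} (hρ : 0 < ρ) :
    symbolInt s (ρ • ξ) = ρ ^ (2 * s) * symbolInt s ξ := by
  have h := Measure.integral_comp_smul (volume : Measure (E n))
    (fun y : E n => (2 - 2 * Real.cos (2 * Real.pi * ⟪ξ, y⟫)) / ‖y‖ ^ ((n : ℝ) + 2 * s)) ρ
  rw [finrank_euclideanSpace, Fintype.card_fin, smul_eq_mul,
    abs_of_pos (by positivity)] at h
  have h2 : symbolInt s (ρ • ξ) = ρ ^ ((n : ℝ) + 2 * s) * ∫ y : E n,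
      (2 - 2 * Real.cos (2 * Real.pi * ⟪ξ, ρ • y⟫)) / ‖ρ • y‖ ^ ((n : ℝ) + 2 * s) := by
    rw [symbolInt, ← integral_const_mul]
    refine integral_congr_ae (Filter.Eventually.of_forall fun y => ?_)
    simp only [norm_smul, Real.norm_eq_abs, abs_of_pos hρ, inner_smul_left, inner_smul_right]
    rw [Real.mul_rpow hρ.le (norm_nonneg y)]
    have : ρ ^ ((n : ℝ) + 2 * s) ≠ 0 := (Real.rpow_pos_of_pos hρ _).ne'
    simp only [conj_trivial]
    rw [← mul_div_assoc, mul_div_mul_left _ _ this]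
  rw [h2, h, Real.rpow_add hρ, Real.rpow_natCast, symbolInt]
  have : ρ ^ n ≠ 0 := (pow_pos hρ n).ne'
  field_simp

/-- The constant in the symbol of `fracLap`: it is `symbolConst n s * |ξ|^{2s}`. -/
def symbolConst (n : ℕ) (hn : 1 ≤ n) (s : ℝ) : ℝ :=
  fracConst n s / 2 * symbolInt s (EuclideanSpace.single (⟨0, hn⟩ : Fin n) (1 : ℝ))

lemma symbolConst_pos {n : ℕ} (hn : 1 ≤ n) {s : ℝ} (hs : 0 < s) (hs1 : s < 1) :
    0 < symbolConst n hn s :=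
  mul_pos (half_pos (fracConst_pos hs hs1)) (symbolInt_pos hn hs hs1 (by simp))

/-- Rotation invariance and homogeneity leave a single constant. Its value is irrelevant and only
its positivity counts, since the kernel built below divides by the symbol. -/
lemma symbolInt_eq {n : ℕ} (hn : 1 ≤ n) {s : ℝ} (hs : 0 < s) (ξ : E n) :
    fracConst n s / 2 * symbolInt s ξ = symbolConst n hn s * ‖ξ‖ ^ (2 * s) := by
  rcases eq_or_ne ξ 0 with rfl | hξ
  · simp [symbolInt, Real.zero_rpow (show 2 * s ≠ 0 by positivity)]
  · have h1 : symbolInt s ξ =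
        symbolInt s (‖ξ‖ • (EuclideanSpace.single (⟨0, hn⟩ : Fin n) (1 : ℝ))) :=
      symbolInt_eq_of_norm_eq (by simp [norm_smul])
    rw [h1, symbolInt_smul (norm_pos_iff.2 hξ), symbolConst]; ring

/-- The cosine transform. -/
def cosTransform {n : ℕ} (h : E n → ℝ) (x : E n) : ℝ :=
  ∫ ξ : E n, Real.cos (2 * Real.pi * ⟪ξ, x⟫) * h ξ

lemma integrable_cos_mul {n : ℕ} {h : E n → ℝ} (hh : Integrable h) (x : E n) :
    Integrable (fun ξ : E n => Real.cos (2 * Real.pi * ⟪ξ, x⟫) * h ξ) := by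
  refine hh.norm.mono' ((Continuous.aestronglyMeasurable (by fun_prop)).mul hh.1)
    (Filter.Eventually.of_forall fun ξ => ?_)
  rw [norm_mul, Real.norm_eq_abs, Real.norm_eq_abs]
  exact mul_le_of_le_one_left (abs_nonneg _) (Real.abs_cos_le_one _)

lemma secondDiff_cosTransform {n : ℕ} {h : E n → ℝ} (hh : Integrable h) (x y : E n) :
    secondDiff (cosTransform h) x y = ∫ ξ : E n,
      -(2 - 2 * Real.cos (2 * Real.pi * ⟪ξ, y⟫)) * (Real.cos (2 * Real.pi * ⟪ξ, x⟫) * h ξ) := by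
  unfold secondDiff cosTransform
  have hadd : Integrable (fun ξ : E n => Real.cos (2 * Real.pi * ⟪ξ, x + y⟫) * h ξ +
      Real.cos (2 * Real.pi * ⟪ξ, x - y⟫) * h ξ) :=
    (integrable_cos_mul hh _).add (integrable_cos_mul hh _)
  rw [← integral_add (integrable_cos_mul hh _) (integrable_cos_mul hh _), ← integral_const_mul,
    ← integral_sub hadd ((integrable_cos_mul hh _).const_mul 2)]
  refine integral_congr_ae (Filter.Eventually.of_forall fun ξ => ?_)
  simp only [inner_add_right, inner_sub_right, mul_add, mul_sub, Real.cos_add, Real.cos_sub]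
  ring

/-- The second difference of a cosine wave is a multiple of that wave, so after Fubini the
y-integral becomes the symbol. Compact support of `h` absorbs the quadratic growth in ξ of the
majorant. -/
lemma fracLap_cosTransform {n : ℕ} (hn : 1 ≤ n) {s : ℝ} (hs : 0 < s) (hs1 : s < 1) {h : E n → ℝ}
    (hc : Continuous h) (hcs : HasCompactSupport h) (x : E n) :
    fracLap s (cosTransform h) x =
      cosTransform (fun ξ => symbolConst n hn s * ‖ξ‖ ^ (2 * s) * h ξ) x := by
  have hh : Integrable h := hc.integrable_of_hasCompactSupport hcs
  have hw : Integrable (fun ξ : E n => (4 + (2 * Real.pi * ‖ξ‖) ^ 2) * |h ξ|) := by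
    refine Continuous.integrable_of_hasCompactSupport (by fun_prop) ?_
    exact HasCompactSupport.mul_left (hcs.comp_left (g := fun z : ℝ => |z|) (by simp))
  have hk := integrable_truncKernel hn (p := 2 * s) (κ := 2) (by linarith) (by linarith)
  have hint : Integrable (Function.uncurry fun y ξ : E n =>
      -(2 - 2 * Real.cos (2 * Real.pi * ⟪ξ, y⟫)) / ‖y‖ ^ ((n : ℝ) + 2 * s) *
        (Real.cos (2 * Real.pi * ⟪ξ, x⟫) * h ξ)) (volume.prod volume) := by
    refine (hk.mul_prod hw).mono' ?_ (Filter.Eventually.of_forall fun z => ?_)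
    · refine Measurable.aestronglyMeasurable ?_
      have : Measurable h := hc.measurable
      simp only [Function.uncurry_def]
      refine Measurable.mul (Measurable.div (Continuous.measurable (by fun_prop)) ?_)
        (Measurable.mul (Continuous.measurable (by fun_prop)) (this.comp measurable_snd))
      exact (measurable_fst.norm).pow_const _
    · simp only [Function.uncurry_def]
      rw [norm_mul, norm_mul, Real.norm_eq_abs (Real.cos _), Real.norm_eq_abs (h _)]
      have h1 : ‖-(2 - 2 * Real.cos (2 * Real.pi * ⟪z.2, z.1⟫)) / ‖z.1‖ ^ ((n : ℝ) + 2 * s)‖ ≤ _ :=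
        abs_div_kernel_le (κ := 2) (by rw [abs_neg]; exact abs_two_sub_two_cos_le z.2 z.1)
      have h2 := mul_le_of_le_one_left (abs_nonneg (h z.2))
        (Real.abs_cos_le_one (2 * Real.pi * ⟪z.2, x⟫))
      have h3 : 0 ≤ min (‖z.1‖ ^ (2:ℝ)) 1 / ‖z.1‖ ^ ((n : ℝ) + 2 * s) := by positivity
      calc _ ≤ _ := mul_le_mul h1 h2 (by positivity) (by positivity)
        _ = _ := by ring
  have hL : ∀ y : E n, secondDiff (cosTransform h) x y / ‖y‖ ^ ((n : ℝ) + 2 * s) =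
      ∫ ξ : E n, -(2 - 2 * Real.cos (2 * Real.pi * ⟪ξ, y⟫)) / ‖y‖ ^ ((n : ℝ) + 2 * s) *
        (Real.cos (2 * Real.pi * ⟪ξ, x⟫) * h ξ) := fun y => by
    rw [secondDiff_cosTransform hh, ← integral_div]
    refine integral_congr_ae (Filter.Eventually.of_forall fun ξ => ?_)
    simp only
    ring
  unfold fracLap
  simp only [hL]
  rw [integral_integral_swap hint, ← integral_const_mul]
  unfold cosTransform
  refine integral_congr_ae (Filter.Eventually.of_forall fun ξ => ?_)
  simp only
  rw [integral_mul_const, ← symbolInt_eq hn hs ξ, symbolInt]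
  simp only [neg_div]
  rw [integral_neg]
  ring

/-! ### Rapidly decaying kernels and a Littlewood–Paley pair -/

open scoped FourierTransform SchwartzMap

/-- The weight `(1 + |x|)^{-n-2}`. -/
def decay {n : ℕ} (x : E n) : ℝ := (1 + ‖x‖) ^ (-((n : ℝ) + 2))

lemma decay_pos {n : ℕ} (x : E n) : 0 < decay x := by
  unfold decay
  have := norm_nonneg x
  positivity

lemma decay_le_one {n : ℕ} (x : E n) : decay x ≤ 1 := by
  unfold decay
  exact Real.rpow_le_one_of_one_le_of_nonpos (by linarith [norm_nonneg x])
    (by have : (0 : ℝ) ≤ n := by positivity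
        linarith)

lemma measurable_decay {n : ℕ} : Measurable (decay : E n → ℝ) :=
  (measurable_const.add measurable_norm).pow_const _

lemma integrable_one_add_mul_decay {n : ℕ} :
    Integrable (fun x : E n => (1 + ‖x‖) * decay x) := by
  have h := integrable_one_add_norm (E := E n) (μ := volume) (r := (n : ℝ) + 1) (by simp)
  refine h.congr (Filter.Eventually.of_forall fun x => ?_)
  have h1 : 0 < 1 + ‖x‖ := by positivity
  unfold decay
  change (1 + ‖x‖) ^ (-((n : ℝ) + 1)) = (1 + ‖x‖) * (1 + ‖x‖) ^ (-((n : ℝ) + 2))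
  nth_rewrite 2 [← Real.rpow_one (1 + ‖x‖)]
  rw [← Real.rpow_add h1]
  congr 1; ring

lemma integrable_rpow_mul_decay {n : ℕ} {q : ℝ} (hq : 0 ≤ q) (hq1 : q ≤ 1) :
    Integrable (fun x : E n => ‖x‖ ^ q * decay x) := by
  refine integrable_one_add_mul_decay.mono'
    ((measurable_norm.pow_const _).mul measurable_decay).aestronglyMeasurable
    (Filter.Eventually.of_forall fun x => ?_)
  have h1 : 0 ≤ ‖x‖ ^ q := by positivity
  rw [Real.norm_of_nonneg (mul_nonneg h1 (decay_pos x).le)]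
  refine mul_le_mul_of_nonneg_right ?_ (decay_pos x).le
  calc ‖x‖ ^ q ≤ (1 + ‖x‖) ^ q :=
        Real.rpow_le_rpow (norm_nonneg x) (by linarith) hq
    _ ≤ (1 + ‖x‖) ^ (1 : ℝ) :=
        Real.rpow_le_rpow_of_exponent_le (by linarith [norm_nonneg x]) hq1
    _ = _ := Real.rpow_one _

lemma integrable_decay {n : ℕ} : Integrable (decay : E n → ℝ) := by
  simpa using integrable_rpow_mul_decay (n := n) le_rfl zero_le_one

/-- A shift of length at most one at most halves 1 + |x|, which makes the weight comparable along
short segments. -/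
lemma decay_add_le {n : ℕ} (x v : E n) (hv : ‖v‖ ≤ 1) :
    decay (x + v) ≤ 2 ^ ((n : ℝ) + 2) * decay x := by
  have h1 : (1 + ‖x‖) / 2 ≤ 1 + ‖x + v‖ := by
    have h2 := norm_sub_le (x + v) v
    rw [add_sub_cancel_right] at h2
    linarith [norm_nonneg (x + v)]
  have h0 : 0 < 1 + ‖x‖ := by positivity
  have hn : (0 : ℝ) ≤ (n : ℝ) + 2 := by positivity
  unfold decay
  calc (1 + ‖x + v‖) ^ (-((n : ℝ) + 2)) ≤ ((1 + ‖x‖) / 2) ^ (-((n : ℝ) + 2)) :=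
        Real.rpow_le_rpow_of_nonpos (by linarith) h1 (by linarith)
    _ = _ := by
      rw [Real.div_rpow h0.le zero_le_two, Real.rpow_neg zero_le_two, div_inv_eq_mul, mul_comm]

/-- A smooth function that decays like `(1 + |x|)^{-n-2}` with its first two derivatives. -/
structure DecayKernel {n : ℕ} (C : ℝ) (K : E n → ℝ) : Prop where
  smooth : ContDiff ℝ ∞ K
  bound : ∀ x, |K x| ≤ C * decay x
  bound_fderiv : ∀ x, ‖fderiv ℝ K x‖ ≤ C * decay x
  taylor : ∀ x v, ‖v‖ ≤ 1 → |K (x + v) - K x - fderiv ℝ K x v| ≤ C * ‖v‖ ^ 2 * decay x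

lemma DecayKernel.nonneg {n : ℕ} {C : ℝ} {K : E n → ℝ} (h : DecayKernel C K) : 0 ≤ C :=
  nonneg_of_mul_nonneg_left ((abs_nonneg _).trans (h.bound 0)) (decay_pos 0)

lemma DecayKernel.integrable {n : ℕ} {C : ℝ} {K : E n → ℝ} (h : DecayKernel C K) :
    Integrable K :=
  (integrable_decay.const_mul C).mono' h.smooth.continuous.aestronglyMeasurable
    (Filter.Eventually.of_forall h.bound)

lemma taylor_bound_of_fderiv2 {n : ℕ} {K : E n → ℝ} (hK : ContDiff ℝ 2 K) {x v : E n}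
    {B : ℝ} (hB : ∀ z ∈ segment ℝ x (x + v), ‖fderiv ℝ (fderiv ℝ K) z‖ ≤ B) :
    |K (x + v) - K x - fderiv ℝ K x v| ≤ B * ‖v‖ ^ 2 := by
  have hd : Differentiable ℝ K := hK.differentiable (by norm_num)
  have hd2 : Differentiable ℝ (fderiv ℝ K) :=
    (hK.fderiv_right (m := 1) (by norm_num)).differentiable (by norm_num)
  have hB0 : 0 ≤ B := (norm_nonneg (fderiv ℝ (fderiv ℝ K) x)).trans (hB x (left_mem_segment ℝ x _))
  have h1 : ∀ z ∈ segment ℝ x (x + v), ‖fderiv ℝ K z - fderiv ℝ K x‖ ≤ B * ‖v‖ := by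
    intro z hz
    have h2 := (convex_segment x (x + v)).norm_image_sub_le_of_norm_fderiv_le (𝕜 := ℝ)
      (fun z _ => hd2 z) hB (left_mem_segment ℝ x _) hz
    refine h2.trans (mul_le_mul_of_nonneg_left ?_ hB0)
    have h3 := norm_sub_le_of_mem_segment hz
    simpa using h3
  have h4 := (convex_segment x (x + v)).norm_image_sub_le_of_norm_fderiv_le' (𝕜 := ℝ)
    (fun z _ => hd z) h1 (left_mem_segment ℝ x _) (right_mem_segment ℝ x _)
  rw [add_sub_cancel_left, Real.norm_eq_abs] at h4
  calc _ ≤ _ := h4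
    _ = _ := by ring

/-- The seminorms with weight (1+|x|)^{n+2} bound the derivatives of order 0, 1 and 2. The Taylor
remainder uses the second derivative along the segment, where `decay_add_le` returns the weight to
the base point. -/
lemma exists_decayKernel_schwartz {n : ℕ} (f : 𝓢(E n, ℝ)) : ∃ C, DecayKernel C (f : E n → ℝ) := by
  have hb : ∀ m : ℕ, ∃ C, 0 ≤ C ∧ ∀ x, ‖iteratedFDeriv ℝ m f x‖ ≤ C * decay x := by
    intro m
    refine ⟨2 ^ (n + 2) *
      (Finset.Iic (n + 2, m)).sup (fun m => SchwartzMap.seminorm ℝ m.1 m.2) f,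
      by positivity, fun x => ?_⟩
    have h := SchwartzMap.one_add_le_sup_seminorm_apply (𝕜 := ℝ) (m := (n + 2, m)) (k := n + 2)
      (n := m) le_rfl le_rfl f x
    have h0 : 0 < 1 + ‖x‖ := by positivity
    have hd : decay x = ((1 + ‖x‖) ^ (n + 2))⁻¹ := by
      unfold decay
      rw [Real.rpow_neg h0.le, ← Real.rpow_natCast]; push_cast; rfl
    rw [hd, ← div_eq_mul_inv, le_div_iff₀ (by positivity), mul_comm]
    exact h
  obtain ⟨C0, h00, h0⟩ := hb 0
  obtain ⟨C1, h10, h1⟩ := hb 1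
  obtain ⟨C2, h20, h2⟩ := hb 2
  have hn2 : (1 : ℝ) ≤ 2 ^ ((n : ℝ) + 2) := Real.one_le_rpow (by norm_num) (by positivity)
  have hmono : ∀ {a : ℝ} (x : E n), a ≤ C0 + C1 + C2 * 2 ^ ((n : ℝ) + 2) →
      a * decay x ≤ (C0 + C1 + C2 * 2 ^ ((n : ℝ) + 2)) * decay x :=
    fun x ha => mul_le_mul_of_nonneg_right ha (decay_pos x).le
  have hp : 0 ≤ C2 * 2 ^ ((n : ℝ) + 2) := by positivity
  refine ⟨C0 + C1 + C2 * 2 ^ ((n : ℝ) + 2), f.smooth ⊤, fun x => ?_, fun x => ?_,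
    fun x v hv => ?_⟩
  · have := h0 x
    rw [norm_iteratedFDeriv_zero, Real.norm_eq_abs] at this
    exact this.trans (hmono x (by linarith))
  · have := h1 x
    rw [norm_iteratedFDeriv_one] at this
    exact this.trans (hmono x (by linarith))
  · have hB : ∀ z ∈ segment ℝ x (x + v),
        ‖fderiv ℝ (fderiv ℝ (f : E n → ℝ)) z‖ ≤ C2 * (2 ^ ((n : ℝ) + 2) * decay x) := by
      intro z hz
      rw [← norm_iteratedFDeriv_one, norm_iteratedFDeriv_fderiv]
      refine (h2 z).trans (mul_le_mul_of_nonneg_left ?_ h20)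
      have h3 := norm_sub_le_of_mem_segment hz
      rw [add_sub_cancel_left] at h3
      have h4 := decay_add_le x (z - x) (h3.trans hv)
      rwa [add_sub_cancel] at h4
    have h5 := taylor_bound_of_fderiv2 ((f.smooth ⊤).of_le ENat.LEInfty.out) hB
    refine h5.trans ?_
    have := hmono (a := C2 * 2 ^ ((n : ℝ) + 2)) x (by linarith)
    have h6 := mul_le_mul_of_nonneg_right this (sq_nonneg ‖v‖)
    calc _ ≤ _ := le_of_eq (by ring)
      _ ≤ _ := h6
      _ = _ := by ring

/-- For real `h` the cosine transform is the real part of the inverse Fourier transform, hence of a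
Schwartz function; its integral is found by Fourier inversion at the origin. -/
lemma cosTransform_eq_re {n : ℕ} {h : E n → ℝ} (hc : ContDiff ℝ ∞ h) (hcs : HasCompactSupport h) :
    ∃ F : 𝓢(E n, ℂ), (∀ x, cosTransform h x = (F x).re) ∧ ∫ x, F x = (h 0 : ℂ) := by
  have hcs' : HasCompactSupport (fun x => (h x : ℂ)) :=
    hcs.comp_left (g := fun z : ℝ => (z : ℂ)) (by simp)
  have hc' : ContDiff ℝ ∞ (fun x => (h x : ℂ)) := Complex.ofRealCLM.contDiff.comp hc
  let H : 𝓢(E n, ℂ) := hcs'.toSchwartzMap hc'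
  have hH : ∀ x, H x = (h x : ℂ) := fun x => rfl
  refine ⟨𝓕⁻ H, fun x => ?_, ?_⟩
  · rw [SchwartzMap.fourierInv_coe, Real.fourierInv_eq', cosTransform]
    have hi : Integrable (fun v : E n =>
        Complex.exp (↑(2 * Real.pi * ⟪v, x⟫) * Complex.I) • H v) := by
      refine H.integrable.norm.mono' ?_ (Filter.Eventually.of_forall fun v => ?_)
      · refine Continuous.aestronglyMeasurable ?_
        have := H.continuous
        fun_prop
      · rw [norm_smul, Complex.norm_exp_ofReal_mul_I, one_mul]
    rw [← RCLike.re_eq_complex_re, ← integral_re hi]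
    refine integral_congr_ae (Filter.Eventually.of_forall fun v => ?_)
    simp only [hH, smul_eq_mul, RCLike.re_eq_complex_re, Complex.re_mul_ofReal,
      Complex.exp_ofReal_mul_I_re]
  · have h1 : 𝓕 (𝓕⁻ H) = H := FourierTransform.fourier_fourierInv_eq H
    have h2 : (𝓕 (𝓕⁻ H) : 𝓢(E n, ℂ)) 0 = ∫ x, (𝓕⁻ H : 𝓢(E n, ℂ)) x := by
      rw [SchwartzMap.fourier_coe, Real.fourier_eq']
      simp
    rw [← h2, h1, hH]

lemma exists_decayKernel_cosTransform {n : ℕ} {h : E n → ℝ} (hc : ContDiff ℝ ∞ h)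
    (hcs : HasCompactSupport h) :
    (∃ C, DecayKernel C (cosTransform h)) ∧ ∫ x, cosTransform h x = h 0 := by
  obtain ⟨F, hF, hF0⟩ := cosTransform_eq_re hc hcs
  have hre : (SchwartzMap.postcompCLM (𝕜 := ℝ) Complex.reCLM F : E n → ℝ) = cosTransform h := by
    ext x
    rw [SchwartzMap.postcompCLM_apply, hF, Complex.reCLM_apply]
  constructor
  · rw [← hre]
    exact exists_decayKernel_schwartz _
  · have h1 := integral_re (F.integrable (μ := volume))
    rw [hF0] at h1
    simp only [hF]
    simpa using h1

lemma cosTransform_comp_two_smul {n : ℕ} (h : E n → ℝ) (x : E n) :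
    cosTransform (fun ξ => h ((2 : ℝ) • ξ)) x =
      ((2 : ℝ) ^ n)⁻¹ * cosTransform h ((1 / 2 : ℝ) • x) := by
  have h1 := Measure.integral_comp_smul (volume : Measure (E n))
    (fun ξ : E n => Real.cos (2 * Real.pi * ⟪ξ, (1 / 2 : ℝ) • x⟫) * h ξ) 2
  rw [finrank_euclideanSpace, Fintype.card_fin, smul_eq_mul, abs_of_pos (by positivity)] at h1
  unfold cosTransform
  rw [← h1]
  refine integral_congr_ae (Filter.Eventually.of_forall fun ξ => ?_)
  simp only [inner_smul_left, inner_smul_right, conj_trivial]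
  congr 3
  ring

/-- A pair of kernels `Θ`, `K` with `∫ Θ = 1`, `∫ K = 0` such that `(-Δ)^s K` is the difference
of `Θ` and its dyadic dilate. -/
structure LittlewoodPaley {n : ℕ} (s C : ℝ) (Θ K : E n → ℝ) : Prop where
  decayΘ : DecayKernel C Θ
  decayK : DecayKernel C K
  integralΘ : ∫ x, Θ x = 1
  integralK : ∫ x, K x = 0
  fracLap_eq : ∀ x, fracLap s K x = Θ x - ((2 : ℝ) ^ n)⁻¹ * Θ ((1 / 2 : ℝ) • x)

lemma DecayKernel.mono {n : ℕ} {C C' : ℝ} {K : E n → ℝ} (h : DecayKernel C K) (hC : C ≤ C') :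
    DecayKernel C' K where
  smooth := h.smooth
  bound x := (h.bound x).trans (mul_le_mul_of_nonneg_right hC (decay_pos x).le)
  bound_fderiv x := (h.bound_fderiv x).trans (mul_le_mul_of_nonneg_right hC (decay_pos x).le)
  taylor x v hv := (h.taylor x v hv).trans
    (mul_le_mul_of_nonneg_right (mul_le_mul_of_nonneg_right hC (sq_nonneg _)) (decay_pos x).le)

/-- For a cutoff θ equal to 1 on the unit ball, χ(ξ) = θ(ξ) - θ(2ξ) vanishes for |ξ| ≤ 1/2, so its
quotient by the symbol is smooth with compact support. Θ and K are the cosine transforms of θ and of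
this quotient; their integrals are the values of these functions at 0, namely 1 and 0. -/
lemma exists_littlewoodPaley {n : ℕ} (hn : 1 ≤ n) {s : ℝ} (hs : 0 < s) (hs1 : s < 1) :
    ∃ (C : ℝ) (Θ K : E n → ℝ), LittlewoodPaley s C Θ K := by
  let θ : ContDiffBump (0 : E n) := ⟨1, 2, one_pos, one_lt_two⟩
  have hθ : ContDiff ℝ ∞ (θ : E n → ℝ) := θ.contDiff
  have hθcs : HasCompactSupport (θ : E n → ℝ) := θ.hasCompactSupport
  have hθ1 : ∀ x : E n, ‖x‖ ≤ 1 → θ x = 1 := fun x hx =>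
    θ.one_of_mem_closedBall (by simpa [θ] using hx)
  let χ : E n → ℝ := fun ξ => θ ξ - θ ((2 : ℝ) • ξ)
  have hθ2 : ContDiff ℝ ∞ (fun ξ : E n => θ ((2 : ℝ) • ξ)) :=
    hθ.comp (contDiff_const_smul (2 : ℝ))
  have hθ2cs : HasCompactSupport (fun ξ : E n => θ ((2 : ℝ) • ξ)) :=
    hθcs.comp_smul two_ne_zero
  have hχ : ContDiff ℝ ∞ χ := hθ.sub hθ2
  have hχcs : HasCompactSupport χ := hθcs.sub hθ2cs
  have hχ0 : ∀ x : E n, ‖x‖ ≤ 1 / 2 → χ x = 0 := fun x hx => by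
    have h1 : ‖(2 : ℝ) • x‖ ≤ 1 := by rw [norm_smul, Real.norm_two]; linarith
    simp only [χ, hθ1 x (by linarith), hθ1 _ h1, sub_self]
  have hc0 := symbolConst_pos hn hs hs1
  let h : E n → ℝ := fun ξ => (symbolConst n hn s * ‖ξ‖ ^ (2 * s))⁻¹ * χ ξ
  have hh : ContDiff ℝ ∞ h := by
    rw [contDiff_iff_contDiffAt]
    intro ξ
    by_cases hξ : ξ = 0
    · have : h =ᶠ[𝓝 ξ] fun _ => 0 := by
        have hb : Metric.ball (0 : E n) (1 / 2) ∈ 𝓝 ξ := by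
          rw [hξ]; exact Metric.ball_mem_nhds _ (by norm_num)
        filter_upwards [hb] with z hz
        rw [mem_ball_zero_iff] at hz
        simp only [h, hχ0 z hz.le, mul_zero]
      exact contDiffAt_const.congr_of_eventuallyEq this
    · have hpos : 0 < ‖ξ‖ := norm_pos_iff.2 hξ
      refine ContDiffAt.mul (ContDiffAt.inv (contDiffAt_const.mul ?_) ?_) hχ.contDiffAt
      · exact (contDiffAt_norm ℝ hξ).rpow_const_of_ne hpos.ne'
      · have := Real.rpow_pos_of_pos hpos (2 * s)
        positivity
  have hhcs : HasCompactSupport h := hχcs.mul_left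
  obtain ⟨⟨C1, hC1⟩, hi1⟩ := exists_decayKernel_cosTransform hθ hθcs
  obtain ⟨⟨C2, hC2⟩, hi2⟩ := exists_decayKernel_cosTransform hh hhcs
  refine ⟨max C1 C2, cosTransform θ, cosTransform h, hC1.mono (le_max_left _ _),
    hC2.mono (le_max_right _ _), ?_, ?_, fun x => ?_⟩
  · rw [hi1]; exact hθ1 0 (by simp)
  · rw [hi2]; simp only [h, hχ0 0 (by simp), mul_zero]
  · rw [fracLap_cosTransform hn hs hs1 hh.continuous hhcs, ← cosTransform_comp_two_smul]
    unfold cosTransform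
    rw [← integral_sub (integrable_cos_mul (hθ.continuous.integrable_of_hasCompactSupport hθcs) x)
      (integrable_cos_mul (hθ2.continuous.integrable_of_hasCompactSupport hθ2cs) x)]
    refine integral_congr_ae (Filter.Eventually.of_forall fun ξ => ?_)
    simp only
    rw [← mul_sub]
    congr 1
    change symbolConst n hn s * ‖ξ‖ ^ (2 * s) * ((symbolConst n hn s * ‖ξ‖ ^ (2 * s))⁻¹ * χ ξ) = χ ξ
    by_cases hξ : ξ = 0
    · rw [hξ, hχ0 0 (by simp), mul_zero, mul_zero]
    · have := Real.rpow_pos_of_pos (norm_pos_iff.2 hξ) (2 * s)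
      rw [← mul_assoc, mul_inv_cancel₀ (by positivity), one_mul]

end CosTransform

/-! ### Symmetry of the fractional Laplacian and non-compact test kernels -/

lemma integrable_comp_add_mul {n : ℕ} {f k : E n → ℝ} (hf : Integrable f) (hfm : Measurable f)
    (hk : Integrable k) (hkm : Measurable k) (c : ℝ) :
    Integrable (fun z : E n × E n => f (z.1 + c • z.2) * k z.2) (volume.prod volume) := by
  have hm : Measurable (fun z : E n × E n => f (z.1 + c • z.2) * k z.2) :=
    (hfm.comp (measurable_fst.add (measurable_snd.const_smul c))).mul (hkm.comp measurable_snd)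
  rw [integrable_prod_iff' hm.aestronglyMeasurable]
  constructor
  · exact Filter.Eventually.of_forall fun y => (hf.comp_add_right (c • y)).mul_const (k y)
  · have : ∀ y : E n, ∫ x : E n, ‖f (x + c • y) * k y‖ = (∫ x : E n, ‖f x‖) * ‖k y‖ := fun y => by
      simp only [norm_mul]
      rw [integral_mul_const, integral_add_right_eq_self (fun x => ‖f x‖) (c • y)]
    simp only [this]
    exact hk.norm.const_mul _

/-- The weight that controls second differences of rapidly decaying functions. -/
def diffWeight {n : ℕ} (x y : E n) : ℝ :=
  (decay x + decay (x + y) + decay (x - y)) * min (‖y‖ ^ (2 : ℝ)) 1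

lemma integrable_diffWeight_div {n : ℕ} (hn : 1 ≤ n) {s : ℝ} (hs : 0 < s) (hs1 : s < 1) :
    Integrable (fun z : E n × E n => diffWeight z.1 z.2 / ‖z.2‖ ^ ((n : ℝ) + 2 * s))
      (volume.prod volume) := by
  have hk := integrable_truncKernel hn (p := 2 * s) (κ := 2) (by linarith) (by linarith)
  have hkm : Measurable (fun y : E n => min (‖y‖ ^ (2 : ℝ)) 1 / ‖y‖ ^ ((n : ℝ) + 2 * s)) :=
    ((measurable_norm.pow_const _).min measurable_const).div (measurable_norm.pow_const _)
  have h (c : ℝ) := integrable_comp_add_mul integrable_decay measurable_decay hk hkm c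
  refine (((h 0).add (h 1)).add (h (-1))).congr (Filter.Eventually.of_forall fun z => ?_)
  simp only [Pi.add_apply, zero_smul, add_zero, one_smul, neg_smul, diffWeight, ← sub_eq_add_neg]
  ring

lemma integrable_mul_secondDiff_div {n : ℕ} (hn : 1 ≤ n) {s : ℝ} (hs : 0 < s) (hs1 : s < 1)
    {u φ : E n → ℝ} {A C : ℝ} (hu : Measurable u) (hA : ∀ x, |u x| ≤ A) (hφ : Measurable φ)
    (hC : ∀ x y, |secondDiff φ x y| ≤ C * diffWeight x y) :
    Integrable (fun z : E n × E n =>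
      u z.1 * (secondDiff φ z.1 z.2 / ‖z.2‖ ^ ((n : ℝ) + 2 * s))) (volume.prod volume) := by
  refine ((integrable_diffWeight_div hn hs hs1).const_mul (A * C)).mono' ?_
    (Filter.Eventually.of_forall fun z => ?_)
  · refine Measurable.aestronglyMeasurable ?_
    unfold secondDiff
    refine (hu.comp measurable_fst).mul (Measurable.div ?_ (measurable_snd.norm.pow_const _))
    exact ((hφ.comp (measurable_fst.add measurable_snd)).add
      (hφ.comp (measurable_fst.sub measurable_snd))).sub
        ((hφ.comp measurable_fst).const_mul 2)
  · have h0 : 0 ≤ ‖z.2‖ ^ ((n : ℝ) + 2 * s) := by positivity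
    have hA0 : 0 ≤ A := (abs_nonneg _).trans (hA 0)
    rw [norm_mul, norm_div, Real.norm_eq_abs, Real.norm_eq_abs, Real.norm_of_nonneg h0]
    calc _ ≤ A * (C * diffWeight z.1 z.2 / ‖z.2‖ ^ ((n : ℝ) + 2 * s)) :=
          mul_le_mul (hA _) (div_le_div_of_nonneg_right (hC _ _) h0) (by positivity) hA0
      _ = _ := by ring

lemma integral_mul_fracLap {n : ℕ} (hn : 1 ≤ n) {s : ℝ} (hs : 0 < s) (hs1 : s < 1)
    {u φ : E n → ℝ} {A C : ℝ} (hu : Measurable u) (hA : ∀ x, |u x| ≤ A) (hφ : Measurable φ)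
    (hC : ∀ x y, |secondDiff φ x y| ≤ C * diffWeight x y) :
    ∫ x, u x * fracLap s φ x = -(fracConst n s / 2) * ∫ z : E n × E n,
      u z.1 * (secondDiff φ z.1 z.2 / ‖z.2‖ ^ ((n : ℝ) + 2 * s)) ∂(volume.prod volume) := by
  rw [integral_prod _ (integrable_mul_secondDiff_div hn hs hs1 hu hA hφ hC), ← integral_const_mul]
  refine integral_congr_ae (Filter.Eventually.of_forall fun x => ?_)
  simp only [fracLap, integral_const_mul]
  ring

/-- For fixed y the second difference is a symmetric combination of translations, and translations
change sides by invariance of Lebesgue measure. -/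
lemma integral_mul_secondDiff {n : ℕ} {u φ : E n → ℝ} {A : ℝ} (hu : Measurable u)
    (hA : ∀ x, |u x| ≤ A) (hφ : Integrable φ) (y : E n) :
    ∫ x, u x * secondDiff φ x y = ∫ x, secondDiff u x y * φ x := by
  have hi : ∀ (c d : E n), Integrable (fun x => u (x + c) * φ (x + d)) := fun c d =>
    (hφ.comp_add_right d).bdd_mul (c := A)
      (hu.comp (measurable_add_const c)).aestronglyMeasurable
      (Filter.Eventually.of_forall fun x => hA _)
  have hz : ∀ (c d : E n), ∫ x, u (x + c) * φ (x + d) = ∫ x, u (x + (c - d)) * φ x := fun c d => by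
    have := integral_add_right_eq_self (μ := volume) (fun x => u (x + (c - d)) * φ x) d
    rw [← this]
    refine integral_congr_ae (Filter.Eventually.of_forall fun x => ?_)
    simp only [add_assoc, add_sub_cancel]
  have h1 : ∀ x, u x * secondDiff φ x y =
      u (x + 0) * φ (x + y) + u (x + 0) * φ (x + -y) - 2 * (u (x + 0) * φ (x + 0)) := fun x => by
    simp only [secondDiff, add_zero, ← sub_eq_add_neg]; ring
  have h2 : ∀ x, secondDiff u x y * φ x =
      u (x + y) * φ (x + 0) + u (x + -y) * φ (x + 0) - 2 * (u (x + 0) * φ (x + 0)) := fun x => by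
    simp only [secondDiff, add_zero, ← sub_eq_add_neg]; ring
  simp only [h1, h2]
  have a1 : Integrable (fun x => u (x + 0) * φ (x + y) + u (x + 0) * φ (x + -y)) :=
    (hi 0 y).add (hi 0 (-y))
  have a2 : Integrable (fun x => u (x + y) * φ (x + 0) + u (x + -y) * φ (x + 0)) :=
    (hi y 0).add (hi (-y) 0)
  rw [integral_sub a1 ((hi 0 0).const_mul 2), integral_sub a2 ((hi 0 0).const_mul 2),
    integral_add (hi _ _) (hi _ _), integral_add (hi _ _) (hi _ _), hz 0 y, hz 0 (-y), hz y 0,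
    hz (-y) 0]
  simp only [zero_sub, sub_zero, neg_neg]
  ring

/-- Fubini on both sides reduces the identity to `integral_mul_secondDiff` for each y. Integrability
in x always comes from `φ`, since `u` is merely bounded; in y it comes from the second differences
of `φ` on one side and of `u` on the other. -/
lemma integral_fracLap_symm {n : ℕ} (hn : 1 ≤ n) {s κ : ℝ} (hs : 0 < s) (hs1 : s < 1)
    (hκ : 2 * s < κ) {u φ : E n → ℝ} {A B C : ℝ} (hu : Measurable u) (hA : ∀ x, |u x| ≤ A)
    (hB : ∀ x y, |secondDiff u x y| ≤ B * min (‖y‖ ^ κ) 1)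
    (hφ : Measurable φ) (hφi : Integrable φ)
    (hC : ∀ x y, |secondDiff φ x y| ≤ C * diffWeight x y) :
    ∫ x, u x * fracLap s φ x = ∫ x, fracLap s u x * φ x := by
  rw [integral_mul_fracLap hn hs hs1 hu hA hφ hC,
    integral_prod_symm _ (integrable_mul_secondDiff_div hn hs hs1 hu hA hφ hC)]
  have hk := integrable_truncKernel hn (p := 2 * s) (κ := κ) (by linarith) hκ
  have hint : Integrable (fun z : E n × E n =>
      secondDiff u z.1 z.2 / ‖z.2‖ ^ ((n : ℝ) + 2 * s) * φ z.1) (volume.prod volume) := by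
    refine ((hφi.norm).mul_prod (hk.const_mul B)).mono' ?_ (Filter.Eventually.of_forall fun z => ?_)
    · refine Measurable.aestronglyMeasurable ?_
      unfold secondDiff
      refine (Measurable.div ?_ (measurable_snd.norm.pow_const _)).mul (hφ.comp measurable_fst)
      exact ((hu.comp (measurable_fst.add measurable_snd)).add
        (hu.comp (measurable_fst.sub measurable_snd))).sub
          ((hu.comp measurable_fst).const_mul 2)
    · rw [norm_mul, mul_comm]
      exact mul_le_mul_of_nonneg_left (abs_div_kernel_le (hB _ _)) (norm_nonneg _)
  have h1 : ∀ y : E n, ∫ x, u x * (secondDiff φ x y / ‖y‖ ^ ((n : ℝ) + 2 * s)) =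
      ∫ x, secondDiff u x y / ‖y‖ ^ ((n : ℝ) + 2 * s) * φ x := fun y => by
    have := integral_mul_secondDiff hu hA hφi y
    have h2 := congrArg (fun t => t * (‖y‖ ^ ((n : ℝ) + 2 * s))⁻¹) this
    simp only [← integral_mul_const] at h2
    refine Eq.trans (integral_congr_ae (Filter.Eventually.of_forall fun x => ?_))
      (h2.trans (integral_congr_ae (Filter.Eventually.of_forall fun x => ?_)))
    · simp only [div_eq_mul_inv]; ring
    · simp only [div_eq_mul_inv]; ring
  simp only [h1]
  rw [← integral_prod_symm _ hint, integral_prod _ hint, ← integral_const_mul]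
  refine integral_congr_ae (Filter.Eventually.of_forall fun x => ?_)
  simp only [fracLap, integral_mul_const]
  ring

lemma DecayKernel.diff_le {n : ℕ} {C : ℝ} {K : E n → ℝ} (h : DecayKernel C K) (x : E n) {v : E n}
    (hv : ‖v‖ ≤ 1) : |K (x + v) - K x| ≤ 2 * C * ‖v‖ * decay x := by
  have h1 := h.taylor x v hv
  have h2 : |fderiv ℝ K x v| ≤ C * decay x * ‖v‖ :=
    ((fderiv ℝ K x).le_opNorm v).trans
      (mul_le_mul_of_nonneg_right (h.bound_fderiv x) (norm_nonneg v))
  have h3 : C * ‖v‖ ^ 2 * decay x ≤ C * ‖v‖ * decay x := by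
    refine mul_le_mul_of_nonneg_right (mul_le_mul_of_nonneg_left ?_ h.nonneg) (decay_pos x).le
    nlinarith [norm_nonneg v]
  rw [abs_le] at h1 h2 ⊢
  constructor <;> linarith

lemma DecayKernel.secondDiff_le {n : ℕ} {C : ℝ} {K : E n → ℝ} (h : DecayKernel C K) (x : E n)
    {v : E n} (hv : ‖v‖ ≤ 1) : |secondDiff K x v| ≤ 2 * C * ‖v‖ ^ 2 * decay x := by
  have h1 := h.taylor x v hv
  have h2 := h.taylor x (-v) (by rwa [norm_neg])
  rw [norm_neg, map_neg, ← sub_eq_add_neg] at h2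
  unfold secondDiff
  rw [abs_le] at h1 h2 ⊢
  constructor <;> linarith

lemma DecayKernel.abs_le {n : ℕ} {C : ℝ} {K : E n → ℝ} (h : DecayKernel C K) (x : E n) :
    |K x| ≤ C :=
  (h.bound x).trans (mul_le_of_le_one_right h.nonneg (decay_le_one x))

lemma DecayKernel.diff_le' {n : ℕ} {C : ℝ} {K : E n → ℝ} (h : DecayKernel C K) (x v : E n) :
    |K (x + v) - K x| ≤ 2 * C * ‖v‖ := by
  have h0 := h.nonneg
  rcases le_total ‖v‖ 1 with hv | hv
  · exact (h.diff_le x hv).trans (mul_le_of_le_one_right (by positivity) (decay_le_one x))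
  · have h1 := h.abs_le x
    have h2 := h.abs_le (x + v)
    have h3 : C * 1 ≤ C * ‖v‖ := mul_le_mul_of_nonneg_left hv h0
    rw [_root_.abs_le] at h1 h2 ⊢
    constructor <;> linarith

lemma DecayKernel.secondDiff_le' {n : ℕ} {C : ℝ} {K : E n → ℝ} (h : DecayKernel C K) (x v : E n) :
    |secondDiff K x v| ≤ 4 * C * min (‖v‖ ^ (2 : ℝ)) 1 := by
  have h0 := h.nonneg
  refine mul_min_of_le ?_ (norm_nonneg v) two_pos fun hv => ?_
  · have h1 := h.abs_le x
    have h2 := h.abs_le (x + v)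
    have h3 := h.abs_le (x - v)
    unfold secondDiff
    rw [_root_.abs_le] at h1 h2 h3 ⊢
    constructor <;> linarith
  · rw [Real.rpow_two]
    refine (h.secondDiff_le x hv).trans ?_
    have : 0 ≤ C * ‖v‖ ^ 2 := by positivity
    nlinarith [decay_le_one x, decay_pos x]

lemma secondDiff_mul {n : ℕ} (f g : E n → ℝ) (x y : E n) :
    secondDiff (fun z => f z * g z) x y = f x * secondDiff g x y + g x * secondDiff f x y +
      (f (x + y) - f x) * (g (x + y) - g x) + (f (x - y) - f x) * (g (x - y) - g x) := by
  unfold secondDiff; ring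

/-- The discrete product rule of `secondDiff_mul` gives, for |y| ≤ 1, four terms with constants 2,
4, 4 and 4, whence 14. The bound is uniform in the scale 0 ≤ a ≤ 1 of the cutoff, as dominated
convergence requires. -/
lemma DecayKernel.secondDiff_cutoff_le {n : ℕ} {C D : ℝ} {K η : E n → ℝ} (hK : DecayKernel C K)
    (hη : DecayKernel D η) {a : ℝ} (ha : 0 ≤ a) (ha1 : a ≤ 1) (x y : E n) :
    |secondDiff (fun z => η (a • z) * K z) x y| ≤ 14 * (D * C) * diffWeight x y := by
  have hC := hK.nonneg
  have hD := hη.nonneg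
  have d0 := decay_pos x
  have d1 := decay_pos (x + y)
  have d2 := decay_pos (x - y)
  have hDC : 0 ≤ D * C := mul_nonneg hD hC
  have hw : ∀ z, |η (a • z) * K z| ≤ D * C * decay z := fun z => by
    rw [abs_mul, mul_assoc]
    exact mul_le_mul (hη.abs_le _) (hK.bound z) (abs_nonneg _) hD
  unfold diffWeight
  rw [← mul_assoc]
  refine mul_min_of_le ?_ (norm_nonneg y) two_pos fun hy => ?_
  · have h0 := hw x
    have h1 := hw (x + y)
    have h2 := hw (x - y)
    have p0 := mul_nonneg hDC d0.le
    have p1 := mul_nonneg hDC d1.le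
    have p2 := mul_nonneg hDC d2.le
    unfold secondDiff
    rw [_root_.abs_le] at h0 h1 h2 ⊢
    constructor <;> linarith
  · rw [secondDiff_mul, Real.rpow_two]
    have hay : ‖a • y‖ ≤ ‖y‖ := by
      rw [norm_smul, Real.norm_of_nonneg ha]
      exact mul_le_of_le_one_left (norm_nonneg y) ha1
    have e1 : ∀ y : E n, ‖a • y‖ ≤ ‖y‖ → |η (a • (x + y)) - η (a • x)| ≤ 2 * D * ‖y‖ := fun y hy => by
      rw [smul_add]
      exact (hη.diff_le' _ _).trans (mul_le_mul_of_nonneg_left hy (by positivity))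
    have e2 : |secondDiff (fun z => η (a • z)) x y| ≤ 4 * D * ‖y‖ ^ 2 := by
      have h1 := hη.secondDiff_le' (a • x) (a • y)
      have h2 : min (‖a • y‖ ^ (2 : ℝ)) 1 ≤ ‖y‖ ^ 2 := by
        rw [Real.rpow_two]
        exact (min_le_left _ _).trans (pow_le_pow_left₀ (norm_nonneg _) hay 2)
      have h3 : secondDiff (fun z => η (a • z)) x y = secondDiff η (a • x) (a • y) := by
        simp only [secondDiff, smul_add, smul_sub]
      rw [h3]
      exact h1.trans (mul_le_mul_of_nonneg_left h2 (by positivity))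
    have b1 : |η (a • x) * secondDiff K x y| ≤ D * (2 * C * ‖y‖ ^ 2 * decay x) := by
      rw [abs_mul]
      exact mul_le_mul (hη.abs_le _) (hK.secondDiff_le x hy) (abs_nonneg _) hD
    have b2 : |K x * secondDiff (fun z => η (a • z)) x y| ≤ C * decay x * (4 * D * ‖y‖ ^ 2) := by
      rw [abs_mul]
      exact mul_le_mul (hK.bound x) e2 (abs_nonneg _) (by positivity)
    have b3 : |(η (a • (x + y)) - η (a • x)) * (K (x + y) - K x)| ≤
        2 * D * ‖y‖ * (2 * C * ‖y‖ * decay x) := by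
      rw [abs_mul]
      exact mul_le_mul (e1 y hay) (hK.diff_le x hy) (abs_nonneg _) (by positivity)
    have b4 : |(η (a • (x - y)) - η (a • x)) * (K (x - y) - K x)| ≤
        2 * D * ‖y‖ * (2 * C * ‖y‖ * decay x) := by
      have h1 := e1 (-y) (by rwa [smul_neg, norm_neg, norm_neg])
      have h2 := hK.diff_le x (v := -y) (by rwa [norm_neg])
      rw [norm_neg, ← sub_eq_add_neg] at h1 h2
      rw [abs_mul]
      exact mul_le_mul h1 h2 (abs_nonneg _) (by positivity)
    have hp : 0 ≤ D * C * ‖y‖ ^ 2 := by positivity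
    have p1 := mul_nonneg hp d1.le
    have p2 := mul_nonneg hp d2.le
    rw [_root_.abs_le] at b1 b2 b3 b4 ⊢
    constructor <;> nlinarith

lemma exists_decayKernel_of_hasCompactSupport {n : ℕ} {φ : E n → ℝ} (hφ : ContDiff ℝ ∞ φ)
    (hcs : HasCompactSupport φ) : ∃ C, DecayKernel C φ :=
  exists_decayKernel_schwartz (hcs.toSchwartzMap hφ)

lemma DecayKernel.secondDiff_le_diffWeight {n : ℕ} {C : ℝ} {K : E n → ℝ} (h : DecayKernel C K)
    (x y : E n) : |secondDiff K x y| ≤ 2 * C * diffWeight x y := by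
  have hC := h.nonneg
  have d0 := decay_pos x
  have d1 := decay_pos (x + y)
  have d2 := decay_pos (x - y)
  have p1 := mul_nonneg hC d1.le
  have p2 := mul_nonneg hC d2.le
  unfold diffWeight
  rw [← mul_assoc]
  refine mul_min_of_le ?_ (norm_nonneg y) two_pos fun hy => ?_
  · have h0 := h.bound x
    have h1 := h.bound (x + y)
    have h2 := h.bound (x - y)
    unfold secondDiff
    rw [_root_.abs_le] at h0 h1 h2 ⊢
    constructor <;> linarith
  · refine (h.secondDiff_le x hy).trans ?_
    rw [Real.rpow_two]
    have q1 := mul_nonneg p1 (sq_nonneg ‖y‖)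
    have q2 := mul_nonneg p2 (sq_nonneg ‖y‖)
    nlinarith

/-- The distributional equation may be tested with rapidly decaying kernels. -/
lemma IsDistribFracLap.integral_kernel {n : ℕ} (hn : 1 ≤ n) {s : ℝ} (hs : 0 < s) (hs1 : s < 1)
    {u g K : E n → ℝ} {A B C : ℝ} (hd : IsDistribFracLap s u g) (hu : Measurable u)
    (hA : ∀ x, |u x| ≤ A) (hg : Measurable g) (hB : ∀ x, |g x| ≤ B) (hK : DecayKernel C K) :
    ∫ x, u x * fracLap s K x = ∫ x, g x * K x := by
  let η : ContDiffBump (0 : E n) := ⟨1, 2, one_pos, one_lt_two⟩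
  obtain ⟨D, hD⟩ := exists_decayKernel_of_hasCompactSupport (φ := (η : E n → ℝ)) η.contDiff
    η.hasCompactSupport
  have hη0 : η (0 : E n) = 1 := η.one_of_mem_closedBall (by simp [η])
  let a : ℕ → ℝ := fun m => 1 / ((m : ℝ) + 1)
  have ha : ∀ m, 0 < a m := fun m => Nat.one_div_pos_of_nat
  have ha1 : ∀ m, a m ≤ 1 := fun m => by
    rw [div_le_one (by positivity)]
    have : (0 : ℝ) ≤ m := m.cast_nonneg
    linarith
  have hat : Filter.Tendsto a Filter.atTop (𝓝 0) := tendsto_one_div_add_atTop_nhds_zero_nat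
  -- These are admissible test functions that converge pointwise to `K`, with majorants independent
  -- of `m` on both sides of the equation.
  let φ : ℕ → E n → ℝ := fun m z => η (a m • z) * K z
  have hφs : ∀ m, ContDiff ℝ ∞ (φ m) := fun m =>
    (η.contDiff.comp (contDiff_const_smul (a m))).mul hK.smooth
  have hφc : ∀ m, HasCompactSupport (φ m) := fun m =>
    (η.hasCompactSupport.comp_smul (ha m).ne').mul_right
  have hφm : ∀ m, Measurable (φ m) := fun m => (hφs m).continuous.measurable
  have hφt : ∀ x, Filter.Tendsto (fun m => φ m x) Filter.atTop (𝓝 (K x)) := fun x => by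
    have h1 : Filter.Tendsto (fun m => η (a m • x)) Filter.atTop (𝓝 1) := by
      rw [← hη0]
      refine (η.continuous.tendsto 0).comp ?_
      simpa using hat.smul_const x
    simpa using h1.mul_const (K x)
  have hφd : ∀ m x y, |secondDiff (φ m) x y| ≤ 14 * (D * C) * diffWeight x y := fun m x y =>
    hK.secondDiff_cutoff_le hD (ha m).le (ha1 m) x y
  have hA0 : 0 ≤ A := (abs_nonneg _).trans (hA 0)
  have hB0 : 0 ≤ B := (abs_nonneg _).trans (hB 0)
  have hleft : Filter.Tendsto (fun m => ∫ x, u x * fracLap s (φ m) x) Filter.atTop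
      (𝓝 (∫ x, u x * fracLap s K x)) := by
    rw [integral_mul_fracLap hn hs hs1 hu hA hK.smooth.continuous.measurable
      hK.secondDiff_le_diffWeight]
    have h1 : ∀ m, ∫ x, u x * fracLap s (φ m) x = _ := fun m =>
      integral_mul_fracLap hn hs hs1 hu hA (hφm m) (hφd m)
    simp only [h1]
    refine Filter.Tendsto.const_mul _ ?_
    refine tendsto_integral_of_dominated_convergence
      (fun z : E n × E n => A * (14 * (D * C)) *
        (diffWeight z.1 z.2 / ‖z.2‖ ^ ((n : ℝ) + 2 * s)))
      (fun m => (integrable_mul_secondDiff_div hn hs hs1 hu hA (hφm m) (hφd m)).1)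
      ((integrable_diffWeight_div hn hs hs1).const_mul _) (fun m => ?_) ?_
    · refine Filter.Eventually.of_forall fun z => ?_
      have h0 : 0 ≤ ‖z.2‖ ^ ((n : ℝ) + 2 * s) := by positivity
      rw [norm_mul, norm_div, Real.norm_eq_abs, Real.norm_eq_abs, Real.norm_of_nonneg h0]
      calc _ ≤ A * (14 * (D * C) * diffWeight z.1 z.2 / ‖z.2‖ ^ ((n : ℝ) + 2 * s)) :=
            mul_le_mul (hA _) (div_le_div_of_nonneg_right (hφd m _ _) h0) (by positivity) hA0
        _ = _ := by ring
    · refine Filter.Eventually.of_forall fun z => ?_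
      refine Filter.Tendsto.const_mul _ (Filter.Tendsto.div_const ?_ _)
      exact ((hφt _).add (hφt _)).sub ((hφt _).const_mul 2)
  have hright : Filter.Tendsto (fun m => ∫ x, g x * φ m x) Filter.atTop
      (𝓝 (∫ x, g x * K x)) := by
    refine tendsto_integral_of_dominated_convergence (fun x => B * (D * |K x|))
      (fun m => (hg.mul (hφm m)).aestronglyMeasurable)
      ((hK.integrable.abs.const_mul _).const_mul _) (fun m => ?_) ?_
    · refine Filter.Eventually.of_forall fun x => ?_
      rw [norm_mul, norm_mul, Real.norm_eq_abs, Real.norm_eq_abs, Real.norm_eq_abs]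
      exact mul_le_mul (hB x) (mul_le_mul_of_nonneg_right (hD.abs_le _) (abs_nonneg _))
        (by positivity) hB0
    · exact Filter.Eventually.of_forall fun x => (hφt x).const_mul _
  refine tendsto_nhds_unique hleft (hright.congr fun m => ?_)
  exact (hd (φ m) (hφs m) (hφc m)).symm

/-! ### Rescaled equation and dyadic averages -/

lemma fracLap_comp_affine {n : ℕ} {s : ℝ} (φ : E n → ℝ) (x₀ : E n) {a : ℝ} (ha : 0 < a)
    (z : E n) : fracLap s (fun w => φ (a • w + x₀)) z = a ^ (2 * s) * fracLap s φ (a • z + x₀) := by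
  have h1 := Measure.integral_comp_smul (volume : Measure (E n))
    (fun y : E n => secondDiff φ (a • z + x₀) y / ‖y‖ ^ ((n : ℝ) + 2 * s)) a
  rw [finrank_euclideanSpace, Fintype.card_fin, smul_eq_mul, abs_of_pos (by positivity)] at h1
  unfold fracLap
  have h2 : ∀ y : E n, secondDiff (fun w => φ (a • w + x₀)) z y / ‖y‖ ^ ((n : ℝ) + 2 * s) =
      a ^ ((n : ℝ) + 2 * s) *
        (secondDiff φ (a • z + x₀) (a • y) / ‖a • y‖ ^ ((n : ℝ) + 2 * s)) := fun y => by
    have e1 : secondDiff (fun w => φ (a • w + x₀)) z y = secondDiff φ (a • z + x₀) (a • y) := by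
      simp only [secondDiff, smul_add, smul_sub, add_right_comm, sub_add_eq_add_sub]
    have : a ^ ((n : ℝ) + 2 * s) ≠ 0 := (Real.rpow_pos_of_pos ha _).ne'
    rw [e1, norm_smul, Real.norm_of_nonneg ha.le, Real.mul_rpow ha.le (norm_nonneg y),
      ← mul_div_assoc, mul_div_mul_left _ _ this]
  simp only [h2]
  rw [integral_const_mul, h1, Real.rpow_add ha, Real.rpow_natCast]
  have : a ^ n ≠ 0 := (pow_pos ha n).ne'
  field_simp

lemma integral_comp_affine {n : ℕ} (f : E n → ℝ) (x₀ : E n) {a : ℝ} (ha : 0 < a) :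
    ∫ y : E n, f (x₀ + a • y) = (a ^ n)⁻¹ * ∫ y, f y := by
  have h1 := Measure.integral_comp_smul (volume : Measure (E n)) (fun y : E n => f (x₀ + y)) a
  rw [finrank_euclideanSpace, Fintype.card_fin, smul_eq_mul, abs_of_pos (by positivity),
    integral_add_left_eq_self f x₀] at h1
  exact h1

lemma IsDistribFracLap.rescale {n : ℕ} {s : ℝ} {u g : E n → ℝ} (hd : IsDistribFracLap s u g)
    (x₀ : E n) {a : ℝ} (ha : 0 < a) :
    IsDistribFracLap s (fun y => u (x₀ + a • y)) (fun y => a ^ (2 * s) * g (x₀ + a • y)) := by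
  intro φ hφ hφc
  -- Transporting `φ` back through the affine map lets the original equation be tested; the
  -- homogeneity of the operator produces the factor a^{2s}.
  let Φ : E n → ℝ := fun w => φ (a⁻¹ • w + -(a⁻¹ • x₀))
  have hΦ : ∀ y, Φ (x₀ + a • y) = φ y := fun y => by
    simp only [Φ, smul_add, inv_smul_smul₀ ha.ne']
    congr 1; abel
  have hL : ∀ y, fracLap s Φ (x₀ + a • y) = (a⁻¹) ^ (2 * s) * fracLap s φ y := fun y => by
    rw [fracLap_comp_affine φ _ (inv_pos.2 ha), smul_add, inv_smul_smul₀ ha.ne']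
    congr 2; abel
  have hpos : 0 < a ^ (2 * s) := Real.rpow_pos_of_pos ha _
  have key := hd Φ (hφ.comp ((contDiff_const_smul _).add contDiff_const)) (by
    have h1 : HasCompactSupport (fun w : E n => φ (w + -(a⁻¹ • x₀))) :=
      hφc.comp_homeomorph (Homeomorph.addRight (-(a⁻¹ • x₀)))
    exact h1.comp_smul (inv_pos.2 ha).ne')
  have e1 := integral_comp_affine (fun w => u w * fracLap s Φ w) x₀ ha
  have e2 := integral_comp_affine (fun w => g w * Φ w) x₀ ha
  rw [key, ← e2] at e1
  simp only [hL, hΦ] at e1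
  rw [Real.inv_rpow ha.le] at e1
  have e3 : ∫ y, u (x₀ + a • y) * fracLap s φ y =
      a ^ (2 * s) * ∫ y, u (x₀ + a • y) * ((a ^ (2 * s))⁻¹ * fracLap s φ y) := by
    rw [← integral_const_mul]
    refine integral_congr_ae (Filter.Eventually.of_forall fun y => ?_)
    simp only
    field_simp
  rw [e3, e1, ← integral_const_mul]
  refine integral_congr_ae (Filter.Eventually.of_forall fun y => ?_)
  simp only
  ring

/-- The moment `∫ |y|^q (1 + |y|)^{-n-2} dy`. -/
def decayMoment (n : ℕ) (q : ℝ) : ℝ := ∫ y : E n, ‖y‖ ^ q * decay y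

lemma decayMoment_nonneg (n : ℕ) (q : ℝ) : 0 ≤ decayMoment n q :=
  integral_nonneg fun y => mul_nonneg (by positivity) (decay_pos y).le

/-- The average of `g` around `x` at scale `a` against the kernel `K`. -/
def kernelAvg {n : ℕ} (K g : E n → ℝ) (a : ℝ) (x : E n) : ℝ := ∫ y : E n, g (x + a • y) * K y

/-- The gradient of `kernelAvg K g a` at `x`. -/
def kernelAvgGrad {n : ℕ} (K g : E n → ℝ) (a : ℝ) (x : E n) : E n →L[ℝ] ℝ :=
  -(a⁻¹ • ∫ y : E n, (g (x + a • y) - g x) • fderiv ℝ K y)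

lemma integrable_kernelAvg {n : ℕ} {C : ℝ} {K g : E n → ℝ} (hK : DecayKernel C K)
    (hg : Measurable g) {B : ℝ} (hB : ∀ x, |g x| ≤ B) (a : ℝ) (x v : E n) :
    Integrable (fun y : E n => g (x + a • y) * K (y + v)) :=
  (hK.integrable.comp_add_right v).bdd_mul (c := B)
    (hg.comp ((measurable_const_add x).comp (measurable_const_smul a))).aestronglyMeasurable
    (Filter.Eventually.of_forall fun _ => hB _)

lemma holder_scaled_le {n : ℕ} {g : E n → ℝ} {q B : ℝ}
    (hH : ∀ x y, |g x - g y| ≤ B * ‖x - y‖ ^ q) {a : ℝ} (ha : 0 < a) (x y : E n) :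
    |g (x + a • y) - g x| ≤ B * a ^ q * ‖y‖ ^ q := by
  have h := hH (x + a • y) x
  rwa [add_sub_cancel_left, norm_smul, Real.norm_of_nonneg ha.le,
    Real.mul_rpow ha.le (norm_nonneg y), ← mul_assoc] at h

/-- The mean zero of `K` allows `g x` to be subtracted under the integral, and the Hölder bound then
yields a^q. The moment of order q ≤ 1 is finite for the chosen weight. -/
lemma abs_kernelAvg_le {n : ℕ} {C : ℝ} {K g : E n → ℝ} (hK : DecayKernel C K)
    (hK0 : ∫ y, K y = 0) (hg : Measurable g) {A B q : ℝ} (hA : ∀ x, |g x| ≤ A) (hB0 : 0 ≤ B)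
    (hq : 0 ≤ q) (hq1 : q ≤ 1) (hH : ∀ x y, |g x - g y| ≤ B * ‖x - y‖ ^ q) {a : ℝ} (ha : 0 < a)
    (x : E n) : |kernelAvg K g a x| ≤ C * B * decayMoment n q * a ^ q := by
  have h1 : kernelAvg K g a x = ∫ y : E n, (g (x + a • y) - g x) * K y := by
    simp only [sub_mul]
    have hi := integrable_kernelAvg hK hg hA a x 0
    simp only [add_zero] at hi
    rw [integral_sub hi (hK.integrable.const_mul _), integral_const_mul, hK0, mul_zero, sub_zero]
    rfl
  have haq : 0 ≤ a ^ q := Real.rpow_nonneg ha.le q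
  rw [h1, ← Real.norm_eq_abs]
  refine (norm_integral_le_of_norm_le ((integrable_rpow_mul_decay hq hq1).const_mul
    (C * B * a ^ q)) (Filter.Eventually.of_forall fun y => ?_)).trans (le_of_eq ?_)
  · rw [norm_mul, Real.norm_eq_abs, Real.norm_eq_abs]
    calc _ ≤ (B * a ^ q * ‖y‖ ^ q) * (C * decay y) :=
          mul_le_mul (holder_scaled_le hH ha x y) (hK.bound y) (abs_nonneg _) (by positivity)
      _ = _ := by ring
  · rw [integral_const_mul, decayMoment]; ring

/-- In `kernelAvgGrad` the value `g x` is already subtracted, which is legitimate because ∇K always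
has mean zero; hence no cancellation of `K` itself is needed. -/
lemma norm_kernelAvgGrad_le {n : ℕ} {C : ℝ} {K g : E n → ℝ} (hK : DecayKernel C K)
    {B q : ℝ} (hB0 : 0 ≤ B)
    (hq : 0 ≤ q) (hq1 : q ≤ 1) (hH : ∀ x y, |g x - g y| ≤ B * ‖x - y‖ ^ q) {a : ℝ} (ha : 0 < a)
    (x : E n) : ‖kernelAvgGrad K g a x‖ ≤ C * B * decayMoment n q * a ^ (q - 1) := by
  have haq : 0 ≤ a ^ q := Real.rpow_nonneg ha.le q
  rw [kernelAvgGrad, norm_neg, norm_smul, norm_inv, Real.norm_of_nonneg ha.le]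
  have h := norm_integral_le_of_norm_le ((integrable_rpow_mul_decay (n := n) hq hq1).const_mul
    (C * B * a ^ q)) (f := fun y : E n => (g (x + a • y) - g x) • fderiv ℝ K y)
    (Filter.Eventually.of_forall fun y => by
      rw [norm_smul, Real.norm_eq_abs]
      calc _ ≤ (B * a ^ q * ‖y‖ ^ q) * (C * decay y) :=
            mul_le_mul (holder_scaled_le hH ha x y) (hK.bound_fderiv y) (norm_nonneg _)
              (by positivity)
        _ = _ := by ring)
  calc _ ≤ a⁻¹ * ∫ y : E n, C * B * a ^ q * (‖y‖ ^ q * decay y) :=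
        mul_le_mul_of_nonneg_left h (inv_nonneg.2 ha.le)
    _ = _ := by
      rw [integral_const_mul, Real.rpow_sub ha, Real.rpow_one, decayMoment]
      field_simp

/-- The shift by h is moved from `g` to the kernel, where it becomes v = h/a of length at most one.
The second order remainder of `K` then costs a^{-2}, and `g x` may be subtracted since a translated
kernel has the same integral. -/
lemma kernelAvg_taylor {n : ℕ} {C : ℝ} {K g : E n → ℝ} (hK : DecayKernel C K)
    (hg : Measurable g) {A B q : ℝ} (hA : ∀ x, |g x| ≤ A) (hB0 : 0 ≤ B)
    (hq : 0 ≤ q) (hq1 : q ≤ 1) (hH : ∀ x y, |g x - g y| ≤ B * ‖x - y‖ ^ q) {a : ℝ} (ha : 0 < a)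
    (x h : E n) (hh : ‖h‖ ≤ a) :
    |kernelAvg K g a (x + h) - kernelAvg K g a x - kernelAvgGrad K g a x h| ≤
      C * B * decayMoment n q * a ^ (q - 2) * ‖h‖ ^ 2 := by
  have haq : 0 ≤ a ^ q := Real.rpow_nonneg ha.le q
  set v : E n := a⁻¹ • h with hv
  have hav : a • v = h := smul_inv_smul₀ ha.ne' h
  have hvn : ‖v‖ = a⁻¹ * ‖h‖ := by
    rw [hv, norm_smul, norm_inv, Real.norm_of_nonneg ha.le]
  have hv1 : ‖-v‖ ≤ 1 := by
    rw [norm_neg, hvn, ← div_eq_inv_mul, div_le_one ha]; exact hh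
  have hGm : Measurable (fun y : E n => g (x + a • y) - g x) :=
    (hg.comp ((measurable_const_add x).comp (measurable_const_smul a))).sub_const _
  have hi := integrable_kernelAvg hK hg hA a x
  have hi0 := hi 0
  simp only [add_zero] at hi0
  have h1 : kernelAvg K g a (x + h) = ∫ y : E n, g (x + a • y) * K (y + -v) := by
    have := integral_add_right_eq_self (μ := (volume : Measure (E n)))
      (fun y => g (x + a • y) * K (y + -v)) v
    rw [← this, kernelAvg]
    refine integral_congr_ae (Filter.Eventually.of_forall fun y => ?_)
    simp only [smul_add, hav, add_neg_cancel_right]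
    congr 2; abel
  have hs0 : ∫ y : E n, (K (y + -v) - K y) = 0 := by
    rw [integral_sub (hK.integrable.comp_add_right _) hK.integrable,
      integral_add_right_eq_self K (-v), sub_self]
  have h2 : kernelAvg K g a (x + h) - kernelAvg K g a x =
      ∫ y : E n, (g (x + a • y) - g x) * (K (y + -v) - K y) := by
    rw [h1, kernelAvg, ← integral_sub (hi _) hi0]
    have e : ∀ y : E n, (g (x + a • y) - g x) * (K (y + -v) - K y) =
        (g (x + a • y) * K (y + -v) - g (x + a • y) * K y) - g x * (K (y + -v) - K y) :=
      fun y => by ring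
    simp only [e]
    have i1 : Integrable (fun y : E n => g (x + a • y) * K (y + -v) - g (x + a • y) * K y) :=
      (hi _).sub hi0
    have i2 : Integrable (fun y : E n => g x * (K (y + -v) - K y)) :=
      ((hK.integrable.comp_add_right _).sub hK.integrable).const_mul _
    rw [integral_sub i1 i2, integral_const_mul, hs0, mul_zero, sub_zero]
  have hgi : Integrable (fun y : E n => (g (x + a • y) - g x) • fderiv ℝ K y) := by
    refine ((integrable_rpow_mul_decay hq hq1).const_mul (C * B * a ^ q)).mono' ?_
      (Filter.Eventually.of_forall fun y => ?_)
    · exact hGm.aestronglyMeasurable.smul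
        (hK.smooth.continuous_fderiv (by simp)).aestronglyMeasurable
    · rw [norm_smul, Real.norm_eq_abs]
      calc _ ≤ (B * a ^ q * ‖y‖ ^ q) * (C * decay y) :=
            mul_le_mul (holder_scaled_le hH ha x y) (hK.bound_fderiv y) (norm_nonneg _)
              (by positivity)
        _ = _ := by ring
  have h3 : kernelAvgGrad K g a x h =
      ∫ y : E n, (g (x + a • y) - g x) * fderiv ℝ K y (-v) := by
    rw [kernelAvgGrad, neg_apply, smul_apply,
      ContinuousLinearMap.integral_apply hgi, ← hav]
    simp only [map_smul, map_neg, mul_neg, smul_apply, smul_eq_mul]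
    rw [integral_neg, ← integral_const_mul]
    congr 1
    refine integral_congr_ae (Filter.Eventually.of_forall fun y => ?_)
    simp only
    field_simp
  have hgi2 : Integrable (fun y : E n => (g (x + a • y) - g x) * fderiv ℝ K y (-v)) := by
    have := hgi.apply_continuousLinearMap (-v)
    simpa using this
  have hgi3 : Integrable (fun y : E n => (g (x + a • y) - g x) * (K (y + -v) - K y)) := by
    have e : ∀ y : E n, (g (x + a • y) - g x) * (K (y + -v) - K y) =
        (g (x + a • y) * K (y + -v) - g (x + a • y) * K y) - g x * (K (y + -v) - K y) :=
      fun y => by ring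
    simp only [e]
    exact ((hi _).sub hi0).sub
      (((hK.integrable.comp_add_right _).sub hK.integrable).const_mul _)
  rw [h2, h3, ← integral_sub hgi3 hgi2, ← Real.norm_eq_abs]
  refine (norm_integral_le_of_norm_le ((integrable_rpow_mul_decay hq hq1).const_mul
    (C * B * a ^ q * ‖v‖ ^ 2)) (Filter.Eventually.of_forall fun y => ?_)).trans (le_of_eq ?_)
  · rw [← mul_sub, norm_mul, Real.norm_eq_abs, Real.norm_eq_abs]
    have ht := hK.taylor y (-v) hv1
    rw [norm_neg] at ht
    calc _ ≤ (B * a ^ q * ‖y‖ ^ q) * (C * ‖v‖ ^ 2 * decay y) :=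
          mul_le_mul (holder_scaled_le hH ha x y) ht (abs_nonneg _) (by positivity)
      _ = _ := by ring
  · rw [integral_const_mul, hvn, Real.rpow_sub ha, Real.rpow_two, decayMoment]
    field_simp

/-- The equation rescaled to scale a around x is tested with `K`; the Littlewood–Paley identity
turns the side of `u` into a difference of two averages. -/
lemma kernelAvg_dyadic {n : ℕ} (hn : 1 ≤ n) {s C : ℝ} (hs : 0 < s) (hs1 : s < 1)
    {Θ K : E n → ℝ} (hLP : LittlewoodPaley s C Θ K) {u g : E n → ℝ} {A B : ℝ}
    (hd : IsDistribFracLap s u g) (hu : Measurable u)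
    (hA : ∀ x, |u x| ≤ A) (hg : Measurable g) (hB : ∀ x, |g x| ≤ B) {a : ℝ} (ha : 0 < a)
    (x : E n) :
    kernelAvg Θ u a x - kernelAvg Θ u (2 * a) x = a ^ (2 * s) * kernelAvg K g a x := by
  have hm : ∀ f : E n → ℝ, Measurable f → Measurable (fun y : E n => f (x + a • y)) := fun f hf =>
    hf.comp ((measurable_const_add x).comp (measurable_const_smul a))
  have hpos : 0 < a ^ (2 * s) := Real.rpow_pos_of_pos ha _
  have h1 := (hd.rescale x ha).integral_kernel hn hs hs1 (hm u hu) (fun y => hA _)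
    ((hm g hg).const_mul _) (B := a ^ (2 * s) * B) (fun y => by
      rw [abs_mul, abs_of_pos hpos]; exact mul_le_mul_of_nonneg_left (hB _) hpos.le) hLP.decayK
  have h2 := Measure.integral_comp_smul (volume : Measure (E n))
    (fun y : E n => u (x + a • y) * Θ ((1 / 2 : ℝ) • y)) 2
  rw [finrank_euclideanSpace, Fintype.card_fin, smul_eq_mul, abs_of_pos (by positivity)] at h2
  have h3 : kernelAvg Θ u (2 * a) x =
      ((2 : ℝ) ^ n)⁻¹ * ∫ y : E n, u (x + a • y) * Θ ((1 / 2 : ℝ) • y) := by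
    rw [← h2, kernelAvg]
    refine integral_congr_ae (Filter.Eventually.of_forall fun y => ?_)
    simp only [smul_smul]
    norm_num
    left
    rw [mul_comm]
  have hi := integrable_kernelAvg hLP.decayΘ hu hA a x 0
  simp only [add_zero] at hi
  have hi2 : Integrable (fun y : E n => u (x + a • y) * Θ ((1 / 2 : ℝ) • y)) :=
    (hLP.decayΘ.integrable.comp_smul (by norm_num)).bdd_mul (c := A)
      (hm u hu).aestronglyMeasurable (Filter.Eventually.of_forall fun y => hA _)
  rw [h3, kernelAvg, kernelAvg, ← integral_const_mul, ← integral_const_mul,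
    ← integral_sub hi (hi2.const_mul _)]
  refine Eq.trans (integral_congr_ae (Filter.Eventually.of_forall fun y => ?_))
    (h1.trans (integral_congr_ae (Filter.Eventually.of_forall fun y => ?_)))
  · simp only [hLP.fracLap_eq]; ring
  · simp only; ring

lemma kernelAvg_tendsto {n : ℕ} {s C : ℝ} {Θ K : E n → ℝ}
    (hLP : LittlewoodPaley s C Θ K) {u : E n → ℝ} {A : ℝ} (hu : Continuous u)
    (hA : ∀ x, |u x| ≤ A) {a : ℕ → ℝ} (ha : Filter.Tendsto a Filter.atTop (𝓝 0)) (x : E n) :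
    Filter.Tendsto (fun j => kernelAvg Θ u (a j) x) Filter.atTop (𝓝 (u x)) := by
  have h1 : u x = ∫ y : E n, u x * Θ y := by
    rw [integral_const_mul, hLP.integralΘ, mul_one]
  rw [h1]
  have hA0 : 0 ≤ A := (abs_nonneg _).trans (hA 0)
  refine tendsto_integral_of_dominated_convergence (fun y => A * |Θ y|) (fun j => ?_)
    (hLP.decayΘ.integrable.abs.const_mul A) (fun j => ?_) ?_
  · have := integrable_kernelAvg hLP.decayΘ hu.measurable hA (a j) x 0
    simp only [add_zero] at this
    exact this.1
  · refine Filter.Eventually.of_forall fun y => ?_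
    rw [norm_mul, Real.norm_eq_abs, Real.norm_eq_abs]
    exact mul_le_mul_of_nonneg_right (hA _) (abs_nonneg _)
  · refine Filter.Eventually.of_forall fun y => Filter.Tendsto.mul_const _ ?_
    refine (hu.tendsto x).comp ?_
    have := (ha.smul_const y).const_add x
    simpa using this

/-! ### Dyadic summation and interior regularity -/

lemma sum_two_sided_geometric_le {r q : ℝ} (hr : 0 ≤ r) (hr1 : r < 1) (hq : 0 ≤ q) (hq1 : q < 1)
    (m N : ℕ) : ∑ j ∈ Finset.range N, (if j < m then r ^ (m - 1 - j) else q ^ (j - m)) ≤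
      (1 - r)⁻¹ + (1 - q)⁻¹ := by
  have hgeom : ∀ {t : ℝ}, 0 ≤ t → t < 1 → ∀ M : ℕ, ∑ j ∈ Finset.range M, t ^ j ≤ (1 - t)⁻¹ :=
    fun {t} ht ht1 M => by
      rw [← tsum_geometric_of_lt_one ht ht1]
      exact (summable_geometric_of_lt_one ht ht1).sum_le_tsum _ fun j _ => pow_nonneg ht j
  rw [Finset.sum_ite]
  refine add_le_add ?_ ?_
  · calc _ ≤ ∑ j ∈ Finset.range m, r ^ (m - 1 - j) := by
          refine Finset.sum_le_sum_of_subset_of_nonneg (fun j hj => ?_)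
            fun j _ _ => pow_nonneg hr _
          simp only [Finset.mem_filter] at hj
          exact Finset.mem_range.2 hj.2
      _ = ∑ j ∈ Finset.range m, r ^ j := Finset.sum_range_reflect (fun j => r ^ j) m
      _ ≤ _ := hgeom hr hr1 m
  · calc _ ≤ ∑ j ∈ Finset.Ico m (m + N), q ^ (j - m) := by
          refine Finset.sum_le_sum_of_subset_of_nonneg (fun j hj => ?_)
            fun j _ _ => pow_nonneg hq _
          simp only [Finset.mem_filter, Finset.mem_range] at hj
          exact Finset.mem_Ico.2 ⟨by omega, by omega⟩
      _ = ∑ j ∈ Finset.range N, q ^ j := by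
          rw [Finset.sum_Ico_eq_sum_range]
          simp
      _ ≤ _ := hgeom hq hq1 N

/-- `f` is bounded with gradient `p`, with a `C^{1,s}` expansion at every point. -/
structure HolderC1 {n : ℕ} (s D : ℝ) (f : E n → ℝ) (p : E n → E n →L[ℝ] ℝ) : Prop where
  bound : ∀ x, |f x| ≤ D
  bound_grad : ∀ x, ‖p x‖ ≤ D
  expand : ∀ x h, |f (x + h) - f x - p x h| ≤ D * ‖h‖ ^ (1 + s)

/-- A dyadic decomposition with increments of order `2^{-j(1+s)}` in `C²`-scaled norms
sums to a `C^{1,s}` expansion. -/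
lemma dyadic_expansion {n : ℕ} {s N : ℝ} (hs : 0 < s) (hs1 : s < 1) (hN : 0 ≤ N)
    (e : ℕ → ℝ) (h : E n) (hh0 : h ≠ 0) (hh : ‖h‖ ≤ 1)
    (he1 : ∀ j : ℕ, ‖h‖ ≤ (1 / 2 : ℝ) ^ (j + 1) →
      |e j| ≤ N * ((1 / 2 : ℝ) ^ (j + 1)) ^ (s - 1) * ‖h‖ ^ 2)
    (he2 : ∀ j : ℕ, (1 / 2 : ℝ) ^ (j + 1) ≤ ‖h‖ →
      |e j| ≤ N * ((1 / 2 : ℝ) ^ (j + 1)) ^ s * ‖h‖) (M : ℕ) :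
    |∑ j ∈ Finset.range M, e j| ≤ N * ((1 - (1 / 2 : ℝ) ^ (1 - s))⁻¹ + (1 - (1 / 2 : ℝ) ^ s)⁻¹) *
      ‖h‖ ^ (1 + s) := by
  have hhp : 0 < ‖h‖ := norm_pos_iff.2 hh0
  -- The index satisfies 2^{-(m+1)} ≤ |h| ≤ 2^{-m}. The j-th increment lives at scale 2^{-(j+1)}, so
  -- j < m are the scales above |h|, where the quadratic remainder is used; the others use the
  -- linear bound. Both give |h|^{1+s} times a factor geometric in the distance of j to m.
  obtain ⟨m, hm1, hm2⟩ := exists_nat_pow_near (x := ‖h‖⁻¹) (y := (2 : ℝ))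
    ((one_le_inv₀ hhp).2 hh) one_lt_two
  have hm1' : ‖h‖ ≤ (1 / 2 : ℝ) ^ m := by
    rw [one_div, inv_pow, le_inv_comm₀ hhp (by positivity)]; exact hm1
  have hm2' : (1 / 2 : ℝ) ^ (m + 1) ≤ ‖h‖ := by
    rw [one_div, inv_pow, inv_le_comm₀ (by positivity) hhp]; exact hm2.le
  have hhalf : (0 : ℝ) < 1 / 2 := by norm_num
  have hr0 : (0 : ℝ) ≤ (1 / 2 : ℝ) ^ (1 - s) := by positivity
  have hr1 : (1 / 2 : ℝ) ^ (1 - s) < 1 :=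
    Real.rpow_lt_one hhalf.le (by norm_num) (by linarith)
  have hq0 : (0 : ℝ) ≤ (1 / 2 : ℝ) ^ s := by positivity
  have hq1 : (1 / 2 : ℝ) ^ s < 1 := Real.rpow_lt_one hhalf.le (by norm_num) hs
  have hpow : ∀ (k : ℕ) (t : ℝ), ((1 / 2 : ℝ) ^ k) ^ t = ((1 / 2 : ℝ) ^ t) ^ k := fun k t => by
    rw [← Real.rpow_natCast, ← Real.rpow_natCast, ← Real.rpow_mul hhalf.le,
      ← Real.rpow_mul hhalf.le, mul_comm]
  have hterm : ∀ j, |e j| ≤ N * ‖h‖ ^ (1 + s) *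
      (if j < m then ((1 / 2 : ℝ) ^ (1 - s)) ^ (m - 1 - j) else ((1 / 2 : ℝ) ^ s) ^ (j - m)) := by
    intro j
    split_ifs with hj
    · have h1 : ‖h‖ ≤ (1 / 2 : ℝ) ^ (j + 1) :=
        hm1'.trans (pow_le_pow_of_le_one hhalf.le (by norm_num) (by omega))
      refine (he1 j h1).trans ?_
      rw [mul_assoc, mul_assoc]
      refine mul_le_mul_of_nonneg_left ?_ hN
      have h2 : ((1 / 2 : ℝ) ^ (j + 1)) ^ (s - 1) =
          ((1 / 2 : ℝ) ^ m) ^ (s - 1) * ((1 / 2 : ℝ) ^ (1 - s)) ^ (m - 1 - j) := by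
        rw [← hpow, ← neg_sub s 1, Real.rpow_neg (by positivity), ← Real.inv_rpow (by positivity),
          ← Real.mul_rpow (by positivity) (by positivity)]
        congr 1
        rw [eq_mul_inv_iff_mul_eq₀ (by positivity), ← pow_add]
        congr 1; omega
      have h3 : ((1 / 2 : ℝ) ^ m) ^ (s - 1) ≤ ‖h‖ ^ (s - 1) :=
        Real.rpow_le_rpow_of_nonpos hhp hm1' (by linarith)
      have h4 : ‖h‖ ^ (1 + s) = ‖h‖ ^ (s - 1) * ‖h‖ ^ 2 := by
        rw [← Real.rpow_two, ← Real.rpow_add hhp]; congr 1; ring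
      rw [h2, h4]
      have h5 : 0 ≤ ((1 / 2 : ℝ) ^ (1 - s)) ^ (m - 1 - j) * ‖h‖ ^ 2 := by positivity
      calc _ = ((1 / 2 : ℝ) ^ m) ^ (s - 1) * (((1 / 2 : ℝ) ^ (1 - s)) ^ (m - 1 - j) * ‖h‖ ^ 2) := by
            ring
        _ ≤ ‖h‖ ^ (s - 1) * (((1 / 2 : ℝ) ^ (1 - s)) ^ (m - 1 - j) * ‖h‖ ^ 2) :=
            mul_le_mul_of_nonneg_right h3 h5
        _ = _ := by ring
    · have hjm : m ≤ j := not_lt.1 hj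
      have h1 : (1 / 2 : ℝ) ^ (j + 1) ≤ ‖h‖ :=
        (pow_le_pow_of_le_one hhalf.le (by norm_num) (by omega)).trans hm2'
      refine (he2 j h1).trans ?_
      rw [mul_assoc, mul_assoc]
      refine mul_le_mul_of_nonneg_left ?_ hN
      have h2 : ((1 / 2 : ℝ) ^ (j + 1)) ^ s =
          ((1 / 2 : ℝ) ^ (m + 1)) ^ s * ((1 / 2 : ℝ) ^ s) ^ (j - m) := by
        rw [← hpow, ← Real.mul_rpow (by positivity) (by positivity), ← pow_add]
        congr 2; omega
      have h3 : ((1 / 2 : ℝ) ^ (m + 1)) ^ s ≤ ‖h‖ ^ s :=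
        Real.rpow_le_rpow (by positivity) hm2' hs.le
      have h4 : ‖h‖ ^ (1 + s) = ‖h‖ * ‖h‖ ^ s := by
        rw [Real.rpow_add hhp, Real.rpow_one]
      rw [h2, h4]
      have h5 : 0 ≤ ((1 / 2 : ℝ) ^ s) ^ (j - m) * ‖h‖ := by positivity
      calc _ = ((1 / 2 : ℝ) ^ (m + 1)) ^ s * (((1 / 2 : ℝ) ^ s) ^ (j - m) * ‖h‖) := by ring
        _ ≤ ‖h‖ ^ s * (((1 / 2 : ℝ) ^ s) ^ (j - m) * ‖h‖) := mul_le_mul_of_nonneg_right h3 h5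
        _ = _ := by ring
  calc _ ≤ ∑ j ∈ Finset.range M, |e j| := Finset.abs_sum_le_sum_abs _ _
    _ ≤ ∑ j ∈ Finset.range M, N * ‖h‖ ^ (1 + s) *
      (if j < m then ((1 / 2 : ℝ) ^ (1 - s)) ^ (m - 1 - j) else ((1 / 2 : ℝ) ^ s) ^ (j - m)) :=
        Finset.sum_le_sum fun j _ => hterm j
    _ = N * ‖h‖ ^ (1 + s) * ∑ j ∈ Finset.range M,
      (if j < m then ((1 / 2 : ℝ) ^ (1 - s)) ^ (m - 1 - j) else ((1 / 2 : ℝ) ^ s) ^ (j - m)) := by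
        rw [Finset.mul_sum]
    _ ≤ N * ‖h‖ ^ (1 + s) * ((1 - (1 / 2 : ℝ) ^ (1 - s))⁻¹ + (1 - (1 / 2 : ℝ) ^ s)⁻¹) :=
        mul_le_mul_of_nonneg_left (sum_two_sided_geometric_le hr0 hr1 hq0 hq1 m M) (by positivity)
    _ = _ := by ring

lemma HolderX.continuous {n : ℕ} {β M : ℝ} {g : E n → ℝ} (hβ : 0 < β) (hg : HolderX β M g) :
    Continuous g := by
  rw [continuous_iff_continuousAt]
  intro x
  rw [ContinuousAt, tendsto_iff_dist_tendsto_zero]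
  have h1 : Filter.Tendsto (fun y => M * ‖y - x‖ ^ β) (𝓝 x) (𝓝 0) := by
    have hc : Continuous (fun y : E n => M * ‖y - x‖ ^ β) :=
      continuous_const.mul ((continuous_id.sub continuous_const).norm.rpow_const
        fun _ => Or.inr hβ.le)
    have := hc.tendsto x
    simpa [Real.zero_rpow hβ.ne'] using this
  exact squeeze_zero (fun y => dist_nonneg) (fun y => hg.holder y x) h1

/-- Interior regularity for the fractional Laplacian: bounded distributional solutions of
`(-Δ)^s u = g` with `g ∈ C^{1-s}` belong to `C^{1,s}`. -/
theorem exists_holderC1_of_isDistribFracLap {n : ℕ} (hn : 1 ≤ n) {s : ℝ} (hs : 0 < s) (hs1 : s < 1)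
    (A M : ℝ) : ∃ D : ℝ, ∀ u g : E n → ℝ, Continuous u → (∀ x, |u x| ≤ A) →
      HolderX (1 - s) M g → IsDistribFracLap s u g → ∃ p, HolderC1 s D u p := by
  obtain ⟨C, Θ, K, hLP⟩ := exists_littlewoodPaley hn hs hs1
  have hC := hLP.decayK.nonneg
  -- `N0` governs the average of `u` at unit scale, where `u` counts as Hölder of exponent 0 with
  -- constant 2A; `N` governs the averages of `g`.
  set N0 : ℝ := C * (2 * A) * decayMoment n 0 with hN0
  set N : ℝ := C * M * decayMoment n (1 - s) with hN
  set Cs : ℝ := (1 - (1 / 2 : ℝ) ^ (1 - s))⁻¹ + (1 - (1 / 2 : ℝ) ^ s)⁻¹ with hCs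
  have hhalf : (0 : ℝ) < 1 / 2 := by norm_num
  have hr1 : (1 / 2 : ℝ) ^ (1 - s) < 1 :=
    Real.rpow_lt_one hhalf.le (by norm_num) (by linarith)
  have hq0 : (0 : ℝ) ≤ (1 / 2 : ℝ) ^ s := by positivity
  have hq1 : (1 / 2 : ℝ) ^ s < 1 := Real.rpow_lt_one hhalf.le (by norm_num) hs
  have hCq : 0 ≤ (1 - (1 / 2 : ℝ) ^ s)⁻¹ := inv_nonneg.2 (by linarith)
  have hCr : 0 ≤ (1 - (1 / 2 : ℝ) ^ (1 - s))⁻¹ := inv_nonneg.2 (by linarith)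
  have hCs0 : 0 ≤ Cs := add_nonneg hCr hCq
  refine ⟨2 * A + N0 + 3 * N * Cs + N * (1 - (1 / 2 : ℝ) ^ s)⁻¹, fun u g hu hA hg hd => ?_⟩
  have hA0 : 0 ≤ A := (abs_nonneg _).trans (hA 0)
  have hM0 : 0 ≤ M := (abs_nonneg _).trans (hg.bound 0)
  have hN0' : 0 ≤ N0 := mul_nonneg (by positivity) (decayMoment_nonneg n 0)
  have hN' : 0 ≤ N := mul_nonneg (by positivity) (decayMoment_nonneg n (1 - s))
  have hgm : Measurable g := (hg.continuous (by linarith)).measurable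
  have hu0 : ∀ x y, |u x - u y| ≤ 2 * A * ‖x - y‖ ^ (0 : ℝ) := fun x y => by
    rw [Real.rpow_zero, mul_one]
    have h1 := hA x
    have h2 := hA y
    rw [abs_le] at h1 h2 ⊢
    constructor <;> linarith
  set a : ℕ → ℝ := fun j => (1 / 2 : ℝ) ^ (j + 1) with ha
  have hap : ∀ j, 0 < a j := fun j => by positivity
  have has : ∀ j, a j ^ s = (1 / 2 : ℝ) ^ s * ((1 / 2 : ℝ) ^ s) ^ j := fun j => by
    change ((1 / 2 : ℝ) ^ (j + 1)) ^ s = _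
    rw [← Real.rpow_natCast, ← Real.rpow_natCast, ← Real.rpow_mul hhalf.le,
      ← Real.rpow_mul hhalf.le, ← Real.rpow_add hhalf]
    congr 1; push_cast; ring
  -- Gradient of the j-th increment. With q = 1-s its size is a^{2s}·a^{-s} = a^s, so the gradients
  -- are summable.
  let P : ℕ → E n → E n →L[ℝ] ℝ := fun j x => a j ^ (2 * s) • kernelAvgGrad K g (a j) x
  have hPn : ∀ j x, ‖P j x‖ ≤ N * a j ^ s := fun j x => by
    have h1 := norm_kernelAvgGrad_le hLP.decayK hM0 (by linarith) (by linarith) hg.holder (hap j) x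
    have h2 : 0 < a j ^ (2 * s) := Real.rpow_pos_of_pos (hap j) _
    simp only [P]
    rw [norm_smul, Real.norm_of_nonneg h2.le]
    calc _ ≤ a j ^ (2 * s) * (C * M * decayMoment n (1 - s) * a j ^ (1 - s - 1)) :=
          mul_le_mul_of_nonneg_left h1 h2.le
      _ = N * (a j ^ (2 * s) * a j ^ (1 - s - 1)) := by rw [hN]; ring
      _ = _ := by rw [← Real.rpow_add (hap j)]; congr 2; ring
  have hgeo : HasSum (fun j => N * ((1 / 2 : ℝ) ^ s) ^ j) (N * (1 - (1 / 2 : ℝ) ^ s)⁻¹) :=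
    (hasSum_geometric_of_lt_one hq0 hq1).mul_left N
  have hPle : ∀ j x, ‖P j x‖ ≤ N * ((1 / 2 : ℝ) ^ s) ^ j := fun j x => by
    refine (hPn j x).trans (mul_le_mul_of_nonneg_left ?_ hN')
    rw [has]
    exact mul_le_of_le_one_left (by positivity) hq1.le
  have hPs : ∀ x, Summable (fun j => P j x) := fun x =>
    Summable.of_norm_bounded hgeo.summable fun j => hPle j x
  have hPt : ∀ x, ‖∑' j, P j x‖ ≤ N * (1 - (1 / 2 : ℝ) ^ s)⁻¹ := fun x =>
    tsum_of_norm_bounded hgeo fun j => hPle j x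
  let Q : E n → E n →L[ℝ] ℝ := fun x => kernelAvgGrad Θ u 1 x
  have hQ : ∀ x, ‖Q x‖ ≤ N0 := fun x => by
    have h1 := norm_kernelAvgGrad_le hLP.decayΘ (by positivity) le_rfl zero_le_one hu0 one_pos x
    rwa [Real.one_rpow, mul_one] at h1
  have hQt : ∀ x h, ‖h‖ ≤ 1 →
      |kernelAvg Θ u 1 (x + h) - kernelAvg Θ u 1 x - Q x h| ≤ N0 * ‖h‖ ^ 2 := fun x h hh => by
    have h1 := kernelAvg_taylor hLP.decayΘ hu.measurable hA (by positivity) le_rfl zero_le_one hu0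
      one_pos x h hh
    rwa [Real.one_rpow, mul_one] at h1
  let d : ℕ → E n → ℝ := fun j x => a j ^ (2 * s) * kernelAvg K g (a j) x
  have hdsum : ∀ x k, ∑ j ∈ Finset.range k, d j x =
      kernelAvg Θ u ((1 / 2 : ℝ) ^ k) x - kernelAvg Θ u 1 x := fun x k => by
    have h1 : ∀ j, d j x = kernelAvg Θ u ((1 / 2 : ℝ) ^ (j + 1)) x -
        kernelAvg Θ u ((1 / 2 : ℝ) ^ j) x := fun j => by
      have h2 := kernelAvg_dyadic hn hs hs1 hLP hd hu.measurable hA hgm hg.bound (hap j) x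
      simp only [d]
      rw [← h2]
      congr 2
      simp only [ha, pow_succ]; ring
    simp only [h1]
    rw [Finset.sum_range_sub (fun j => kernelAvg Θ u ((1 / 2 : ℝ) ^ j) x), pow_zero]
  have hdn : ∀ j x, |d j x| ≤ N * a j ^ (1 + s) := fun j x => by
    have h1 := abs_kernelAvg_le hLP.decayK hLP.integralK hgm hg.bound hM0 (by linarith)
      (by linarith) hg.holder (hap j) x
    have h2 : 0 < a j ^ (2 * s) := Real.rpow_pos_of_pos (hap j) _
    simp only [d]
    rw [abs_mul, abs_of_pos h2]
    calc _ ≤ a j ^ (2 * s) * (C * M * decayMoment n (1 - s) * a j ^ (1 - s)) :=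
          mul_le_mul_of_nonneg_left h1 h2.le
      _ = N * (a j ^ (2 * s) * a j ^ (1 - s)) := by rw [hN]; ring
      _ = _ := by rw [← Real.rpow_add (hap j)]; congr 2; ring
  have hdt : ∀ j x h, ‖h‖ ≤ a j →
      |d j (x + h) - d j x - P j x h| ≤ N * a j ^ (s - 1) * ‖h‖ ^ 2 := fun j x h hh => by
    have h1 := kernelAvg_taylor hLP.decayK hgm hg.bound hM0 (by linarith) (by linarith) hg.holder
      (hap j) x h hh
    have h2 : 0 < a j ^ (2 * s) := Real.rpow_pos_of_pos (hap j) _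
    have h3 : d j (x + h) - d j x - P j x h = a j ^ (2 * s) *
        (kernelAvg K g (a j) (x + h) - kernelAvg K g (a j) x - kernelAvgGrad K g (a j) x h) := by
      simp only [d, P, smul_apply, smul_eq_mul]; ring
    rw [h3, abs_mul, abs_of_pos h2]
    calc _ ≤ a j ^ (2 * s) * (C * M * decayMoment n (1 - s) * a j ^ (1 - s - 2) * ‖h‖ ^ 2) :=
          mul_le_mul_of_nonneg_left h1 h2.le
      _ = N * (a j ^ (2 * s) * a j ^ (1 - s - 2)) * ‖h‖ ^ 2 := by rw [hN]; ring
      _ = _ := by rw [← Real.rpow_add (hap j)]; congr 3; ring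
  -- Below scale |h| no cancellation is used: the two increments and the gradient term are each at
  -- most N a^s|h|.
  have hdt2 : ∀ j x h, a j ≤ ‖h‖ →
      |d j (x + h) - d j x - P j x h| ≤ 3 * N * a j ^ s * ‖h‖ := fun j x h hh => by
    have h1 := hdn j x
    have h2 := hdn j (x + h)
    have h3 : |P j x h| ≤ N * a j ^ s * ‖h‖ :=
      ((P j x).le_opNorm h).trans (mul_le_mul_of_nonneg_right (hPn j x) (norm_nonneg h))
    have h4 : N * a j ^ (1 + s) ≤ N * a j ^ s * ‖h‖ := by
      rw [Real.rpow_add (hap j), Real.rpow_one, mul_assoc N, mul_comm (a j)]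
      refine mul_le_mul_of_nonneg_left (mul_le_mul_of_nonneg_left hh ?_) hN'
      exact (Real.rpow_pos_of_pos (hap j) _).le
    rw [abs_le] at h1 h2 h3 ⊢
    constructor <;> linarith
  refine ⟨fun x => Q x + ∑' j, P j x, fun x => ?_, fun x => ?_, fun x h => ?_⟩
  · have := hA x
    have h1 : 0 ≤ 3 * N * Cs := by positivity
    have h2 : 0 ≤ N * (1 - (1 / 2 : ℝ) ^ s)⁻¹ := by positivity
    linarith
  · have h1 : 0 ≤ 3 * N * Cs := by positivity
    have := norm_add_le (Q x) (∑' j, P j x)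
    linarith [hQ x, hPt x]
  · have hpos1 : 0 ≤ 3 * N * Cs := by positivity
    have hpos2 : 0 ≤ N * (1 - (1 / 2 : ℝ) ^ s)⁻¹ := by positivity
    rcases eq_or_ne h 0 with rfl | hh0
    · simp only [add_zero, sub_self, map_zero, abs_zero]
      positivity
    rcases le_total ‖h‖ 1 with hh | hh
    -- The increments telescope to the average at scale 2^{-k} minus the one at scale 1, and the
    -- former converges to `u`.
    · have hlim : Filter.Tendsto (fun k => ∑ j ∈ Finset.range k,
          (d j (x + h) - d j x - P j x h)) Filter.atTop
          (𝓝 ((u (x + h) - kernelAvg Θ u 1 (x + h)) - (u x - kernelAvg Θ u 1 x) -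
            (∑' j, P j x) h)) := by
        have h1 : ∀ z, Filter.Tendsto (fun k => ∑ j ∈ Finset.range k, d j z) Filter.atTop
            (𝓝 (u z - kernelAvg Θ u 1 z)) := fun z => by
          simp only [hdsum]
          refine Filter.Tendsto.sub_const (kernelAvg_tendsto hLP hu hA ?_ z) _
          exact tendsto_pow_atTop_nhds_zero_of_lt_one hhalf.le (by norm_num)
        have h2 : Filter.Tendsto (fun k => ∑ j ∈ Finset.range k, P j x h) Filter.atTop
            (𝓝 ((∑' j, P j x) h)) := by
          have h3 := (hPs x).hasSum.tendsto_sum_nat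
          have h4 := ((ContinuousLinearMap.apply ℝ ℝ h).continuous.tendsto _).comp h3
          refine h4.congr fun k => ?_
          simp
        simpa only [Finset.sum_sub_distrib] using ((h1 (x + h)).sub (h1 x)).sub h2
      have hb := le_of_tendsto hlim.abs (Filter.Eventually.of_forall fun k =>
        dyadic_expansion hs hs1 (N := 3 * N) (by positivity) _ h hh0 hh (fun j hj => by
          refine (hdt j x h hj).trans ?_
          have : 0 ≤ N * a j ^ (s - 1) * ‖h‖ ^ 2 := by
            have := Real.rpow_pos_of_pos (hap j) (s - 1)
            positivity
          change _ ≤ 3 * N * a j ^ (s - 1) * ‖h‖ ^ 2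
          linarith) (fun j hj => hdt2 j x h hj) k)
      have hq := hQt x h hh
      have hsq : ‖h‖ ^ 2 ≤ ‖h‖ ^ (1 + s) := by
        rw [← Real.rpow_two]
        exact Real.rpow_le_rpow_of_exponent_ge (norm_pos_iff.2 hh0) hh (by linarith)
      have hpw : 0 ≤ ‖h‖ ^ (1 + s) := by positivity
      have hfin : |u (x + h) - u x - (Q x + ∑' j, P j x) h| ≤
          N0 * ‖h‖ ^ (1 + s) + 3 * N * Cs * ‖h‖ ^ (1 + s) := by
        have h5 := mul_le_mul_of_nonneg_left hsq hN0'
        rw [add_apply]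
        rw [abs_le] at hq hb ⊢
        constructor <;> linarith
      refine hfin.trans ?_
      have : 0 ≤ (2 * A + N * (1 - (1 / 2 : ℝ) ^ s)⁻¹) * ‖h‖ ^ (1 + s) := by positivity
      linarith
    -- For |h| ≥ 1 the bounds on the function and on its gradient suffice.
    · have h1 := hA (x + h)
      have h2 := hA x
      have h3 : |(Q x + ∑' j, P j x) h| ≤ (N0 + N * (1 - (1 / 2 : ℝ) ^ s)⁻¹) * ‖h‖ := by
        refine ((Q x + ∑' j, P j x).le_opNorm h).trans
          (mul_le_mul_of_nonneg_right ?_ (norm_nonneg h))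
        exact (norm_add_le _ _).trans (add_le_add (hQ x) (hPt x))
      have h4 : ‖h‖ ≤ ‖h‖ ^ (1 + s) := by
        nth_rewrite 1 [← Real.rpow_one ‖h‖]
        exact Real.rpow_le_rpow_of_exponent_le hh (by linarith)
      have h5 : 1 ≤ ‖h‖ ^ (1 + s) := hh.trans h4
      have h6 : |u (x + h) - u x - (Q x + ∑' j, P j x) h| ≤
          2 * A + (N0 + N * (1 - (1 / 2 : ℝ) ^ s)⁻¹) * ‖h‖ := by
        rw [abs_le] at h1 h2 h3 ⊢
        constructor <;> linarith
      refine h6.trans ?_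
      have h7 := mul_le_mul_of_nonneg_left h5 (by positivity : 0 ≤ 2 * A)
      have h8 := mul_le_mul_of_nonneg_left h4
        (by positivity : 0 ≤ N0 + N * (1 - (1 / 2 : ℝ) ^ s)⁻¹)
      have h9 : 0 ≤ 3 * N * Cs * ‖h‖ ^ (1 + s) := by positivity
      linarith

/-! ### Functions of class C^{1,s} -/

section HolderC1

variable {n : ℕ} {s D : ℝ} {f : E n → ℝ} {p : E n → E n →L[ℝ] ℝ}

lemma HolderC1.nonneg (h : HolderC1 s D f p) : 0 ≤ D := (abs_nonneg _).trans (h.bound 0)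

lemma HolderC1.hasFDerivAt (h : HolderC1 s D f p) (hs : 0 < s) (x : E n) :
    HasFDerivAt f (p x) x := by
  rw [hasFDerivAt_iff_isLittleO_nhds_zero]
  have h1 : (fun v : E n => f (x + v) - f x - p x v) =O[𝓝 0] fun v => ‖v‖ ^ (1 + s) := by
    refine Asymptotics.IsBigO.of_bound D (Filter.Eventually.of_forall fun v => ?_)
    rw [Real.norm_eq_abs, Real.norm_of_nonneg (by positivity)]
    exact h.expand x v
  refine h1.trans_isLittleO ?_
  rw [Asymptotics.isLittleO_iff]
  intro c hc
  have ht : Filter.Tendsto (fun v : E n => ‖v‖ ^ s) (𝓝 0) (𝓝 0) := by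
    have hcont : Continuous (fun v : E n => ‖v‖ ^ s) :=
      continuous_norm.rpow_const fun _ => Or.inr hs.le
    simpa [Real.zero_rpow hs.ne'] using hcont.tendsto 0
  filter_upwards [ht.eventually (gt_mem_nhds hc)] with v hv
  rw [Real.norm_of_nonneg (by positivity)]
  rcases eq_or_ne v 0 with rfl | hv0
  · simp [Real.zero_rpow (show 1 + s ≠ 0 by linarith)]
  · rw [Real.rpow_add (norm_pos_iff.2 hv0), Real.rpow_one, mul_comm]
    exact mul_le_mul_of_nonneg_right hv.le (norm_nonneg v)

lemma HolderC1.fderiv_eq (h : HolderC1 s D f p) (hs : 0 < s) (x : E n) : fderiv ℝ f x = p x :=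
  (h.hasFDerivAt hs x).fderiv

lemma HolderC1.continuous (h : HolderC1 s D f p) (hs : 0 < s) : Continuous f :=
  continuous_iff_continuousAt.2 fun x => (h.hasFDerivAt hs x).continuousAt

lemma HolderC1.lipschitz (h : HolderC1 s D f p) (hs : 0 < s) (x y : E n) :
    |f x - f y| ≤ D * ‖x - y‖ := by
  have := convex_univ.norm_image_sub_le_of_norm_hasFDerivWithin_le (𝕜 := ℝ) (x := y) (y := x)
    (fun z _ => (h.hasFDerivAt hs z).hasFDerivWithinAt) (fun z _ => h.bound_grad z)
    (mem_univ _) (mem_univ _)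
  rwa [Real.norm_eq_abs] at this

lemma HolderC1.secondDiff_le (h : HolderC1 s D f p) (hs : 0 < s) (x y : E n) :
    |secondDiff f x y| ≤ 4 * D * min (‖y‖ ^ (1 + s)) 1 := by
  have hD := h.nonneg
  refine mul_min_of_le ?_ (norm_nonneg y) (by linarith) fun hy => ?_
  · have h0 := h.bound x
    have h1 := h.bound (x + y)
    have h2 := h.bound (x - y)
    unfold secondDiff
    rw [abs_le] at h0 h1 h2 ⊢
    constructor <;> linarith
  · have h1 := h.expand x y
    have h2 := h.expand x (-y)
    rw [norm_neg, map_neg, ← sub_eq_add_neg] at h2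
    have h3 : 0 ≤ D * ‖y‖ ^ (1 + s) := by positivity
    unfold secondDiff
    rw [abs_le] at h1 h2 ⊢
    constructor <;> linarith

lemma HolderC1.fracLapConverges (hn : 1 ≤ n) (h : HolderC1 s D f p) (hs : 0 < s) (hs1 : s < 1)
    (x : E n) : FracLapConverges s f x :=
  integrable_div_kernel hn (κ := 1 + s) (by linarith) (by linarith)
    (measurable_secondDiff (h.continuous hs).measurable x) (h.secondDiff_le hs x)

lemma integrable_weight {σ B : ℝ} (hσ : 0 < σ) (hf : Measurable f) (hB : ∀ x, |f x| ≤ B) :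
    Integrable (fun y : E n => f y / (1 + ‖y‖ ^ ((n : ℝ) + 2 * σ))) := by
  have hi := integrable_one_add_norm (E := E n) (μ := volume) (r := (n : ℝ) + 2 * σ)
    (by simp; linarith)
  have hB0 : 0 ≤ B := (abs_nonneg _).trans (hB 0)
  have hr : 0 ≤ (n : ℝ) + 2 * σ := by positivity
  refine (hi.const_mul (B * 2 ^ ((n : ℝ) + 2 * σ))).mono' ?_
    (Filter.Eventually.of_forall fun y => ?_)
  · exact (hf.div ((measurable_norm.pow_const _).const_add 1)).aestronglyMeasurable
  · have h0 : 0 ≤ ‖y‖ ^ ((n : ℝ) + 2 * σ) := by positivity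
    have h1 : (0 : ℝ) < 1 + ‖y‖ := by positivity
    have h2 : (1 + ‖y‖) ^ ((n : ℝ) + 2 * σ) ≤
        2 ^ ((n : ℝ) + 2 * σ) * (1 + ‖y‖ ^ ((n : ℝ) + 2 * σ)) := by
      have hm : 1 + ‖y‖ ≤ 2 * max 1 ‖y‖ := by
        linarith [le_max_left 1 ‖y‖, le_max_right 1 ‖y‖]
      have hm0 : (0 : ℝ) ≤ max 1 ‖y‖ := le_max_of_le_left zero_le_one
      calc _ ≤ (2 * max 1 ‖y‖) ^ ((n : ℝ) + 2 * σ) := Real.rpow_le_rpow h1.le hm hr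
        _ = 2 ^ ((n : ℝ) + 2 * σ) * (max 1 ‖y‖) ^ ((n : ℝ) + 2 * σ) :=
            Real.mul_rpow zero_le_two hm0
        _ ≤ _ := by
            refine mul_le_mul_of_nonneg_left ?_ (by positivity)
            rcases le_total 1 ‖y‖ with h | h
            · rw [max_eq_right h]; linarith
            · rw [max_eq_left h, Real.one_rpow]; linarith
    rw [norm_div, Real.norm_eq_abs, Real.norm_of_nonneg (by positivity),
      div_le_iff₀ (by positivity), Real.rpow_neg h1.le]
    have h3 : 0 < (1 + ‖y‖) ^ ((n : ℝ) + 2 * σ) := by positivity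
    calc |f y| ≤ B * 1 := by rw [mul_one]; exact hB y
      _ ≤ B * (2 ^ ((n : ℝ) + 2 * σ) * (1 + ‖y‖ ^ ((n : ℝ) + 2 * σ)) *
            ((1 + ‖y‖) ^ ((n : ℝ) + 2 * σ))⁻¹) := by
          refine mul_le_mul_of_nonneg_left ?_ hB0
          rw [← div_eq_mul_inv, le_div_iff₀ h3, one_mul]
          exact h2
      _ = _ := by ring

/-- With ε = κ - 2σ the order 2σ+ε is κ > 1, which rules out the case where the slope must vanish.
-/
lemma punctuallyRegular_of_expand {σ κ C : ℝ} {x : E n} {P : E n →L[ℝ] ℝ} (hκ : 2 * σ < κ)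
    (hκ1 : 1 < κ) (h : ∀ᶠ y in 𝓝 (0 : E n), |f (x + y) - f x - P y| ≤ C * ‖y‖ ^ κ) :
    PunctuallyRegular σ f x := by
  refine ⟨κ - 2 * σ, by linarith, (InnerProductSpace.toDual ℝ (E n)).symm P, C,
    fun h => by linarith, ?_⟩
  filter_upwards [h] with y hy
  rw [InnerProductSpace.toDual_symm_apply, add_sub_cancel]
  exact hy

lemma HolderC1.inDomain {σ : ℝ} (h : HolderC1 s D f p) (hs : 0 < s) (hσ : 0 < σ) (hσs : σ < s)
    (hs1 : s < 1) (x : E n) : InDomain σ f x where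
  regular := punctuallyRegular_of_expand (κ := 1 + s) (by linarith) (by linarith)
    (Filter.Eventually.of_forall fun y => h.expand x y)
  weight := integrable_weight hσ (h.continuous hs).measurable h.bound

/-- The point z + e with |e| = |z - x| is reached by the expansion at z and by the one at x. The
three remainders, at steps e, z-x+e and z-x, contribute 1, 4 and 1 times D|z-x|^{1+s}. -/
lemma HolderC1.holder_grad (h : HolderC1 s D f p) (hs : 0 < s) (hs1 : s < 1) (x z : E n) :
    ‖p z - p x‖ ≤ 6 * D * ‖z - x‖ ^ s := by
  have hD := h.nonneg
  rcases eq_or_ne z x with rfl | hne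
  · rw [sub_self, sub_self, norm_zero, norm_zero]
    positivity
  set ρ : ℝ := ‖z - x‖ with hρ
  have hρ0 : 0 < ρ := norm_pos_iff.2 (sub_ne_zero.2 hne)
  have hsphere : ∀ e : E n, ‖e‖ = ρ → |(p z - p x) e| ≤ 6 * D * ρ ^ (1 + s) := by
    intro e he
    have h1 := h.expand z e
    have h2 := h.expand x (z - x + e)
    have h3 := h.expand x (z - x)
    have e2 : x + (z - x + e) = z + e := by abel
    have e3 : x + (z - x) = z := by abel
    rw [e2, map_add] at h2
    rw [e3, ← hρ] at h3
    rw [he] at h1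
    have h4 : ‖z - x + e‖ ^ (1 + s) ≤ 4 * ρ ^ (1 + s) := by
      have h5 : ‖z - x + e‖ ≤ 2 * ρ := (norm_add_le _ _).trans (by rw [he, ← hρ]; linarith)
      calc _ ≤ (2 * ρ) ^ (1 + s) := Real.rpow_le_rpow (norm_nonneg _) h5 (by linarith)
        _ = 2 ^ (1 + s) * ρ ^ (1 + s) := Real.mul_rpow zero_le_two hρ0.le
        _ ≤ 2 ^ (2 : ℝ) * ρ ^ (1 + s) := by
            refine mul_le_mul_of_nonneg_right ?_ (by positivity)
            exact Real.rpow_le_rpow_of_exponent_le one_le_two (by linarith)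
        _ = _ := by norm_num
    have h6 := mul_le_mul_of_nonneg_left h4 hD
    rw [sub_apply]
    rw [abs_le] at h1 h2 h3 ⊢
    constructor <;> linarith
  refine ContinuousLinearMap.opNorm_le_bound _ (by positivity) fun w => ?_
  rcases eq_or_ne w 0 with rfl | hw
  · simp
  have hw0 : 0 < ‖w‖ := norm_pos_iff.2 hw
  have h1 := hsphere ((ρ / ‖w‖) • w) (by
    rw [norm_smul, Real.norm_of_nonneg (by positivity)]; field_simp)
  rw [map_smul, smul_eq_mul, abs_mul, abs_of_pos (by positivity), Real.rpow_add hρ0,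
    Real.rpow_one, div_mul_eq_mul_div, div_le_iff₀ hw0] at h1
  rw [Real.norm_eq_abs]
  refine le_of_mul_le_mul_left ?_ hρ0
  calc _ ≤ _ := h1
    _ = _ := by ring

/-- For |y| ≥ 1 the Lipschitz bound suffices. For |y| ≤ |v| each second difference is O(|y|^{1+s}),
and |y|^{1-s} is traded for |v|^{1-s}. For |v| ≤ |y| ≤ 1 one expands in v at x, x+y and x-y: the
gradient differences cost 6+6, the remainders 4. The remaining exponent 2s is enough for operators
of order 2σ < 2s, though not for (-Δ)^s. -/
lemma HolderC1.secondDiff_shift_le (h : HolderC1 s D f p) (hs : 0 < s) (hs1 : s < 1) (x y v : E n)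
    (hv : ‖v‖ ≤ 1) : |secondDiff f (x + v) y - secondDiff f x y| ≤
      16 * D * ‖v‖ ^ (1 - s) * min (‖y‖ ^ (2 * s)) 1 := by
  have hD := h.nonneg
  rcases eq_or_ne v 0 with rfl | hv0
  · rw [add_zero, sub_self, abs_zero]
    positivity
  have hvp : 0 < ‖v‖ := norm_pos_iff.2 hv0
  have hvs : 0 ≤ ‖v‖ ^ (1 - s) := by positivity
  have hsplit : ‖v‖ ^ (1 + s) = ‖v‖ ^ (1 - s) * ‖v‖ ^ (2 * s) := by
    rw [← Real.rpow_add hvp]; congr 1; ring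
  refine mul_min_of_le ?_ (norm_nonneg y) (by linarith) fun hy => ?_
  · have hl : ∀ z, |f (z + v) - f z| ≤ D * ‖v‖ ^ (1 - s) := fun z => by
      have h1 := h.lipschitz hs (z + v) z
      rw [add_sub_cancel_left] at h1
      refine h1.trans (mul_le_mul_of_nonneg_left ?_ hD)
      nth_rewrite 1 [← Real.rpow_one ‖v‖]
      exact Real.rpow_le_rpow_of_exponent_ge hvp hv (by linarith)
    have h1 := hl x
    have h2 := hl (x + y)
    have h3 := hl (x - y)
    have h4 : 0 ≤ D * ‖v‖ ^ (1 - s) := by positivity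
    unfold secondDiff
    rw [add_right_comm x v y, show x + v - y = x - y + v by abel]
    rw [abs_le] at h1 h2 h3 ⊢
    constructor <;> linarith
  · rcases le_total ‖y‖ ‖v‖ with hyv | hyv
    · have hb : ∀ z, |secondDiff f z y| ≤ 4 * D * (‖v‖ ^ (1 - s) * ‖y‖ ^ (2 * s)) := fun z => by
        refine (h.secondDiff_le hs z y).trans ?_
        refine mul_le_mul_of_nonneg_left ((min_le_left _ _).trans ?_) (by positivity)
        rcases eq_or_ne y 0 with rfl | hy0
        · rw [norm_zero, Real.zero_rpow (by linarith)]
          positivity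
        · have hyp : 0 < ‖y‖ := norm_pos_iff.2 hy0
          have : ‖y‖ ^ (1 + s) = ‖y‖ ^ (1 - s) * ‖y‖ ^ (2 * s) := by
            rw [← Real.rpow_add hyp]; congr 1; ring
          rw [this]
          exact mul_le_mul_of_nonneg_right
            (Real.rpow_le_rpow hyp.le hyv (by linarith)) (by positivity)
      have h1 := hb x
      have h2 := hb (x + v)
      have h3 : 0 ≤ D * (‖v‖ ^ (1 - s) * ‖y‖ ^ (2 * s)) := by positivity
      rw [abs_le] at h1 h2 ⊢
      constructor <;> linarith
    · have e0 := h.expand x v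
      have e1 := h.expand (x + y) v
      have e2 := h.expand (x - y) v
      have hg : ∀ w : E n, ‖w‖ = ‖y‖ → |(p (x + w) - p x) v| ≤
          6 * D * (‖v‖ ^ (1 - s) * ‖y‖ ^ (2 * s)) := fun w hw => by
        have h1 := h.holder_grad hs hs1 x (x + w)
        rw [add_sub_cancel_left, hw] at h1
        have h2 := ((p (x + w) - p x).le_opNorm v).trans
          (mul_le_mul_of_nonneg_right h1 (norm_nonneg v))
        refine h2.trans ?_
        rw [mul_assoc]
        refine mul_le_mul_of_nonneg_left ?_ (by positivity)
        have h3 : ‖v‖ = ‖v‖ ^ (1 - s) * ‖v‖ ^ s := by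
          rw [← Real.rpow_add hvp]; simp
        have h4 : ‖y‖ ^ (2 * s) = ‖y‖ ^ s * ‖y‖ ^ s := by
          rw [← Real.rpow_add (hvp.trans_le hyv)]; congr 1; ring
        have h5 : ‖v‖ ^ s ≤ ‖y‖ ^ s := Real.rpow_le_rpow hvp.le hyv hs.le
        rw [h4]
        calc _ = ‖y‖ ^ s * (‖v‖ ^ (1 - s) * ‖v‖ ^ s) := by rw [← h3]
          _ = ‖v‖ ^ (1 - s) * (‖y‖ ^ s * ‖v‖ ^ s) := by ring
          _ ≤ _ := mul_le_mul_of_nonneg_left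
            (mul_le_mul_of_nonneg_left h5 (by positivity)) hvs
      have g1 := hg y rfl
      have g2 := hg (-y) (norm_neg y)
      rw [← sub_eq_add_neg] at g2
      rw [sub_apply] at g1 g2
      have hvy : ‖v‖ ^ (1 + s) ≤ ‖v‖ ^ (1 - s) * ‖y‖ ^ (2 * s) := by
        rw [hsplit]
        exact mul_le_mul_of_nonneg_left (Real.rpow_le_rpow hvp.le hyv (by linarith)) hvs
      have hvy' := mul_le_mul_of_nonneg_left hvy hD
      unfold secondDiff
      rw [add_right_comm x v y, show x + v - y = x - y + v by abel]
      rw [abs_le] at e0 e1 e2 g1 g2 ⊢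
      constructor <;> linarith

lemma HolderC1.continuous_fracLap (hn : 1 ≤ n) (h : HolderC1 s D f p) (hs : 0 < s) (hs1 : s < 1) :
    Continuous (fracLap s f) := by
  have hf := h.continuous hs
  unfold fracLap
  refine continuous_const.mul (continuous_of_dominated
    (bound := fun y => 4 * D * (min (‖y‖ ^ (1 + s)) 1 / ‖y‖ ^ ((n : ℝ) + 2 * s)))
    (fun x => (h.fracLapConverges hn hs hs1 x).1)
    (fun x => Filter.Eventually.of_forall fun y => abs_div_kernel_le (h.secondDiff_le hs x y))
    ((integrable_truncKernel hn (by linarith) (by linarith)).const_mul _)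
    (Filter.Eventually.of_forall fun y => ?_))
  unfold secondDiff
  fun_prop

/-- By symmetry of the operator both continuous functions have the same integral against every test
function, so they agree almost everywhere and hence everywhere. -/
lemma HolderC1.fracLap_eq_of_isDistribFracLap (hn : 1 ≤ n) (h : HolderC1 s D f p) (hs : 0 < s)
    (hs1 : s < 1) {g : E n → ℝ} (hg : Continuous g) (hd : IsDistribFracLap s f g) (x : E n) :
    fracLap s f x = g x := by
  have hc := h.continuous_fracLap hn hs hs1
  have hae : ∀ᵐ x ∂(volume : Measure (E n)), fracLap s f x - g x = 0 := by
    refine ae_eq_zero_of_integral_contDiff_smul_eq_zero (hc.sub hg).locallyIntegrable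
      fun φ hφ hφc => ?_
    obtain ⟨C, hC⟩ := exists_decayKernel_of_hasCompactSupport hφ hφc
    have h1 := integral_fracLap_symm hn hs hs1 (κ := 1 + s) (by linarith)
      (h.continuous hs).measurable h.bound (h.secondDiff_le hs) hφ.continuous.measurable
      hC.integrable hC.secondDiff_le_diffWeight
    rw [hd φ hφ hφc] at h1
    have i1 : Integrable (fun x => fracLap s f x * φ x) :=
      (hc.mul hφ.continuous).integrable_of_hasCompactSupport hφc.mul_left
    have i2 : Integrable (fun x => g x * φ x) :=
      (hg.mul hφ.continuous).integrable_of_hasCompactSupport hφc.mul_left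
    have h2 : ∀ x, φ x • (fracLap s f x - g x) = fracLap s f x * φ x - g x * φ x := fun x => by
      rw [smul_eq_mul]; ring
    simp only [h2]
    rw [integral_sub i1 i2, h1, sub_self]
  have heq := (Continuous.ae_eq_iff_eq volume (hc.sub hg) continuous_const).1 hae
  have := congrFun heq x
  simpa [sub_eq_zero] using this

end HolderC1

/-! ### Lower order operators and continuity of the elliptic terms -/

lemma le_rpow_mul_rpow {a x y θ : ℝ} (ha : 0 ≤ a) (hx : a ≤ x) (hy : a ≤ y) (hθ : 0 ≤ θ)
    (hθ1 : θ ≤ 1) : a ≤ x ^ θ * y ^ (1 - θ) := by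
  rcases ha.eq_or_lt with rfl | h
  · exact mul_nonneg (Real.rpow_nonneg hx _) (Real.rpow_nonneg hy _)
  · calc a = a ^ θ * a ^ (1 - θ) := by rw [← Real.rpow_add h]; simp
      _ ≤ _ := mul_le_mul (Real.rpow_le_rpow ha hx hθ)
        (Real.rpow_le_rpow ha hy (by linarith)) (by positivity) (Real.rpow_nonneg (ha.trans hx) _)

section HolderC1

variable {n : ℕ} {s D : ℝ} {f : E n → ℝ} {p : E n → E n →L[ℝ] ℝ}

lemma HolderC1.shift (h : HolderC1 s D f p) (v : E n) :
    HolderC1 s D (fun z => f (z + v)) (fun z => p (z + v)) where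
  bound x := h.bound _
  bound_grad x := h.bound_grad _
  expand x w := by
    have := h.expand (x + v) w
    rwa [add_right_comm] at this

lemma holderC1_zero (n : ℕ) (s : ℝ) :
    HolderC1 s 0 (fun _ : E n => (0 : ℝ)) (fun _ => 0) where
  bound x := by simp
  bound_grad x := by simp
  expand x w := by simp

lemma HolderC1.abs_fracLap_le (hn : 1 ≤ n) (h : HolderC1 s D f p) (hs : 0 < s) (hs1 : s < 1)
    (x : E n) : |fracLap s f x| ≤ fracConst n s / 2 * truncConst n (2 * s) (1 + s) * (4 * D) :=
  NonlocalObstacle.abs_fracLap_le hn hs hs1 (by linarith) (h.secondDiff_le hs x)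

lemma HolderC1.abs_nonlocalOp_le (hn : 1 ≤ n) {σ lam Lam : ℝ} (h : HolderC1 s D f p) (hs : 0 < s)
    (hs1 : s < 1) (hσ : 0 < σ) (hσs : σ < s) (h0 : 0 < lam) (h1 : lam ≤ Lam)
    {J : (E n → ℝ) → E n → ℝ} (hJ : IsNonlocalOp σ lam Lam J) (x : E n) :
    |J f x| ≤ Lam * truncConst n (2 * σ) (1 + s) * (4 * D) := by
  have := hJ.abs_sub_le hn hσ (κ := 1 + s) (by linarith) h0 h1 (h.inDomain hs hσ hσs hs1 x)
    ((holderC1_zero n s).inDomain hs hσ hσs hs1 x) (B := 4 * D) (fun y => by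
      have := h.secondDiff_le hs x y
      simpa [secondDiff] using this)
  rwa [hJ.map_zero, sub_zero] at this

/-- Translation invariance turns an increment in x into a difference of two functions at one point,
where ellipticity applies. -/
lemma HolderC1.nonlocalOp_shift_le (hn : 1 ≤ n) {σ lam Lam : ℝ} (h : HolderC1 s D f p)
    (hs : 0 < s) (hs1 : s < 1) (hσ : 0 < σ) (hσs : σ < s) (h0 : 0 < lam) (h1 : lam ≤ Lam)
    {J : (E n → ℝ) → E n → ℝ} (hJ : IsNonlocalOp σ lam Lam J) (x v : E n) (hv : ‖v‖ ≤ 1) :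
    |J f (x + v) - J f x| ≤ Lam * truncConst n (2 * σ) (2 * s) * (16 * D * ‖v‖ ^ (1 - s)) := by
  rw [← hJ.translation f x v (h.inDomain hs hσ hσs hs1 _)]
  refine hJ.abs_sub_le hn hσ (κ := 2 * s) (by linarith) h0 h1
    ((h.shift v).inDomain hs hσ hσs hs1 x) (h.inDomain hs hσ hσs hs1 x) fun y => ?_
  have h2 := h.secondDiff_shift_le hs hs1 x y v hv
  have h3 : secondDiff (fun z => f (z + v)) x y = secondDiff f (x + v) y := by
    simp only [secondDiff, add_right_comm x v y, show x + v - y = x - y + v by abel]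
  rwa [h3]

/-- Lower order operators map `C^{1,s}` into `C^{1-s}`. -/
lemma exists_holderX_lowerOp (hn : 1 ≤ n) {σ lam Lam : ℝ} (hs : 1 / 2 < s)
    (hs1 : s < 1) (hσ : 0 < σ) (hσs : σ < s) (h0 : 0 < lam) (h1 : lam ≤ Lam) (b : E n) (r D : ℝ) :
    ∃ C, ∀ (f : E n → ℝ) (p : E n → E n →L[ℝ] ℝ) (J : (E n → ℝ) → E n → ℝ),
      HolderC1 s D f p → IsNonlocalOp σ lam Lam J → HolderX (1 - s) C (lowerOp b r J f) := by
  have hs0 : 0 < s := by linarith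
  have hLam : 0 ≤ Lam := by linarith
  set C0 : ℝ := Lam * truncConst n (2 * σ) (1 + s) * (4 * D) + D * ‖b‖ + |r| * D with hC0
  set C1 : ℝ := Lam * truncConst n (2 * σ) (2 * s) * (16 * D) + 6 * D * ‖b‖ + |r| * D with hC1
  refine ⟨2 * C0 + C1, fun f p J hf hJ => ?_⟩
  have hD := hf.nonneg
  have ht1 := truncConst_nonneg n (2 * σ) (1 + s)
  have ht2 := truncConst_nonneg n (2 * σ) (2 * s)
  have hC0' : 0 ≤ C0 := by positivity
  have hC1' : 0 ≤ C1 := by positivity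
  have hbd : ∀ x, |lowerOp b r J f x| ≤ C0 := fun x => by
    unfold lowerOp
    rw [hf.fderiv_eq hs0]
    have a1 := hf.abs_nonlocalOp_le hn hs0 hs1 hσ hσs h0 h1 hJ x
    have a2 : |p x b| ≤ D * ‖b‖ := ((p x).le_opNorm b).trans
      (mul_le_mul_of_nonneg_right (hf.bound_grad x) (norm_nonneg b))
    have a3 : |r * f x| ≤ |r| * D := by
      rw [abs_mul]; exact mul_le_mul_of_nonneg_left (hf.bound x) (abs_nonneg r)
    rw [abs_le] at a1 a2 a3 ⊢
    constructor <;> linarith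
  refine ⟨fun x => (hbd x).trans (by linarith), fun x z => ?_⟩
  rcases le_total ‖x - z‖ 1 with hxz | hxz
  · obtain ⟨v, rfl⟩ : ∃ v, x = z + v := ⟨x - z, by abel⟩
    rw [add_sub_cancel_left] at hxz ⊢
    have hv0 := norm_nonneg v
    -- This is where s > 1/2 enters: the gradient is C^s, which is at least as good as C^{1-s}.
    have e1 : ‖v‖ ^ s ≤ ‖v‖ ^ (1 - s) := by
      rcases hv0.eq_or_lt with h | h
      · rw [← h, Real.zero_rpow (by linarith), Real.zero_rpow (by linarith)]
      · exact Real.rpow_le_rpow_of_exponent_ge h hxz (by linarith)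
    have e2 : ‖v‖ ≤ ‖v‖ ^ (1 - s) := by
      rcases hv0.eq_or_lt with h | h
      · rw [← h]; positivity
      · nth_rewrite 1 [← Real.rpow_one ‖v‖]
        exact Real.rpow_le_rpow_of_exponent_ge h hxz (by linarith)
    have a1 := hf.nonlocalOp_shift_le hn hs0 hs1 hσ hσs h0 h1 hJ z v hxz
    have a2 : |p (z + v) b - p z b| ≤ 6 * D * ‖b‖ * ‖v‖ ^ (1 - s) := by
      have g1 := hf.holder_grad hs0 hs1 z (z + v)
      rw [add_sub_cancel_left] at g1
      rw [← sub_apply]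
      calc _ ≤ ‖p (z + v) - p z‖ * ‖b‖ := (p (z + v) - p z).le_opNorm b
        _ ≤ 6 * D * ‖v‖ ^ (1 - s) * ‖b‖ := by
          refine mul_le_mul_of_nonneg_right (g1.trans ?_) (norm_nonneg b)
          exact mul_le_mul_of_nonneg_left e1 (by positivity)
        _ = _ := by ring
    have a3 : |r * f (z + v) - r * f z| ≤ |r| * D * ‖v‖ ^ (1 - s) := by
      have g1 := hf.lipschitz hs0 (z + v) z
      rw [add_sub_cancel_left] at g1
      rw [← mul_sub, abs_mul, mul_assoc]
      exact mul_le_mul_of_nonneg_left (g1.trans (mul_le_mul_of_nonneg_left e2 hD)) (abs_nonneg r)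
    have hfin : |lowerOp b r J f (z + v) - lowerOp b r J f z| ≤ C1 * ‖v‖ ^ (1 - s) := by
      unfold lowerOp
      rw [hf.fderiv_eq hs0, hf.fderiv_eq hs0, hC1]
      rw [abs_le] at a1 a2 a3 ⊢
      constructor <;> linarith
    refine hfin.trans (mul_le_mul_of_nonneg_right (by linarith) (by positivity))
  · have a1 := hbd x
    have a2 := hbd z
    have e1 : 1 ≤ ‖x - z‖ ^ (1 - s) := Real.one_le_rpow hxz (by linarith)
    have e2 := mul_le_mul_of_nonneg_left e1 (by positivity : 0 ≤ 2 * C0 + C1)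
    rw [abs_le] at a1 a2 ⊢
    constructor <;> linarith

/-- A geometric mean of the bounds 4d and 8D|y|^{1+s}: smallness in d is bought with part of the
exponent in |y|. -/
lemma HolderC1.secondDiff_sub_le {f' : E n → ℝ} {p' : E n → E n →L[ℝ] ℝ} {d θ : ℝ}
    (h : HolderC1 s D f p) (h' : HolderC1 s D f' p') (hs : 0 < s) (hθ : 0 ≤ θ) (hθ1 : θ < 1)
    (hd : ∀ x, |f x - f' x| ≤ d) (x y : E n) :
    |secondDiff f x y - secondDiff f' x y| ≤
      (4 * d) ^ θ * (8 * D) ^ (1 - θ) * min (‖y‖ ^ ((1 + s) * (1 - θ))) 1 := by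
  have hD := h.nonneg
  have b0 : |secondDiff f x y - secondDiff f' x y| ≤ 4 * d := by
    have h0 := hd x
    have h1 := hd (x + y)
    have h2 := hd (x - y)
    unfold secondDiff
    rw [abs_le] at h0 h1 h2 ⊢
    constructor <;> linarith
  have b1 : |secondDiff f x y - secondDiff f' x y| ≤ 8 * D * min (‖y‖ ^ (1 + s)) 1 := by
    have h0 := h.secondDiff_le hs x y
    have h1 := h'.secondDiff_le hs x y
    rw [abs_le] at h0 h1 ⊢
    constructor <;> linarith
  have h8 : 0 ≤ 8 * D := by positivity
  refine mul_min_of_le ?_ (norm_nonneg y) (mul_pos (by linarith) (by linarith)) fun hy => ?_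
  · exact le_rpow_mul_rpow (abs_nonneg _) b0
      (b1.trans (mul_le_of_le_one_right h8 (min_le_right _ _))) hθ hθ1.le
  · have b2 := b1.trans (mul_le_mul_of_nonneg_left (min_le_left _ _) h8)
    refine (le_rpow_mul_rpow (abs_nonneg _) b0 b2 hθ hθ1.le).trans (le_of_eq ?_)
    rw [Real.mul_rpow h8 (by positivity), ← Real.rpow_mul (norm_nonneg y), mul_assoc]

/-- The step ρ = d^{1/(1+s)} balances the Taylor remainders 2Dρ^{1+s} against the error 2d in the
values. -/
lemma HolderC1.grad_sub_le {f' : E n → ℝ} {p' : E n → E n →L[ℝ] ℝ} {d : ℝ}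
    (h : HolderC1 s D f p) (h' : HolderC1 s D f' p') (hs : 0 < s) (hd0 : 0 < d)
    (hd : ∀ x, |f x - f' x| ≤ d) (x : E n) :
    ‖p x - p' x‖ ≤ (2 * D + 2) * d ^ (s / (1 + s)) := by
  have hD := h.nonneg
  set ρ : ℝ := d ^ (1 / (1 + s)) with hρ
  have hρ0 : 0 < ρ := Real.rpow_pos_of_pos hd0 _
  have hρd : ρ ^ (1 + s) = d := by
    rw [hρ, ← Real.rpow_mul hd0.le, one_div, inv_mul_cancel₀ (by linarith), Real.rpow_one]
  have hρs : ρ ^ s = d ^ (s / (1 + s)) := by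
    rw [hρ, ← Real.rpow_mul hd0.le]; congr 1; ring
  rw [← hρs]
  refine ContinuousLinearMap.opNorm_le_bound _ (by positivity) fun w => ?_
  rcases eq_or_ne w 0 with rfl | hw
  · simp
  have hw0 : 0 < ‖w‖ := norm_pos_iff.2 hw
  set e : E n := (ρ / ‖w‖) • w with he
  have hen : ‖e‖ = ρ := by
    rw [he, norm_smul, Real.norm_of_nonneg (by positivity)]; field_simp
  have h1 := h.expand x e
  have h2 := h'.expand x e
  have h3 := hd x
  have h4 := hd (x + e)
  have h5 : |(p x - p' x) e| ≤ (2 * D + 2) * d := by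
    rw [hen, hρd] at h1 h2
    rw [sub_apply]
    rw [abs_le] at h1 h2 h3 h4 ⊢
    constructor <;> linarith
  rw [he, map_smul, smul_eq_mul, abs_mul, abs_of_pos (by positivity), ← hρd, Real.rpow_add hρ0,
    Real.rpow_one, div_mul_eq_mul_div, div_le_iff₀ hw0] at h5
  rw [Real.norm_eq_abs]
  refine le_of_mul_le_mul_left ?_ hρ0
  calc _ ≤ _ := h5
    _ = _ := by ring

/-- The elliptic part is continuous with respect to uniform convergence of functions that are
bounded in `C^{1,s}`. -/
lemma exists_elliptic_modulus (hn : 1 ≤ n) {σ lam Lam : ℝ} (hs : 1 / 2 < s)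
    (hs1 : s < 1) (hσ : 0 < σ) (hσs : σ < s) (h0 : 0 < lam) (h1 : lam ≤ Lam) (b : E n) (r D : ℝ) :
    ∃ Ψ : ℝ → ℝ, Filter.Tendsto Ψ (𝓝 0) (𝓝 0) ∧
      ∀ (f f' : E n → ℝ) (p p' : E n → E n →L[ℝ] ℝ) (J : (E n → ℝ) → E n → ℝ) (d : ℝ) (x : E n),
      HolderC1 s D f p → HolderC1 s D f' p' → IsNonlocalOp σ lam Lam J → 0 ≤ d →
      (∀ x, |f x - f' x| ≤ d) → |fracLap s f x - fracLap s f' x| ≤ Ψ d ∧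
      |lowerOp b r J f x - lowerOp b r J f' x| ≤ Ψ d := by
  have hs0 : 0 < s := by linarith
  have hLam : 0 ≤ Lam := by linarith
  -- With this choice (1+s)(1-θ) = (1+3s)/2, the midpoint of 2s and 1+s.
  set θ : ℝ := (1 - s) / (2 * (1 + s)) with hθ
  have hθ0 : 0 < θ := div_pos (by linarith) (by linarith)
  have hθe : θ * (2 * (1 + s)) = 1 - s := div_mul_cancel₀ _ (by linarith)
  have hθ1 : θ < 1 := by
    rw [hθ, div_lt_one (by linarith)]; linarith
  have hκ : 2 * s < (1 + s) * (1 - θ) := by nlinarith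
  set κ : ℝ := (1 + s) * (1 - θ) with hκd
  have hc := fracConst_pos (n := n) hs0 hs1
  have ht1 := truncConst_nonneg n (2 * s) κ
  have ht2 := truncConst_nonneg n (2 * σ) κ
  let C : ℝ := fracConst n s / 2 * truncConst n (2 * s) κ + Lam * truncConst n (2 * σ) κ
  refine ⟨fun d => C * ((4 * d) ^ θ * (8 * D) ^ (1 - θ)) +
    (2 * D + 2) * d ^ (s / (1 + s)) * ‖b‖ + |r| * d, ?_, ?_⟩
  · have hcont : Continuous (fun d : ℝ => C * ((4 * d) ^ θ * (8 * D) ^ (1 - θ)) +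
        (2 * D + 2) * d ^ (s / (1 + s)) * ‖b‖ + |r| * d) := by
      have e1 : Continuous (fun d : ℝ => (4 * d) ^ θ) :=
        (continuous_const.mul continuous_id).rpow_const fun _ => Or.inr hθ0.le
      have e2 : Continuous (fun d : ℝ => d ^ (s / (1 + s))) :=
        continuous_id.rpow_const fun _ => Or.inr (by positivity)
      fun_prop
    have := hcont.tendsto 0
    simp only [mul_zero, Real.zero_rpow hθ0.ne', zero_mul,
      Real.zero_rpow (show s / (1 + s) ≠ 0 by positivity), add_zero] at this
    exact this
  · intro f f' p p' J d x hf hf' hJ hd0 hd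
    have hD := hf.nonneg
    rcases hd0.eq_or_lt with rfl | hd0
    · have hff : f = f' := funext fun x => by
        have := abs_nonpos_iff.1 (hd x)
        linarith
      have hC : 0 ≤ C := by positivity
      rw [hff, sub_self, sub_self, abs_zero]
      constructor <;> positivity
    have hB := hf.secondDiff_sub_le hf' hs0 hθ0.le hθ1 hd x
    have hX : 0 ≤ (4 * d) ^ θ * (8 * D) ^ (1 - θ) := by positivity
    have hY : 0 ≤ (2 * D + 2) * d ^ (s / (1 + s)) * ‖b‖ := by positivity
    have hZ : 0 ≤ |r| * d := by positivity
    have hP : 0 ≤ fracConst n s / 2 * truncConst n (2 * s) κ * ((4 * d) ^ θ * (8 * D) ^ (1 - θ)) :=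
      mul_nonneg (by positivity) hX
    have hQ : 0 ≤ Lam * truncConst n (2 * σ) κ * ((4 * d) ^ θ * (8 * D) ^ (1 - θ)) :=
      mul_nonneg (by positivity) hX
    constructor
    · rw [← fracLap_sub (hf.fracLapConverges hn hs0 hs1 x) (hf'.fracLapConverges hn hs0 hs1 x)]
      have := NonlocalObstacle.abs_fracLap_le hn hs0 hs1 hκ (f := f - f') (x := x) (fun y => by
        rw [secondDiff_sub]; exact hB y)
      refine this.trans ?_
      simp only [C, add_mul]
      linarith
    · have a1 := hJ.abs_sub_le hn hσ (κ := κ) (by linarith) h0 h1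
        (hf.inDomain hs0 hσ hσs hs1 x) (hf'.inDomain hs0 hσ hσs hs1 x) hB
      have a2 : |p x b - p' x b| ≤ (2 * D + 2) * d ^ (s / (1 + s)) * ‖b‖ := by
        rw [← sub_apply]
        exact ((p x - p' x).le_opNorm b).trans
          (mul_le_mul_of_nonneg_right (hf.grad_sub_le hf' hs0 hd0 hd x) (norm_nonneg b))
      have a3 : |r * f x - r * f' x| ≤ |r| * d := by
        rw [← mul_sub, abs_mul]
        exact mul_le_mul_of_nonneg_left (hd x) (abs_nonneg r)
      unfold lowerOp
      rw [hf.fderiv_eq hs0, hf'.fderiv_eq hs0]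
      simp only [C, add_mul]
      rw [abs_le] at a1 a2 a3 ⊢
      constructor <;> linarith

/-- Pointwise limits of functions bounded in `C^{1,s}`. -/
lemma exists_holderC1_of_tendsto {F : ℕ → E n → ℝ} {P : ℕ → E n → E n →L[ℝ] ℝ}
    (hF : ∀ k, HolderC1 s D (F k) (P k))
    (hlim : ∀ x, Filter.Tendsto (fun k => F k x) Filter.atTop (𝓝 (f x))) :
    ∃ p, HolderC1 s D f p := by
  have : ProperSpace (E n →L[ℝ] ℝ) := FiniteDimensional.proper ℝ _
  have hx : ∀ x, ∃ q : E n →L[ℝ] ℝ, ‖q‖ ≤ D ∧ ∀ v, |f (x + v) - f x - q v| ≤ D * ‖v‖ ^ (1 + s) := by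
    intro x
    -- The gradients stay in a compact ball. The subsequence may depend on x, which is harmless
    -- because the values converge along the whole sequence.
    obtain ⟨q, hq, φ, hφ, hφt⟩ := (isCompact_closedBall (0 : E n →L[ℝ] ℝ) D).tendsto_subseq
      (x := fun k => P k x) fun k => by simpa using (hF k).bound_grad x
    refine ⟨q, by simpa using hq, fun v => ?_⟩
    have h1 : Filter.Tendsto (fun k => P (φ k) x v) Filter.atTop (𝓝 (q v)) :=
      ((ContinuousLinearMap.apply ℝ ℝ v).continuous.tendsto q).comp hφt
    have h2 := (((hlim (x + v)).comp hφ.tendsto_atTop).sub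
      ((hlim x).comp hφ.tendsto_atTop)).sub h1
    exact le_of_tendsto h2.abs (Filter.Eventually.of_forall fun k => (hF (φ k)).expand x v)
  choose q hq hqe using hx
  exact ⟨q, fun x => le_of_tendsto (hlim x).abs
    (Filter.Eventually.of_forall fun k => (hF k).bound x), hq, hqe⟩

end HolderC1

/-! ### From almost every time to every time -/

/-- A set of full measure meets every interval (a,t]. Approaching from the left stays inside (0,T]
and covers the final time. -/
lemma exists_seq_of_ae_Ioc {T : ℝ} {P : ℝ → Prop}
    (hP : ∀ᵐ t ∂(volume.restrict (Ioc 0 T)), P t) {t : ℝ} (ht : t ∈ Ioc 0 T) :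
    ∃ τ : ℕ → ℝ, (∀ k, τ k ∈ Ioc 0 T) ∧ (∀ k, P (τ k)) ∧
      Filter.Tendsto τ Filter.atTop (𝓝 t) := by
  have h : ∀ k : ℕ, ∃ τ, τ ∈ Ioc 0 T ∧ P τ ∧ |τ - t| ≤ 1 / ((k : ℝ) + 1) := by
    intro k
    have hk : (0 : ℝ) < 1 / ((k : ℝ) + 1) := by positivity
    set a : ℝ := max 0 (t - 1 / ((k : ℝ) + 1)) with ha
    have hat : a < t := max_lt ht.1 (by linarith)
    have hsub : Ioc a t ⊆ Ioc 0 T := fun τ hτ =>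
      ⟨(le_max_left _ _).trans_lt hτ.1, hτ.2.trans ht.2⟩
    have h1 := ae_restrict_of_ae_restrict_of_subset hsub hP
    have h2 : (ae (volume.restrict (Ioc a t))).NeBot := by
      rw [ae_neBot, Ne, Measure.restrict_eq_zero, Real.volume_Ioc]
      simpa using hat
    obtain ⟨τ, hτ, hτ2⟩ := (h1.and (ae_restrict_mem measurableSet_Ioc)).exists
    refine ⟨τ, hsub hτ2, hτ, ?_⟩
    have h3 : t - 1 / ((k : ℝ) + 1) < τ := (le_max_right _ _).trans_lt hτ2.1
    rw [abs_le]
    constructor <;> linarith [hτ2.2]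
  choose τ h1 h2 h3 using h
  refine ⟨τ, h1, h2, ?_⟩
  rw [tendsto_iff_dist_tendsto_zero]
  exact squeeze_zero (fun _ => dist_nonneg) (fun k => h3 k) tendsto_one_div_add_atTop_nhds_zero_nat

section Evolution

variable {n : ℕ} {s σ lam Lam T r α M D : ℝ} {b : E n} {u ut : ℝ → E n → ℝ}

/-- The derivative is controlled only for positive times; the initial time is reached by continuity.
-/
lemma time_lipschitz (hT : 0 < T)
    (hcont : ContinuousOn (fun q : ℝ × E n => u q.1 q.2) (Icc 0 T ×ˢ univ))
    (hd : ∀ t ∈ Ioc 0 T, ∀ x, HasDerivWithinAt (fun τ => u τ x) (ut t x) (Ioc 0 T) t)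
    (hM : ∀ t ∈ Ioc 0 T, ∀ x, |ut t x| ≤ M) :
    ∀ t ∈ Icc 0 T, ∀ τ ∈ Icc 0 T, ∀ x, |u t x - u τ x| ≤ M * |t - τ| := by
  have h1 : ∀ t ∈ Ioc 0 T, ∀ τ ∈ Ioc 0 T, ∀ x, |u t x - u τ x| ≤ M * |t - τ| :=
    fun t ht τ hτ x => (convex_Ioc 0 T).norm_image_sub_le_of_norm_hasDerivWithin_le
      (fun t ht => hd t ht x) (fun t ht => hM t ht x) hτ ht
  have h0 : ∀ t ∈ Ioc 0 T, ∀ x, |u t x - u 0 x| ≤ M * |t - 0| := by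
    intro t ht x
    have hne : (𝓝[Ioc 0 T] (0 : ℝ)).NeBot := by
      rw [← mem_closure_iff_nhdsWithin_neBot, closure_Ioc hT.ne]
      exact ⟨le_rfl, hT.le⟩
    have hc : Filter.Tendsto (fun τ => u τ x) (𝓝[Ioc 0 T] 0) (𝓝 (u 0 x)) := by
      have h2 : ContinuousOn (fun τ : ℝ => u τ x) (Icc 0 T) :=
        hcont.comp (f := fun τ : ℝ => (τ, x)) (by fun_prop) fun τ hτ => ⟨hτ, mem_univ _⟩
      exact ((h2 0 ⟨le_rfl, hT.le⟩).mono Ioc_subset_Icc_self).tendsto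
    have hl : Filter.Tendsto (fun τ : ℝ => M * |t - τ|) (𝓝[Ioc 0 T] 0) (𝓝 (M * |t - 0|)) := by
      have : Continuous fun τ : ℝ => M * |t - τ| := by fun_prop
      exact (this.tendsto 0).mono_left nhdsWithin_le_nhds
    refine le_of_tendsto_of_tendsto (hc.const_sub (u t x)).abs hl ?_
    filter_upwards [self_mem_nhdsWithin] with τ hτ using h1 t ht τ hτ x
  intro t ht τ hτ x
  rcases ht.1.eq_or_lt with rfl | ht0
  · rcases hτ.1.eq_or_lt with rfl | hτ0
    · simp
    · rw [abs_sub_comm, abs_sub_comm 0 τ]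
      exact h0 τ ⟨hτ0, hτ.2⟩ x
  · rcases hτ.1.eq_or_lt with rfl | hτ0
    · exact h0 t ⟨ht0, ht.2⟩ x
    · exact h1 t ⟨ht0, ht.2⟩ τ ⟨hτ0, hτ.2⟩ x

/-- `u` is Lipschitz in time with Hölder continuous derivative `ut`, bounded in `C^{1,s}` in space,
with `(-Δ)^s u` bounded in `C^{1-s}` in space. -/
structure RegularEvolution (s α T M D : ℝ) (u ut : ℝ → E n → ℝ) : Prop where
  reg : ∀ t ∈ Ioc 0 T, HolderC1 s D (u t) (fderiv ℝ (u t))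
  cont : ContinuousOn (fun q : ℝ × E n => u q.1 q.2) (Icc 0 T ×ˢ univ)
  lip : ∀ t ∈ Icc 0 T, ∀ τ ∈ Icc 0 T, ∀ x, |u t x - u τ x| ≤ M * |t - τ|
  hasDeriv : ∀ t ∈ Ioc 0 T, ∀ x, HasDerivWithinAt (fun τ => u τ x) (ut t x) (Ioc 0 T) t
  holder : HolderTX T α (1 - s) M ut
  lap : ∀ t ∈ Ioc 0 T, HolderX (1 - s) D (fracLap s (u t))

lemma HolderC1.mono {D' : ℝ} {f : E n → ℝ} {p : E n → E n →L[ℝ] ℝ} (h : HolderC1 s D f p)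
    (hD : D ≤ D') : HolderC1 s D' f p where
  bound x := (h.bound x).trans hD
  bound_grad x := (h.bound_grad x).trans hD
  expand x v := (h.expand x v).trans (mul_le_mul_of_nonneg_right hD (by positivity))

lemma RegularEvolution.nonneg (hT : 0 < T) (h : RegularEvolution s α T M D u ut) : 0 ≤ M :=
  (abs_nonneg _).trans (h.holder.bound T ⟨hT, le_rfl⟩ 0)

/-- The operator `∂ₜu + (-Δ)^s u - R u`, evaluated classically. -/
def evolOp (s : ℝ) (b : E n) (r : ℝ) (J : (E n → ℝ) → E n → ℝ) (u ut : ℝ → E n → ℝ) (t : ℝ)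
    (x : E n) : ℝ :=
  ut t x + fracLap s (u t) x - lowerOp b r J (u t) x

/-- Full regularity of bounded evolutions whose fractional Laplacian, in the sense of
distributions, is Hölder continuous in space. -/
theorem exists_regularEvolution (hn : 1 ≤ n) (hs : 1 / 2 < s) (hs1 : s < 1)
    (hT : 0 < T) (M : ℝ) :
    ∃ D : ℝ, ∀ (u ut g : ℝ → E n → ℝ),
      ContinuousOn (fun q : ℝ × E n => u q.1 q.2) (Icc 0 T ×ˢ univ) →
      (∀ x, |u 0 x| ≤ M) →
      (∀ t ∈ Ioc 0 T, ∀ x, HasDerivWithinAt (fun τ => u τ x) (ut t x) (Ioc 0 T) t) →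
      HolderTX T α (1 - s) M ut →
      (∀ᵐ t ∂(volume.restrict (Ioc 0 T)),
        IsDistribFracLap s (u t) (g t) ∧ HolderX (1 - s) M (g t)) →
      RegularEvolution s α T M D u ut ∧
        ∀ᵐ t ∂(volume.restrict (Ioc 0 T)), ∀ x, fracLap s (u t) x = g t x := by
  have hs0 : 0 < s := by linarith
  -- M + MT bounds |u|: the initial datum plus the growth allowed by |∂ₜu| ≤ M.
  obtain ⟨D₀, hD₀⟩ := exists_holderC1_of_isDistribFracLap hn hs0 hs1 (M + M * T) M
  set D : ℝ := max D₀ (max M (fracConst n s / 2 * truncConst n (2 * s) (1 + s) * (4 * D₀))) with hD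
  refine ⟨D, fun u ut g hcont h0 hd hut hg => ?_⟩
  have hM0 : 0 ≤ M := (abs_nonneg _).trans (h0 0)
  have hlip := time_lipschitz hT hcont hd hut.bound
  have hbd : ∀ t ∈ Ioc 0 T, ∀ x, |u t x| ≤ M + M * T := fun t ht x => by
    have h1 := hlip t ⟨ht.1.le, ht.2⟩ 0 ⟨le_rfl, hT.le⟩ x
    rw [sub_zero, abs_of_pos ht.1] at h1
    have h2 := h0 x
    have h3 := mul_le_mul_of_nonneg_left ht.2 hM0
    rw [abs_le] at h1 h2 ⊢
    constructor <;> linarith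
  have huc : ∀ t ∈ Ioc 0 T, Continuous (u t) := fun t ht => by
    have h2 : ContinuousOn (fun x : E n => u t x) univ :=
      hcont.comp (f := fun x : E n => (t, x)) (by fun_prop) fun x _ =>
        ⟨⟨ht.1.le, ht.2⟩, mem_univ _⟩
    exact continuousOn_univ.1 h2
  have hgood : ∀ᵐ t ∂(volume.restrict (Ioc 0 T)), (∃ p, HolderC1 s D₀ (u t) p) ∧
      (∀ x, fracLap s (u t) x = g t x) ∧ HolderX (1 - s) M (g t) := by
    filter_upwards [hg, ae_restrict_mem measurableSet_Ioc] with t ht htm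
    obtain ⟨p, hp⟩ := hD₀ (u t) (g t) (huc t htm) (hbd t htm) ht.2 ht.1
    exact ⟨⟨p, hp⟩, fun x => hp.fracLap_eq_of_isDistribFracLap hn hs0 hs1
      (ht.2.continuous (by linarith)) ht.1 x, ht.2⟩
  have hlimu : ∀ {t : ℝ}, t ∈ Ioc 0 T → ∀ τ : ℕ → ℝ, (∀ k, τ k ∈ Ioc 0 T) →
      Filter.Tendsto τ Filter.atTop (𝓝 t) →
      ∀ x, Filter.Tendsto (fun k => u (τ k) x) Filter.atTop (𝓝 (u t x)) := by
    intro t ht τ hτ hτt x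
    rw [tendsto_iff_dist_tendsto_zero]
    have h1 : Filter.Tendsto (fun k => M * |τ k - t|) Filter.atTop (𝓝 0) := by
      have := ((hτt.sub_const t).abs).const_mul M
      simpa using this
    exact squeeze_zero (fun _ => dist_nonneg)
      (fun k => hlip _ ⟨(hτ k).1.le, (hτ k).2⟩ t ⟨ht.1.le, ht.2⟩ x) h1
  have hreg₀ : ∀ t ∈ Ioc 0 T, ∃ p, HolderC1 s D₀ (u t) p := by
    intro t ht
    obtain ⟨τ, hτ, hP, hτt⟩ := exists_seq_of_ae_Ioc hgood ht
    choose p hp using fun k => (hP k).1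
    exact exists_holderC1_of_tendsto hp (hlimu ht τ hτ hτt)
  have hreg₁ : ∀ t ∈ Ioc 0 T, HolderC1 s D₀ (u t) (fderiv ℝ (u t)) := fun t ht => by
    obtain ⟨p, hp⟩ := hreg₀ t ht
    have : fderiv ℝ (u t) = p := funext fun x => hp.fderiv_eq hs0 x
    rwa [this]
  -- The Hölder bound holds at good times and passes to every t by dominated convergence of the
  -- singular integrals, whose majorant is uniform in t.
  have hlap : ∀ t ∈ Ioc 0 T, ∀ x y, |fracLap s (u t) x - fracLap s (u t) y| ≤
      M * ‖x - y‖ ^ (1 - s) := by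
    intro t ht x y
    obtain ⟨τ, hτ, hP, hτt⟩ := exists_seq_of_ae_Ioc hgood ht
    have hLt : ∀ z, Filter.Tendsto (fun k => fracLap s (u (τ k)) z) Filter.atTop
        (𝓝 (fracLap s (u t) z)) := by
      intro z
      unfold fracLap
      refine Filter.Tendsto.const_mul _ (tendsto_integral_of_dominated_convergence
        (fun y => 4 * D₀ * (min (‖y‖ ^ (1 + s)) 1 / ‖y‖ ^ ((n : ℝ) + 2 * s)))
        (fun k => ((hreg₁ _ (hτ k)).fracLapConverges hn hs0 hs1 z).1)
        ((integrable_truncKernel hn (by linarith) (by linarith)).const_mul _)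
        (fun k => Filter.Eventually.of_forall fun y =>
          abs_div_kernel_le ((hreg₁ _ (hτ k)).secondDiff_le hs0 z y))
        (Filter.Eventually.of_forall fun y => ?_))
      have hl := hlimu ht τ hτ hτt
      exact (((hl _).add (hl _)).sub ((hl _).const_mul 2)).div_const _
    refine le_of_tendsto ((hLt x).sub (hLt y)).abs (Filter.Eventually.of_forall fun k => ?_)
    rw [(hP k).2.1, (hP k).2.1]
    exact (hP k).2.2.holder x y
  refine ⟨⟨fun t ht => (hreg₁ t ht).mono (le_max_left _ _), hcont, hlip, hd, hut,
    fun t ht => ⟨fun x => ?_, fun x y => ?_⟩⟩, hgood.mono fun t ht => ht.2.1⟩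
  · exact ((hreg₁ t ht).abs_fracLap_le hn hs0 hs1 x).trans
      ((le_max_right _ _).trans (le_max_right _ _))
  · exact (hlap t ht x y).trans (mul_le_mul_of_nonneg_right
      ((le_max_left _ _).trans (le_max_right _ _)) (by positivity))

lemma exists_holderX_evolOp (hn : 1 ≤ n) (hs : 1 / 2 < s)
    (hs1 : s < 1) (hσ : 0 < σ) (hσs : σ < s) (h0 : 0 < lam) (h1 : lam ≤ Lam) (b : E n)
    (r α T M D : ℝ) :
    ∃ C, ∀ (u ut : ℝ → E n → ℝ) (J : (E n → ℝ) → E n → ℝ), RegularEvolution s α T M D u ut →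
      0 < α → IsNonlocalOp σ lam Lam J → ∀ t ∈ Ioc 0 T, HolderX (1 - s) C (evolOp s b r J u ut t) := by
  obtain ⟨C, hC⟩ := exists_holderX_lowerOp hn hs hs1 hσ hσs h0 h1 b r D
  refine ⟨M + D + C, fun u ut J hu hα hJ t ht => ?_⟩
  have hR := hC (u t) _ J (hu.reg t ht) hJ
  have hL := hu.lap t ht
  refine ⟨fun x => ?_, fun x y => ?_⟩
  · have a1 := hR.bound x
    have a2 := hL.bound x
    have a3 := hu.holder.bound t ht x
    unfold evolOp
    rw [abs_le] at a1 a2 a3 ⊢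
    constructor <;> linarith
  · have a1 := hR.holder x y
    have a2 := hL.holder x y
    have a3 := hu.holder.holder t ht t ht x y
    rw [sub_self, abs_zero, Real.zero_rpow hα.ne', zero_add] at a3
    unfold evolOp
    rw [abs_le] at a1 a2 a3 ⊢
    constructor <;> linarith

/-- In x the operator is Hölder uniformly in t. In t its elliptic terms follow the modulus of
`exists_elliptic_modulus` at the uniform distance M|t - t₀|. -/
lemma RegularEvolution.continuousOn_evolOp (hn : 1 ≤ n) (hs : 1 / 2 < s)
    (hs1 : s < 1) (hσ : 0 < σ) (hσs : σ < s) (h0 : 0 < lam) (h1 : lam ≤ Lam) (hT : 0 < T)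
    (hα : 0 < α) (h : RegularEvolution s α T M D u ut) {J : (E n → ℝ) → E n → ℝ}
    (hJ : IsNonlocalOp σ lam Lam J) :
    ContinuousOn (fun q : ℝ × E n => evolOp s b r J u ut q.1 q.2) (Ioc 0 T ×ˢ univ) := by
  obtain ⟨C, hC⟩ := exists_holderX_evolOp hn hs hs1 hσ hσs h0 h1 b r α T M D
  have hC := hC u ut J h hα hJ
  obtain ⟨Ψ, hΨ, hmod⟩ := exists_elliptic_modulus hn hs hs1 hσ hσs h0 h1 b r D
  have hM := h.nonneg hT
  rintro ⟨t₀, x₀⟩ ⟨ht₀, -⟩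
  rw [ContinuousWithinAt, tendsto_iff_dist_tendsto_zero]
  have hlim : Filter.Tendsto (fun q : ℝ × E n => C * ‖q.2 - x₀‖ ^ (1 - s) +
      (M * |q.1 - t₀| ^ α + 2 * Ψ (M * |q.1 - t₀|))) (𝓝[Ioc 0 T ×ˢ univ] (t₀, x₀)) (𝓝 0) := by
    have e1 : Filter.Tendsto (fun q : ℝ × E n => C * ‖q.2 - x₀‖ ^ (1 - s)) (𝓝 (t₀, x₀)) (𝓝 0) := by
      have hc : Continuous (fun q : ℝ × E n => C * ‖q.2 - x₀‖ ^ (1 - s)) :=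
        continuous_const.mul ((continuous_snd.sub continuous_const).norm.rpow_const
          fun _ => Or.inr (by linarith))
      simpa [Real.zero_rpow (show 1 - s ≠ 0 by linarith)] using hc.tendsto (t₀, x₀)
    have e2 : Filter.Tendsto (fun q : ℝ × E n => M * |q.1 - t₀| ^ α) (𝓝 (t₀, x₀)) (𝓝 0) := by
      have hc : Continuous (fun q : ℝ × E n => M * |q.1 - t₀| ^ α) :=
        continuous_const.mul ((continuous_fst.sub continuous_const).abs.rpow_const
          fun _ => Or.inr hα.le)
      simpa [Real.zero_rpow hα.ne'] using hc.tendsto (t₀, x₀)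
    have e3 : Filter.Tendsto (fun q : ℝ × E n => M * |q.1 - t₀|) (𝓝 (t₀, x₀)) (𝓝 0) := by
      have hc : Continuous (fun q : ℝ × E n => M * |q.1 - t₀|) := by fun_prop
      simpa using hc.tendsto (t₀, x₀)
    have e4 := (hΨ.comp e3).const_mul 2
    have := e1.add (e2.add e4)
    simp only [mul_zero, add_zero] at this
    exact this.mono_left nhdsWithin_le_nhds
  refine squeeze_zero' (Filter.Eventually.of_forall fun _ => dist_nonneg) ?_ hlim
  filter_upwards [self_mem_nhdsWithin] with q hq
  have hq1 : q.1 ∈ Ioc 0 T := hq.1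
  have hx := (hC q.1 hq1).holder q.2 x₀
  obtain ⟨m1, m2⟩ := hmod (u q.1) (u t₀) _ _ J (M * |q.1 - t₀|) x₀ (h.reg _ hq1) (h.reg _ ht₀) hJ
    (by positivity) (h.lip _ ⟨hq1.1.le, hq1.2⟩ _ ⟨ht₀.1.le, ht₀.2⟩)
  have m3 := h.holder.holder q.1 hq1 t₀ ht₀ x₀ x₀
  rw [sub_self, norm_zero, Real.zero_rpow (by linarith), add_zero] at m3
  rw [Real.dist_eq]
  simp only [evolOp] at hx ⊢
  rw [abs_le] at hx m1 m2 m3 ⊢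
  constructor <;> linarith

end Evolution

/-! ### Gluing test functions into a C^{1,s} function -/

section Glue

variable {n : ℕ} {s D : ℝ} {f : E n → ℝ} {p : E n → E n →L[ℝ] ℝ}

/-- Since `q` shares value and gradient with `f` at x₀, second differences change only by
O(|y|^{1+s}), and only for |y| < R. Half of the surplus of 1+s over 2s becomes R^{(1-s)/2}; the
other half keeps the integral convergent. -/
lemma HolderC1.glue_le (hn : 1 ≤ n) {σ lam Lam : ℝ} (h : HolderC1 s D f p) (hs : 1 / 2 < s)
    (hs1 : s < 1) (hσ : 0 < σ) (hσs : σ < s) (h0 : 0 < lam) (h1 : lam ≤ Lam)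
    {J : (E n → ℝ) → E n → ℝ} (hJ : IsNonlocalOp σ lam Lam J) {q v : E n → ℝ} {x₀ : E n} {C R : ℝ}
    (hqm : Measurable q) (hC : 0 ≤ C) (hq : ∀ y, |q (x₀ + y) - f x₀ - p x₀ y| ≤ C * ‖y‖ ^ 2)
    (hR : 0 < R) (hR1 : R ≤ 1) (hv : ∀ x, v x = if ‖x - x₀‖ < R then q x else f x) :
    |fracLap s v x₀ - fracLap s f x₀| ≤ fracConst n s / 2 *
        truncConst n (2 * s) ((1 + 3 * s) / 2) * (2 * (C + D) * R ^ ((1 - s) / 2)) ∧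
      |J v x₀ - J f x₀| ≤
        Lam * truncConst n (2 * σ) ((1 + 3 * s) / 2) * (2 * (C + D) * R ^ ((1 - s) / 2)) := by
  have hs0 : 0 < s := by linarith
  have hD := h.nonneg
  have hfm := (h.continuous hs0).measurable
  have hvm : Measurable v := by
    have hv' : v = fun x => if ‖x - x₀‖ < R then q x else f x := funext hv
    rw [hv']
    exact Measurable.ite (measurableSet_lt (measurable_id.sub_const _).norm measurable_const) hqm hfm
  have hsq : ∀ y : E n, ‖y‖ ≤ 1 → ‖y‖ ^ 2 ≤ ‖y‖ ^ (1 + s) := fun y hy => by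
    rcases eq_or_ne y 0 with rfl | hy0
    · simp [Real.zero_rpow (show 1 + s ≠ 0 by linarith)]
    · rw [← Real.rpow_two]
      exact Real.rpow_le_rpow_of_exponent_ge (norm_pos_iff.2 hy0) hy (by linarith)
  have hW : ∀ y, |v (x₀ + y) - f (x₀ + y)| ≤
      (C + D) * R ^ ((1 - s) / 2) * min (‖y‖ ^ ((1 + 3 * s) / 2)) 1 := by
    intro y
    rw [hv, add_sub_cancel_left]
    split_ifs with hy
    · have hy1 : ‖y‖ ≤ 1 := hy.le.trans hR1
      have e1 : |q (x₀ + y) - f (x₀ + y)| ≤ (C + D) * ‖y‖ ^ (1 + s) := by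
        have a1 := hq y
        have a2 := h.expand x₀ y
        have a3 := mul_le_mul_of_nonneg_left (hsq y hy1) hC
        rw [abs_le] at a1 a2 ⊢
        constructor <;> linarith
      rw [min_eq_left (Real.rpow_le_one (norm_nonneg y) hy1 (by linarith)), mul_assoc]
      refine e1.trans (mul_le_mul_of_nonneg_left ?_ (by positivity))
      rcases eq_or_ne y 0 with rfl | hy0
      · rw [norm_zero, Real.zero_rpow (by linarith)]; positivity
      · have hyp : 0 < ‖y‖ := norm_pos_iff.2 hy0
        calc ‖y‖ ^ (1 + s) = ‖y‖ ^ ((1 - s) / 2) * ‖y‖ ^ ((1 + 3 * s) / 2) := by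
              rw [← Real.rpow_add hyp]; congr 1; ring
          _ ≤ _ := mul_le_mul_of_nonneg_right
            (Real.rpow_le_rpow hyp.le hy.le (by linarith)) (by positivity)
    · rw [sub_self, abs_zero]; positivity
  have hv0 : v x₀ = f x₀ := by
    have a1 := hq 0
    simp only [add_zero, map_zero, sub_zero, norm_zero, ne_eq, OfNat.ofNat_ne_zero,
      not_false_eq_true, zero_pow, mul_zero] at a1
    rw [hv, sub_self, norm_zero, if_pos hR]
    exact sub_eq_zero.1 (abs_nonpos_iff.1 a1)
  have hδ : ∀ y, |secondDiff v x₀ y - secondDiff f x₀ y| ≤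
      2 * (C + D) * R ^ ((1 - s) / 2) * min (‖y‖ ^ ((1 + 3 * s) / 2)) 1 := fun y => by
    have a1 := hW y
    have a2 := hW (-y)
    rw [norm_neg, ← sub_eq_add_neg] at a2
    unfold secondDiff
    rw [hv0]
    rw [abs_le] at a1 a2 ⊢
    constructor <;> linarith
  have hmin : ∀ y : E n, min (‖y‖ ^ (1 + s)) 1 ≤ min (‖y‖ ^ ((1 + 3 * s) / 2)) 1 := fun y => by
    rcases le_total ‖y‖ 1 with hy | hy
    · refine min_le_min_right 1 ?_
      rcases eq_or_ne y 0 with rfl | hy0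
      · rw [norm_zero, Real.zero_rpow (by linarith), Real.zero_rpow (by linarith)]
      · exact Real.rpow_le_rpow_of_exponent_ge (norm_pos_iff.2 hy0) hy (by linarith)
    · rw [min_eq_right (Real.one_le_rpow hy (by linarith)),
        min_eq_right (Real.one_le_rpow hy (by linarith))]
  have hconv : FracLapConverges s v x₀ := by
    refine integrable_div_kernel hn (κ := (1 + 3 * s) / 2) (by linarith) (by linarith)
      (measurable_secondDiff hvm x₀) (B := 2 * (C + D) * R ^ ((1 - s) / 2) + 4 * D) fun y => ?_
    have a1 := hδ y
    have a2 := (h.secondDiff_le hs0 x₀ y).trans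
      (mul_le_mul_of_nonneg_left (hmin y) (by positivity))
    rw [abs_le] at a1 a2 ⊢
    constructor <;> linarith
  have hdom : InDomain σ v x₀ := by
    refine ⟨punctuallyRegular_of_expand (κ := 1 + s) (P := p x₀) (C := C) (by linarith)
      (by linarith) ?_, integrable_weight hσ hvm (B := D + (C + D) * R ^ ((1 - s) / 2)) fun x => ?_⟩
    · filter_upwards [Metric.ball_mem_nhds (0 : E n) hR] with y hy
      rw [mem_ball_zero_iff] at hy
      rw [hv0, hv, add_sub_cancel_left, if_pos hy]
      exact (hq y).trans (mul_le_mul_of_nonneg_left (hsq y (hy.le.trans hR1)) hC)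
    · have a1 := hW (x - x₀)
      rw [add_sub_cancel] at a1
      have a2 := h.bound x
      have a3 := a1.trans (mul_le_of_le_one_right (by positivity) (min_le_right _ _))
      rw [abs_le] at a2 a3 ⊢
      constructor <;> linarith
  constructor
  · rw [← fracLap_sub hconv (h.fracLapConverges hn hs0 hs1 x₀)]
    refine NonlocalObstacle.abs_fracLap_le hn hs0 hs1 (by linarith) fun y => ?_
    rw [secondDiff_sub]
    exact hδ y
  · exact hJ.abs_sub_le hn hσ (by linarith) h0 h1 hdom (h.inDomain hs0 hσ hσs hs1 x₀) hδ

lemma isC12_of_add {A : ℝ → ℝ} {B : E n → ℝ} (hA : ContDiff ℝ 2 A) (hB : ContDiff ℝ 2 B)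
    (t₀ : ℝ) (x₀ : E n) (R : ℝ) : IsC12 (fun t x => A t + B x) t₀ x₀ R := by
  have hB1 : ContDiff ℝ 1 (fderiv ℝ B) := hB.fderiv_right (m := 1) (by norm_num)
  have c1 : Continuous (deriv A) := hA.continuous_deriv (by norm_num)
  have c2 : Continuous (fderiv ℝ (fderiv ℝ B)) := hB1.continuous_fderiv (by norm_num)
  refine ⟨fun q => deriv A q.1, fun q => fderiv ℝ B q.2, fun q => fderiv ℝ (fderiv ℝ B) q.2,
    ?_, (c1.comp continuous_fst).continuousOn, (hB1.continuous.comp continuous_snd).continuousOn,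
    (c2.comp continuous_snd).continuousOn, fun q _ => ⟨?_, ?_, ?_⟩⟩
  · exact ((hA.continuous.comp continuous_fst).add (hB.continuous.comp continuous_snd)).continuousOn
  · exact ((hA.differentiable (by norm_num)).differentiableAt.hasDerivAt).add_const _
  · exact ((hB.differentiable (by norm_num)).differentiableAt.hasFDerivAt).const_add _
  · exact (hB1.differentiable (by norm_num)).differentiableAt.hasFDerivAt

end Glue

/-! ### Touching paraboloids and classical inequalities -/

/-- A paraboloid in space-time. -/
def parabTime (k t₁ t₀ : ℝ) (k' c : ℝ) (t : ℝ) : ℝ := c + (k * (t - t₁) ^ 2 + k' * (t - t₀) ^ 2)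

/-- The spatial part of a paraboloid. -/
def parabSpace {n : ℕ} (k : ℝ) (x₁ x₀ : E n) (k' : ℝ) (x : E n) : ℝ :=
  k * ‖x - x₁‖ ^ 2 + k' * ‖x - x₀‖ ^ 2

lemma contDiff_parabTime (k t₁ t₀ k' c : ℝ) : ContDiff ℝ 2 (parabTime k t₁ t₀ k' c) := by
  unfold parabTime; fun_prop

lemma contDiff_parabSpace {n : ℕ} (k : ℝ) (x₁ x₀ : E n) (k' : ℝ) :
    ContDiff ℝ 2 (parabSpace k x₁ x₀ k') := by
  unfold parabSpace
  have h : ∀ z : E n, ContDiff ℝ 2 fun x : E n => ‖x - z‖ ^ 2 := fun z =>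
    (contDiff_norm_sq ℝ).comp (contDiff_id.sub contDiff_const)
  exact (contDiff_const.mul (h x₁)).add (contDiff_const.mul (h x₀))

lemma parabSpace_expand {n : ℕ} (k : ℝ) (x₁ x₀ : E n) (k' : ℝ) (y : E n) :
    parabSpace k x₁ x₀ k' (x₀ + y) - parabSpace k x₁ x₀ k' x₀ -
      fderiv ℝ (parabSpace k x₁ x₀ k') x₀ y = (k + k') * ‖y‖ ^ 2 := by
  have h1 : ∀ z : E n, HasFDerivAt (fun x : E n => ‖x - z‖ ^ 2)
      (2 • (innerSL ℝ (x₀ - z)).comp (ContinuousLinearMap.id ℝ (E n))) x₀ := fun z =>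
    ((hasFDerivAt_id x₀).sub_const z).norm_sq
  have h2 : HasFDerivAt (parabSpace k x₁ x₀ k') _ x₀ := ((h1 x₁).const_mul k).add ((h1 x₀).const_mul k')
  have e : x₀ + y - x₁ = (x₀ - x₁) + y := by abel
  rw [h2.fderiv]
  simp only [parabSpace, e, norm_add_sq_real]
  simp [inner_sub_left]
  ring

section Touch

variable {n : ℕ} {s σ lam Lam T r α M D : ℝ} {b : E n} {u ut : ℝ → E n → ℝ}

/-- The parabolic operator of the glued function converges to that of `u` as the radius of the
ball tends to zero. -/
lemma RegularEvolution.glue_tendsto (hn : 1 ≤ n) (hs : 1 / 2 < s)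
    (hs1 : s < 1) (hσ : 0 < σ) (hσs : σ < s) (h0 : 0 < lam) (h1 : lam ≤ Lam)
    (h : RegularEvolution s α T M D u ut) {J : (E n → ℝ) → E n → ℝ}
    (hJ : IsNonlocalOp σ lam Lam J) {t₀ : ℝ} (ht₀ : t₀ ∈ Ioo 0 T) {x₀ x₁ : E n} {k k' t₁ c : ℝ}
    (hval : parabTime k t₁ t₀ k' c t₀ + parabSpace k x₁ x₀ k' x₀ = u t₀ x₀)
    (htime : deriv (parabTime k t₁ t₀ k' c) t₀ = ut t₀ x₀)
    (hspace : fderiv ℝ (parabSpace k x₁ x₀ k') x₀ = fderiv ℝ (u t₀) x₀) :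
    Filter.Tendsto (fun R => parabolicOp s b r J (glue
      (fun t x => parabTime k t₁ t₀ k' c t + parabSpace k x₁ x₀ k' x) u t₀ x₀ R) t₀ x₀)
      (𝓝[>] 0) (𝓝 (evolOp s b r J u ut t₀ x₀)) := by
  have ht₀' : t₀ ∈ Ioc 0 T := ⟨ht₀.1, ht₀.2.le⟩
  have hu := h.reg t₀ ht₀'
  set φ : ℝ → E n → ℝ := fun t x => parabTime k t₁ t₀ k' c t + parabSpace k x₁ x₀ k' x with hφ
  set C1 : ℝ := fracConst n s / 2 * truncConst n (2 * s) ((1 + 3 * s) / 2) * (2 * (|k + k'| + D))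
  set C2 : ℝ := Lam * truncConst n (2 * σ) ((1 + 3 * s) / 2) * (2 * (|k + k'| + D))
  rw [tendsto_iff_dist_tendsto_zero]
  have hlim : Filter.Tendsto (fun R : ℝ => (C1 + C2) * R ^ ((1 - s) / 2)) (𝓝[>] 0) (𝓝 0) := by
    have hc : Continuous (fun R : ℝ => (C1 + C2) * R ^ ((1 - s) / 2)) :=
      continuous_const.mul (continuous_id.rpow_const fun _ => Or.inr (by linarith))
    have := hc.tendsto 0
    rw [Real.zero_rpow (by linarith), mul_zero] at this
    exact this.mono_left nhdsWithin_le_nhds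
  refine squeeze_zero' (Filter.Eventually.of_forall fun _ => dist_nonneg) ?_ hlim
  filter_upwards [Ioc_mem_nhdsGT (zero_lt_one' ℝ)] with R hR
  have hv : ∀ x, glue φ u t₀ x₀ R t₀ x = if ‖x - x₀‖ < R then φ t₀ x else u t₀ x := fun x => by
    unfold glue
    congr 1
    simp only [stBall, mem_ofPred_eq, sub_self, eq_iff_iff]
    rw [zero_pow two_ne_zero, zero_add, sq_lt_sq₀ (norm_nonneg _) hR.1.le]
  have hderiv : deriv (fun τ => glue φ u t₀ x₀ R τ x₀) t₀ = ut t₀ x₀ := by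
    have heq : (fun τ => glue φ u t₀ x₀ R τ x₀) =ᶠ[𝓝 t₀] fun τ => φ τ x₀ := by
      filter_upwards [Metric.ball_mem_nhds t₀ hR.1] with τ hτ
      unfold glue
      refine if_pos ?_
      rw [Metric.mem_ball, Real.dist_eq] at hτ
      simp only [stBall, mem_ofPred_eq, sub_self, norm_zero]
      rw [zero_pow two_ne_zero, add_zero, ← sq_abs]
      exact pow_lt_pow_left₀ hτ (abs_nonneg _) two_ne_zero
    rw [heq.deriv_eq, ← htime, hφ]
    exact deriv_add_const _
  have hfd : fderiv ℝ (glue φ u t₀ x₀ R t₀) x₀ = fderiv ℝ (u t₀) x₀ := by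
    have heq : glue φ u t₀ x₀ R t₀ =ᶠ[𝓝 x₀] φ t₀ := by
      filter_upwards [Metric.ball_mem_nhds x₀ hR.1] with x hx
      rw [hv]
      rw [Metric.mem_ball, dist_eq_norm] at hx
      exact if_pos hx
    rw [heq.fderiv_eq, ← hspace, hφ]
    exact fderiv_const_add _
  have hv0 : glue φ u t₀ x₀ R t₀ x₀ = u t₀ x₀ := by
    rw [hv, sub_self, norm_zero, if_pos hR.1]
    exact hval
  obtain ⟨g1, g2⟩ := hu.glue_le hn hs hs1 hσ hσs h0 h1 hJ (q := φ t₀) (x₀ := x₀) (C := |k + k'|)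
    (((contDiff_parabSpace k x₁ x₀ k').continuous.measurable).const_add _) (abs_nonneg _)
    (fun y => by
      have e := parabSpace_expand k x₁ x₀ k' y
      rw [← hspace, ← hval, ← abs_of_nonneg (sq_nonneg ‖y‖), ← abs_mul, ← e]
      refine le_of_eq (congrArg _ ?_)
      simp only [hφ]; ring) hR.1 hR.2 hv
  rw [Real.dist_eq]
  unfold parabolicOp evolOp lowerOp
  rw [hderiv, hfd, hv0]
  simp only [C1, C2]
  rw [← mul_assoc] at g1 g2
  rw [abs_le] at g1 g2 ⊢
  constructor <;> linarith

/-- A continuous function is touched strictly by a paraboloid of either sign near any point. -/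
lemma exists_touching_paraboloid {ε t₁ ρ B : ℝ} {x₁ : E n} (hε : ε = 1 ∨ ε = -1) (hρ : 0 < ρ)
    (hc : ContinuousOn (fun q : ℝ × E n => u q.1 q.2)
      (Icc (t₁ - ρ) (t₁ + ρ) ×ˢ Metric.closedBall x₁ ρ))
    (hB : ∀ t ∈ Icc (t₁ - ρ) (t₁ + ρ), ∀ x, |u t x| ≤ B) :
    ∃ t₀ x₀ k k' c, |t₀ - t₁| < ρ ∧ ‖x₀ - x₁‖ < ρ ∧
      parabTime k t₁ t₀ k' c t₀ + parabSpace k x₁ x₀ k' x₀ = u t₀ x₀ ∧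
      ∀ t x, |t - t₁| ≤ ρ → ‖x - x₁‖ ≤ ρ → (t, x) ≠ (t₀, x₀) →
        0 < ε * (u t x - (parabTime k t₁ t₀ k' c t + parabSpace k x₁ x₀ k' x)) := by
  have hε2 : ε * ε = 1 := by rcases hε with h | h <;> rw [h] <;> norm_num
  have hεa : ∀ a : ℝ, |ε * a| = |a| := fun a => by
    rcases hε with h | h <;> rw [h] <;> simp
  -- On the boundary of the cylinder the penalty is at least 2B + 1, more than the oscillation 2B of
  -- u, so the minimum is interior.
  set K : ℝ := (2 * B + 1) / ρ ^ 2 with hK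
  have hKρ : K * ρ ^ 2 = 2 * B + 1 := div_mul_cancel₀ _ (by positivity)
  have ht₁ : t₁ ∈ Icc (t₁ - ρ) (t₁ + ρ) := ⟨by linarith, by linarith⟩
  have hB0 : 0 ≤ B := (abs_nonneg _).trans (hB t₁ ht₁ 0)
  have hK0 : 0 < K := by positivity
  have hcomp : IsCompact (Icc (t₁ - ρ) (t₁ + ρ) ×ˢ Metric.closedBall x₁ ρ) :=
    isCompact_Icc.prod (isCompact_closedBall _ _)
  have hne : (Icc (t₁ - ρ) (t₁ + ρ) ×ˢ Metric.closedBall x₁ ρ).Nonempty :=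
    ⟨(t₁, x₁), ht₁, Metric.mem_closedBall_self hρ.le⟩
  have hcont : ContinuousOn (fun q : ℝ × E n =>
      ε * u q.1 q.2 + K * ((q.1 - t₁) ^ 2 + ‖q.2 - x₁‖ ^ 2))
      (Icc (t₁ - ρ) (t₁ + ρ) ×ˢ Metric.closedBall x₁ ρ) :=
    (continuousOn_const.mul hc).add (by fun_prop)
  obtain ⟨⟨t₀, x₀⟩, ⟨ht₀, hx₀⟩, hmin⟩ := hcomp.exists_isMinOn hne hcont
  have hm : ∀ t x, |t - t₁| ≤ ρ → ‖x - x₁‖ ≤ ρ →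
      ε * u t₀ x₀ + K * ((t₀ - t₁) ^ 2 + ‖x₀ - x₁‖ ^ 2) ≤
      ε * u t x + K * ((t - t₁) ^ 2 + ‖x - x₁‖ ^ 2) := fun t x ht hx => by
    refine hmin (a := (t, x)) ⟨?_, ?_⟩
    · rw [abs_le] at ht; exact ⟨by linarith, by linarith⟩
    · rwa [Metric.mem_closedBall, dist_eq_norm]
  have hcen := hm t₁ x₁ (by simpa using hρ.le) (by simpa using hρ.le)
  rw [sub_self, sub_self, norm_zero, zero_pow two_ne_zero, add_zero, mul_zero, add_zero] at hcen
  have hb0 := abs_le.1 ((hεa _).trans_le (hB t₀ ht₀ x₀))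
  have hb1 := abs_le.1 ((hεa _).trans_le (hB t₁ ht₁ x₁))
  have hlt : K * ((t₀ - t₁) ^ 2 + ‖x₀ - x₁‖ ^ 2) < K * ρ ^ 2 := by
    rw [hKρ]
    linarith [hb0.1, hb1.2]
  have hlt' := lt_of_mul_lt_mul_left hlt hK0.le
  -- The paraboloid centred at (t₁,x₁) places the contact point; the second one, centred at the
  -- contact point itself, makes the touching strict.
  refine ⟨t₀, x₀, -ε * K, -ε, u t₀ x₀ + ε * K * ((t₀ - t₁) ^ 2 + ‖x₀ - x₁‖ ^ 2), ?_, ?_, ?_, ?_⟩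
  · exact abs_lt_of_sq_lt_sq (by linarith [sq_nonneg ‖x₀ - x₁‖]) hρ.le
  · exact lt_of_pow_lt_pow_left₀ 2 hρ.le (by linarith [sq_nonneg (t₀ - t₁)])
  · simp only [parabTime, parabSpace, sub_self, norm_zero]
    ring
  · intro t x ht hx hne
    have h1 := hm t x ht hx
    have h2 : 0 < (t - t₀) ^ 2 + ‖x - x₀‖ ^ 2 := by
      by_cases htt : t = t₀
      · have hxx : x ≠ x₀ := fun hxx => hne (by rw [htt, hxx])
        have := norm_pos_iff.2 (sub_ne_zero.2 hxx)
        positivity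
      · have := sub_ne_zero.2 htt
        positivity
    have h3 : ε * (u t x - (parabTime (-ε * K) t₁ t₀ (-ε)
        (u t₀ x₀ + ε * K * ((t₀ - t₁) ^ 2 + ‖x₀ - x₁‖ ^ 2)) t + parabSpace (-ε * K) x₁ x₀ (-ε) x)) =
        ε * u t x - ε * u t₀ x₀ - (ε * ε) * (K * ((t₀ - t₁) ^ 2 + ‖x₀ - x₁‖ ^ 2)) +
          (ε * ε) * (K * ((t - t₁) ^ 2 + ‖x - x₁‖ ^ 2)) +
          (ε * ε) * ((t - t₀) ^ 2 + ‖x - x₀‖ ^ 2) := by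
      simp only [parabTime, parabSpace]; ring
    rw [h3, hε2]
    linarith

/-- Signed viscosity inequality: a supersolution for `ε = 1`, a subsolution for `ε = -1`. -/
def ViscosityAt (ε s : ℝ) (b : E n) (r : ℝ) (J : (E n → ℝ) → E n → ℝ) (T : ℝ)
    (u : ℝ → E n → ℝ) (t₀ : ℝ) (x₀ : E n) : Prop :=
  ∀ (R : ℝ) (φ : ℝ → E n → ℝ), 0 < R → IsC12 φ t₀ x₀ R → u t₀ x₀ = φ t₀ x₀ →
    (∀ t ∈ Ioc 0 T, ∀ x : E n, (t, x) ∈ stBall t₀ x₀ R → (t, x) ≠ (t₀, x₀) →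
      0 < ε * (u t x - φ t x)) →
      0 ≤ ε * parabolicOp s b r J (glue φ u t₀ x₀ R) t₀ x₀

lemma ViscositySuperAt.viscosityAt {J : (E n → ℝ) → E n → ℝ} {t₀ : ℝ} {x₀ : E n}
    (h : ViscositySuperAt s b r J T u t₀ x₀) : ViscosityAt 1 s b r J T u t₀ x₀ := by
  intro R φ hR hφ hval ht
  rw [one_mul]
  exact h R φ hR hφ hval fun t htt x hx hne => by linarith [ht t htt x hx hne]

lemma ViscositySubAt.viscosityAt {J : (E n → ℝ) → E n → ℝ} {t₀ : ℝ} {x₀ : E n}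
    (h : ViscositySubAt s b r J T u t₀ x₀) : ViscosityAt (-1) s b r J T u t₀ x₀ := by
  intro R φ hR hφ hval ht
  have := h R φ hR hφ hval fun t htt x hx hne => by linarith [ht t htt x hx hne]
  linarith

/-- A wrong sign at (t₁,x₁) would persist nearby by continuity. Some point nearby is touched
strictly by a paraboloid, whose derivatives there are those of u. The viscosity inequality holds for
all small gluing radii, and its limit contradicts the sign. -/
lemma RegularEvolution.evolOp_nonneg_of_viscosity (hn : 1 ≤ n) (hs : 1 / 2 < s)
    (hs1 : s < 1) (hσ : 0 < σ) (hσs : σ < s) (h0 : 0 < lam) (h1 : lam ≤ Lam) (hT : 0 < T)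
    (hα : 0 < α) (h : RegularEvolution s α T M D u ut) {J : (E n → ℝ) → E n → ℝ}
    (hJ : IsNonlocalOp σ lam Lam J) {ε : ℝ} (hε : ε = 1 ∨ ε = -1) {t₁ : ℝ} (ht₁ : t₁ ∈ Ioo 0 T)
    {x₁ : E n} (hvisc : ∀ᶠ q in 𝓝 (t₁, x₁), ViscosityAt ε s b r J T u q.1 q.2) :
    0 ≤ ε * evolOp s b r J u ut t₁ x₁ := by
  by_contra! hneg
  have hcF := h.continuousOn_evolOp (b := b) (r := r) hn hs hs1 hσ hσs h0 h1 hT hα hJ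
  have hnhds : Ioc 0 T ×ˢ univ ∈ 𝓝 (t₁, x₁) :=
    prod_mem_nhds (Ioc_mem_nhds ht₁.1 ht₁.2) Filter.univ_mem
  have hev : ∀ᶠ q in 𝓝 (t₁, x₁), ε * evolOp s b r J u ut q.1 q.2 < 0 :=
    ((continuousOn_const.mul hcF).continuousAt hnhds).eventually_lt continuousAt_const hneg
  have hev2 : ∀ᶠ q : ℝ × E n in 𝓝 (t₁, x₁), q ∈ Ioo 0 T ×ˢ univ :=
    prod_mem_nhds (Ioo_mem_nhds ht₁.1 ht₁.2) Filter.univ_mem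
  obtain ⟨ρ', hρ', hball⟩ := Metric.eventually_nhds_iff.1 (hvisc.and (hev.and hev2))
  set ρ : ℝ := ρ' / 2 with hρd
  have hρ : 0 < ρ := by positivity
  have hin : ∀ t x, |t - t₁| ≤ ρ → ‖x - x₁‖ ≤ ρ → dist ((t, x) : ℝ × E n) (t₁, x₁) < ρ' := by
    intro t x ht hx
    rw [Prod.dist_eq, Real.dist_eq, dist_eq_norm]
    exact (max_le ht hx).trans_lt (by linarith)
  have hIoo : ∀ t ∈ Icc (t₁ - ρ) (t₁ + ρ), t ∈ Ioo 0 T := fun t ht =>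
    (hball (hin t x₁ (by rw [abs_le]; constructor <;> linarith [ht.1, ht.2])
      (by simpa using hρ.le))).2.2.1
  obtain ⟨t₀, x₀, k, k', c, ht₀, hx₀, hval, htouch⟩ :=
    exists_touching_paraboloid (u := u) (B := D) hε hρ
      (h.cont.mono fun q hq => ⟨Ioo_subset_Icc_self (hIoo _ hq.1), mem_univ _⟩)
      (fun t ht x => (h.reg t (Ioo_subset_Ioc_self (hIoo t ht))).bound x) (x₁ := x₁)
  obtain ⟨hv, hF, ht₀T, -⟩ := hball (hin t₀ x₀ ht₀.le hx₀.le)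
  simp only at hv hF ht₀T
  have hεε : ε ≠ 0 := by rcases hε with h | h <;> rw [h] <;> norm_num
  set A := parabTime k t₁ t₀ k' c with hA
  set Bf := parabSpace k x₁ x₀ k' with hBf
  have hs0 : 0 < s := by linarith
  have hAd : Differentiable ℝ A := (contDiff_parabTime _ _ _ _ _).differentiable (by norm_num)
  have hBd : Differentiable ℝ Bf := (contDiff_parabSpace _ _ _ _).differentiable (by norm_num)
  have hnonneg : ∀ t x, |t - t₁| ≤ ρ → ‖x - x₁‖ ≤ ρ → 0 ≤ ε * (u t x - (A t + Bf x)) := by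
    intro t x ht hx
    by_cases hne : (t, x) = (t₀, x₀)
    · obtain ⟨rfl, rfl⟩ := Prod.mk.inj hne
      rw [hval, sub_self, mul_zero]
    · exact (htouch t x ht hx hne).le
  have hnt : ∀ᶠ t in 𝓝 t₀, |t - t₁| ≤ ρ := by
    have : ContinuousAt (fun t : ℝ => |t - t₁|) t₀ := by fun_prop
    exact (this.eventually_lt continuousAt_const ht₀).mono fun t ht => ht.le
  have hnx : ∀ᶠ x in 𝓝 x₀, ‖x - x₁‖ ≤ ρ := by
    have : ContinuousAt (fun x : E n => ‖x - x₁‖) x₀ := by fun_prop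
    exact (this.eventually_lt continuousAt_const hx₀).mono fun t ht => ht.le
  have htime : deriv A t₀ = ut t₀ x₀ := by
    have hd1 : HasDerivAt (fun t => u t x₀) (ut t₀ x₀) t₀ :=
      (h.hasDeriv t₀ (Ioo_subset_Ioc_self ht₀T) x₀).hasDerivAt (Ioc_mem_nhds ht₀T.1 ht₀T.2)
    have hd2 : HasDerivAt (fun t => ε * (u t x₀ - (A t + Bf x₀)))
        (ε * (ut t₀ x₀ - deriv A t₀)) t₀ :=
      (hd1.sub ((hAd t₀).hasDerivAt.add_const _)).const_mul ε
    have hmin : IsLocalMin (fun t => ε * (u t x₀ - (A t + Bf x₀))) t₀ := by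
      filter_upwards [hnt] with t ht
      rw [hval, sub_self, mul_zero]
      exact hnonneg t x₀ ht hx₀.le
    have := hmin.hasDerivAt_eq_zero hd2
    rcases mul_eq_zero.1 this with h | h
    · exact absurd h hεε
    · linarith
  have hspace : fderiv ℝ Bf x₀ = fderiv ℝ (u t₀) x₀ := by
    have hu := h.reg t₀ (Ioo_subset_Ioc_self ht₀T)
    have hd2 : HasFDerivAt (fun x => ε * (u t₀ x - (A t₀ + Bf x)))
        (ε • (fderiv ℝ (u t₀) x₀ - fderiv ℝ Bf x₀)) x₀ :=
      ((hu.hasFDerivAt hs0 x₀).sub ((hBd x₀).hasFDerivAt.const_add _)).const_mul ε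
    have hmin : IsLocalMin (fun x => ε * (u t₀ x - (A t₀ + Bf x))) x₀ := by
      filter_upwards [hnx] with x hx
      rw [hval, sub_self, mul_zero]
      exact hnonneg t₀ x ht₀.le hx
    have := hmin.hasFDerivAt_eq_zero hd2
    rcases smul_eq_zero.1 this with h | h
    · exact absurd h hεε
    · exact (sub_eq_zero.1 h).symm
  have hlim := (h.glue_tendsto (b := b) (r := r) hn hs hs1 hσ hσs h0 h1 hJ ht₀T hval htime
    hspace).const_mul ε
  have hge : 0 ≤ ε * evolOp s b r J u ut t₀ x₀ := by
    refine ge_of_tendsto hlim ?_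
    obtain ⟨R₁, hR₁, hb₁⟩ := Metric.eventually_nhds_iff.1 hnt
    obtain ⟨R₂, hR₂, hb₂⟩ := Metric.eventually_nhds_iff.1 hnx
    filter_upwards [Ioc_mem_nhdsGT (lt_min hR₁ hR₂)] with R hR
    refine hv R _ hR.1 (isC12_of_add (contDiff_parabTime _ _ _ _ _)
      (contDiff_parabSpace _ _ _ _) t₀ x₀ R) hval.symm fun t _ x hx hne => ?_
    simp only [stBall, mem_ofPred_eq] at hx
    refine htouch t x (hb₁ ?_) (hb₂ ?_) hne
    · rw [Real.dist_eq]
      refine (abs_lt_of_sq_lt_sq (by linarith [sq_nonneg ‖x - x₀‖]) hR.1.le).trans_le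
        (hR.2.trans (min_le_left _ _))
    · rw [dist_eq_norm]
      exact (lt_of_pow_lt_pow_left₀ 2 hR.1.le (by linarith [sq_nonneg (t - t₀)])).trans_le
        (hR.2.trans (min_le_right _ _))
  linarith

end Touch

/-! ### Comparison and monotonicity in time -/

lemma integral_div_kernel_le {n : ℕ} (hn : 1 ≤ n) {p κ : ℝ} (hp : 0 < p) (hκ : p < κ)
    {f : E n → ℝ} {B : ℝ} (hB0 : 0 ≤ B) (hB : ∀ y, f y ≤ B * min (‖y‖ ^ κ) 1) :
    ∫ y : E n, f y / ‖y‖ ^ ((n : ℝ) + p) ≤ B * truncConst n p κ := by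
  by_cases hf : Integrable (fun y : E n => f y / ‖y‖ ^ ((n : ℝ) + p))
  · rw [truncConst, ← integral_const_mul]
    refine integral_mono hf ((integrable_truncKernel hn hp hκ).const_mul B) fun y => ?_
    simp only
    rw [← mul_div_assoc]
    exact div_le_div_of_nonneg_right (hB y) (by positivity)
  -- A non-integrable integrand has integral 0 by convention, and the right side is non-negative.
  · rw [integral_undef hf]
    exact mul_nonneg hB0 (truncConst_nonneg n p κ)

lemma le_fracLap_of_secondDiff_le {n : ℕ} (hn : 1 ≤ n) {s : ℝ} (hs : 0 < s) (hs1 : s < 1)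
    {w : E n → ℝ} {x : E n} {B : ℝ} (hB0 : 0 ≤ B)
    (hB : ∀ y, secondDiff w x y ≤ B * min (‖y‖ ^ (2 : ℝ)) 1) :
    -(fracConst n s / 2 * truncConst n (2 * s) 2 * B) ≤ fracLap s w x := by
  have h := integral_div_kernel_le hn (p := 2 * s) (by linarith) (by linarith) hB0 hB
  have hc := fracConst_pos (n := n) hs hs1
  have := mul_le_mul_of_nonneg_left h (half_pos hc).le
  unfold fracLap
  linarith

/-- The negative part of the second difference enters with a favourable sign, so an upper bound on
the second difference suffices. -/
lemma extremalSup_le_of_secondDiff_le {n : ℕ} (hn : 1 ≤ n) {σ lam Lam : ℝ} (hσ : 0 < σ)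
    (hσ1 : σ < 1) (h0 : 0 < lam) (h1 : lam ≤ Lam)
    {w : E n → ℝ} {x : E n} {B : ℝ} (hB0 : 0 ≤ B)
    (hB : ∀ y, secondDiff w x y ≤ B * min (‖y‖ ^ (2 : ℝ)) 1) :
    extremalSup σ lam Lam w x ≤ Lam * truncConst n (2 * σ) 2 * B := by
  have hL : 0 ≤ Lam := by linarith
  have h := integral_div_kernel_le hn (p := 2 * σ) (κ := 2) (B := Lam * B)
    (f := fun y => Lam * max (secondDiff w x y) 0 - lam * max (-secondDiff w x y) 0)
    (by linarith) (by linarith) (by positivity) fun y => by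
      have a1 : max (secondDiff w x y) 0 ≤ B * min (‖y‖ ^ (2 : ℝ)) 1 :=
        max_le (hB y) (by positivity)
      have a2 := mul_le_mul_of_nonneg_left a1 hL
      have a3 : 0 ≤ lam * max (-secondDiff w x y) 0 :=
        mul_nonneg h0.le (le_max_right _ _)
      linarith
  unfold extremalSup
  linarith

section Comparison

variable {n : ℕ} {s σ lam Lam T r α M D : ℝ} {b : E n} {u ut : ℝ → E n → ℝ}

lemma RegularEvolution.hasFDerivAt (h : RegularEvolution s α T M D u ut) (hs : 0 < s) {t : ℝ}
    (ht : t ∈ Ioc 0 T) (x : E n) : HasFDerivAt (u t) (fderiv ℝ (u t) x) x :=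
  (h.reg t ht).hasFDerivAt hs x

/-- A derivative at the right end point of an interval is non-negative if the function is
maximal there. -/
lemma deriv_nonneg_of_max_right {f : ℝ → ℝ} {f' t₀ : ℝ} (ht₀ : 0 < t₀)
    (hf : HasDerivWithinAt f f' (Ioo 0 t₀) t₀) (hmax : ∀ t ∈ Ioo 0 t₀, f t ≤ f t₀) : 0 ≤ f' := by
  rw [hasDerivWithinAt_iff_tendsto_slope' (by simp)] at hf
  have hne : (𝓝[Ioo 0 t₀] t₀).NeBot := by
    rw [← mem_closure_iff_nhdsWithin_neBot, closure_Ioo ht₀.ne]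
    exact ⟨ht₀.le, le_rfl⟩
  refine ge_of_tendsto hf ?_
  filter_upwards [self_mem_nhdsWithin] with t ht
  rw [slope_def_field]
  exact div_nonneg_of_nonpos (by linarith [hmax t ht]) (by linarith [ht.2])

/-- Comparison at an approximate maximum point of `u(t) - u(t+δ)`. -/
lemma RegularEvolution.shift_bound (hn : 1 ≤ n) (hs : 1 / 2 < s)
    (hs1 : s < 1) (hσ : 0 < σ) (hσs : σ < s) (h0 : 0 < lam) (h1 : lam ≤ Lam)
    (h : RegularEvolution s α T M D u ut) {J : (E n → ℝ) → E n → ℝ}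
    (hJ : IsNonlocalOp σ lam Lam J) {ε C δ t₀ k : ℝ} {x₀ : E n} {η : E n → ℝ}
    (hC : 0 ≤ C) (hηd : Differentiable ℝ η) (hηf : ∀ x, ‖fderiv ℝ η x‖ ≤ C)
    (hηs : ∀ x y, |secondDiff η x y| ≤ 4 * C * min (‖y‖ ^ (2 : ℝ)) 1) (hε : 0 ≤ ε) (hδ : 0 < δ) (ht₀ : 0 < t₀) (ht₀T : t₀ + δ ≤ T)
    (hk : r + 1 ≤ k) (hW : 0 < u t₀ x₀ - u (t₀ + δ) x₀)
    (hmaxx : ∀ x, (u t₀ x - u (t₀ + δ) x) + ε * η x ≤ (u t₀ x₀ - u (t₀ + δ) x₀) + ε * η x₀)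
    (hmaxt : ∀ t ∈ Ioo 0 t₀, Real.exp (-k * t) * (u t x₀ - u (t + δ) x₀) ≤
      Real.exp (-k * t₀) * (u t₀ x₀ - u (t₀ + δ) x₀))
    (hF0 : evolOp s b r J u ut t₀ x₀ ≤ 0) (hF1 : 0 ≤ evolOp s b r J u ut (t₀ + δ) x₀) :
    u t₀ x₀ - u (t₀ + δ) x₀ ≤ ε * (C * (fracConst n s / 2 * truncConst n (2 * s) 2 * 4 +
      Lam * truncConst n (2 * σ) 2 * 4 + ‖b‖)) := by
  have hs0 : 0 < s := by linarith
  have htm : t₀ ∈ Ioc 0 T := ⟨ht₀, by linarith⟩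
  have htm' : t₀ + δ ∈ Ioc 0 T := ⟨by linarith, ht₀T⟩
  have hr0 := h.reg t₀ htm
  have hr1 := h.reg _ htm'
  set W : ℝ := u t₀ x₀ - u (t₀ + δ) x₀ with hWd
  -- Maximality at x₀, tested at x₀ ± y, bounds this second difference by that of -εη.
  have hsd : ∀ y, secondDiff (u t₀ - u (t₀ + δ)) x₀ y ≤
      ε * (4 * C) * min (‖y‖ ^ (2 : ℝ)) 1 := by
    intro y
    have a1 := hmaxx (x₀ + y)
    have a2 := hmaxx (x₀ - y)
    have a3 := mul_le_mul_of_nonneg_left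
      ((neg_le_abs (secondDiff η x₀ y)).trans (hηs x₀ y)) hε
    simp only [secondDiff, Pi.sub_apply] at a3 ⊢
    linarith
  have hB0 : 0 ≤ ε * (4 * C) := by positivity
  have hL := le_fracLap_of_secondDiff_le hn hs0 hs1 hB0 hsd
  rw [fracLap_sub (hr0.fracLapConverges hn hs0 hs1 x₀) (hr1.fracLapConverges hn hs0 hs1 x₀)] at hL
  have hJ' := ((hJ.elliptic _ _ x₀ (hr0.inDomain hs0 hσ hσs hs1 x₀)
    (hr1.inDomain hs0 hσ hσs hs1 x₀)).2).trans
      (extremalSup_le_of_secondDiff_le hn hσ (by linarith) h0 h1 hB0 hsd)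
  have hgrad : fderiv ℝ (u t₀) x₀ b - fderiv ℝ (u (t₀ + δ)) x₀ b ≤ ε * (C * ‖b‖) := by
    have hd : HasFDerivAt (fun x => (u t₀ x - u (t₀ + δ) x) + ε * η x)
        (fderiv ℝ (u t₀) x₀ - fderiv ℝ (u (t₀ + δ)) x₀ + ε • fderiv ℝ η x₀) x₀ :=
      ((h.hasFDerivAt hs0 htm x₀).sub (h.hasFDerivAt hs0 htm' x₀)).add
        ((hηd x₀).hasFDerivAt.const_mul ε)
    have hmax : IsLocalMax (fun x => (u t₀ x - u (t₀ + δ) x) + ε * η x) x₀ :=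
      Filter.Eventually.of_forall hmaxx
    have hz := congrArg (fun L : E n →L[ℝ] ℝ => L b) (hmax.hasFDerivAt_eq_zero hd)
    simp only [add_apply, sub_apply, smul_apply, smul_eq_mul, zero_apply] at hz
    have a1 : |fderiv ℝ η x₀ b| ≤ C * ‖b‖ := by
      exact ((fderiv ℝ η x₀).le_opNorm b).trans
        (mul_le_mul_of_nonneg_right (hηf x₀) (norm_nonneg b))
    have a2 := mul_le_mul_of_nonneg_left ((neg_le_abs _).trans a1) hε
    linarith
  -- Only times before t₀ are used, since t₀ + δ may be the final time, where just a one-sided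
  -- derivative exists.
  have htime : k * W ≤ ut t₀ x₀ - ut (t₀ + δ) x₀ := by
    have d1 : HasDerivWithinAt (fun t => u t x₀) (ut t₀ x₀) (Ioo 0 t₀) t₀ :=
      (h.hasDeriv t₀ htm x₀).mono fun t ht => ⟨ht.1, ht.2.le.trans htm.2⟩
    have d2 : HasDerivWithinAt (fun t => u (t + δ) x₀) (ut (t₀ + δ) x₀) (Ioo 0 t₀) t₀ := by
      have e1 : HasDerivWithinAt (fun t : ℝ => t + δ) 1 (Ioo 0 t₀) t₀ :=
        (hasDerivWithinAt_id _ _).add_const δ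
      have hmaps : MapsTo (fun t : ℝ => t + δ) (Ioo 0 t₀) (Ioc 0 T) := fun t ht =>
        ⟨add_pos ht.1 hδ, (add_lt_add_left ht.2 δ).le.trans ht₀T⟩
      have e2 := HasDerivWithinAt.comp (h₂ := fun t => u t x₀) t₀ (h.hasDeriv _ htm' x₀) e1 hmaps
      rwa [mul_one] at e2
    have d3 : HasDerivWithinAt (fun t => Real.exp (-k * t)) (Real.exp (-k * t₀) * (-k * 1))
        (Ioo 0 t₀) t₀ := ((hasDerivWithinAt_id t₀ _).const_mul (-k)).exp
    have d4 := d3.mul (d1.sub d2)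
    have h5 := deriv_nonneg_of_max_right ht₀ d4 hmaxt
    have h6 : 0 ≤ Real.exp (-k * t₀) * ((ut t₀ x₀ - ut (t₀ + δ) x₀) - k * W) := by
      refine h5.trans (le_of_eq ?_)
      simp only [Pi.sub_apply]
      rw [hWd]; ring
    have h7 := nonneg_of_mul_nonneg_right h6 (Real.exp_pos _)
    linarith
  -- In the difference of the two inequalities for F the zero order term contributes rW; the choice
  -- of k absorbs it and leaves W itself to be estimated.
  have hkW : (r + 1) * W ≤ k * W := mul_le_mul_of_nonneg_right hk hW.le
  unfold evolOp lowerOp at hF0 hF1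
  have hrW : r * u t₀ x₀ - r * u (t₀ + δ) x₀ = r * W := by rw [hWd]; ring
  linarith

/-- Solutions starting from the obstacle are non-decreasing in time. -/
lemma RegularEvolution.monotone (hn : 1 ≤ n) (hs : 1 / 2 < s)
    (hs1 : s < 1) (hσ : 0 < σ) (hσs : σ < s) (h0 : 0 < lam) (h1 : lam ≤ Lam) (hT : 0 < T)
    (h : RegularEvolution s α T M D u ut) {J : (E n → ℝ) → E n → ℝ}
    (hJ : IsNonlocalOp σ lam Lam J) {ψ : E n → ℝ}
    (hψ : ∀ t ∈ Ioc 0 T, ∀ x, ψ x ≤ u t x) (hψ0 : ∀ x, u 0 x = ψ x)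
    (hsuper : ∀ t ∈ Ioc 0 T, ∀ x, 0 ≤ evolOp s b r J u ut t x)
    (hsub : ∀ t ∈ Ioc 0 T, ∀ x, ψ x < u t x → evolOp s b r J u ut t x ≤ 0)
    {t τ : ℝ} (ht : 0 ≤ t) (htτ : t ≤ τ) (hτ : τ ≤ T) (x : E n) : u t x ≤ u τ x := by
  rcases htτ.eq_or_lt with rfl | htτ
  · exact le_rfl
  by_contra! hneg
  set δ : ℝ := τ - t with hδd
  have hδ : 0 < δ := by linarith
  set k : ℝ := |r| + 1 with hk
  have hk0 : 0 < k := by positivity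
  have hM := h.nonneg hT
  -- A decrease of u over some time δ makes the supremum of this function positive, which is to be
  -- refuted. The exponential weight dominates the zero order term.
  let G : ℝ × E n → ℝ := fun q => Real.exp (-k * q.1) * (u q.1 q.2 - u (q.1 + δ) q.2)
  let S₀ : Set (ℝ × E n) := Icc 0 (T - δ) ×ˢ univ
  have hIcc : ∀ t' ∈ Icc 0 (T - δ), t' ∈ Icc 0 T ∧ t' + δ ∈ Icc 0 T := fun t' ht' =>
    ⟨⟨ht'.1, by linarith [ht'.2]⟩, ⟨by linarith [ht'.1], by linarith [ht'.2]⟩⟩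
  have hGb : ∀ q ∈ S₀, G q ≤ M * δ := by
    rintro ⟨t', x'⟩ ⟨ht', -⟩
    have a1 := h.lip t' (hIcc t' ht').1 _ (hIcc t' ht').2 x'
    rw [sub_add_cancel_left, abs_neg, abs_of_pos hδ] at a1
    have a2 : Real.exp (-k * t') ≤ 1 := by
      rw [Real.exp_le_one_iff]; nlinarith [ht'.1]
    have a3 := Real.exp_pos (-k * t')
    calc G (t', x') ≤ Real.exp (-k * t') * (M * δ) :=
          mul_le_mul_of_nonneg_left ((le_abs_self _).trans a1) a3.le
      _ ≤ M * δ := mul_le_of_le_one_left (by positivity) a2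
  have hbdd : BddAbove (G '' S₀) := ⟨M * δ, by rintro _ ⟨q, hq, rfl⟩; exact hGb q hq⟩
  have hmem : (t, x) ∈ S₀ := ⟨⟨ht, by linarith⟩, mem_univ _⟩
  have hne : (G '' S₀).Nonempty := ⟨_, mem_image_of_mem G hmem⟩
  set S : ℝ := sSup (G '' S₀) with hS
  have hGS : ∀ q ∈ S₀, G q ≤ S := fun q hq => le_csSup hbdd (mem_image_of_mem G hq)
  have hSpos : 0 < S := by
    refine lt_of_lt_of_le (mul_pos (Real.exp_pos _) ?_) (hGS _ hmem)
    have : t + δ = τ := by rw [hδd]; ring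
    simp only [this]
    linarith
  let θ : ContDiffBump (0 : E n) := ⟨1, 2, one_pos, one_lt_two⟩
  obtain ⟨C, hC⟩ := exists_decayKernel_of_hasCompactSupport (φ := (θ : E n → ℝ)) θ.contDiff
    θ.hasCompactSupport
  have hC0 := hC.nonneg
  set A : ℝ := C * (fracConst n s / 2 * truncConst n (2 * s) 2 * 4 +
      Lam * truncConst n (2 * σ) 2 * 4 + ‖b‖) with hA
  have hc := fracConst_pos (n := n) (show 0 < s by linarith) hs1
  have hA0 : 0 ≤ A := by
    have := truncConst_nonneg n (2 * s) 2
    have := truncConst_nonneg n (2 * σ) 2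
    have : 0 ≤ Lam := by linarith
    positivity
  have hestimate : ∀ ε, 0 < ε → ε ≤ S → S ≤ ε * (A + 1) := by
    intro ε hε hεS
    obtain ⟨_, ⟨⟨t₁, x₁⟩, ⟨ht₁, -⟩, rfl⟩, hlt⟩ :=
      exists_lt_of_lt_csSup hne (show S - ε / 2 < sSup (G '' S₀) by linarith)
    -- The supremum over ℝⁿ need not be attained. A bump of height ε at a point where G exceeds S -
    -- ε/2 forces a maximum near that point, because away from the bump the values do not exceed S.
    let η : E n → ℝ := fun z => θ (z + -x₁)
    have hη1 : η x₁ = 1 := by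
      simp only [η, add_neg_cancel]
      exact θ.one_of_mem_closedBall (by simp [θ])
    have hηle : ∀ z, η z ≤ 1 := fun z => θ.le_one
    have hη0 : ∀ z, z ∉ Metric.closedBall x₁ 2 → η z = 0 := fun z hz => by
      refine θ.zero_of_le_dist ?_
      rw [Metric.mem_closedBall, not_le, dist_eq_norm] at hz
      rw [dist_zero_right, ← sub_eq_add_neg]
      exact hz.le
    have hηd : Differentiable ℝ η :=
      (hC.smooth.differentiable (by simp)).comp (differentiable_id.add_const (-x₁))
    have hηf : ∀ z, ‖fderiv ℝ η z‖ ≤ C := fun z => by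
      rw [show fderiv ℝ η z = fderiv ℝ (θ : E n → ℝ) (z + -x₁) from fderiv_comp_add_right (-x₁)]
      exact (hC.bound_fderiv _).trans (mul_le_of_le_one_right hC0 (decay_le_one _))
    have hηs : ∀ z y, |secondDiff η z y| ≤ 4 * C * min (‖y‖ ^ (2 : ℝ)) 1 := fun z y => by
      have e : secondDiff η z y = secondDiff (θ : E n → ℝ) (z + -x₁) y := by
        simp only [secondDiff, η]
        rw [add_right_comm z y, sub_add_eq_add_sub z y]
      rw [e]
      exact hC.secondDiff_le' _ y
    have hcont : ContinuousOn (fun q : ℝ × E n => G q + ε * η q.2)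
        (Icc 0 (T - δ) ×ˢ Metric.closedBall x₁ 2) := by
      have c1 : ContinuousOn (fun q : ℝ × E n => u q.1 q.2)
          (Icc 0 (T - δ) ×ˢ Metric.closedBall x₁ 2) :=
        h.cont.mono fun q hq => ⟨(hIcc _ hq.1).1, mem_univ _⟩
      have c2 : ContinuousOn (fun q : ℝ × E n => u (q.1 + δ) q.2)
          (Icc 0 (T - δ) ×ˢ Metric.closedBall x₁ 2) :=
        h.cont.comp (f := fun q : ℝ × E n => (q.1 + δ, q.2)) (by fun_prop)
          fun q hq => ⟨(hIcc _ hq.1).2, mem_univ _⟩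
      have c3 : Continuous η := θ.continuous.comp (continuous_id.add continuous_const)
      have c4 : Continuous (fun q : ℝ × E n => Real.exp (-k * q.1)) := by fun_prop
      exact (c4.continuousOn.mul (c1.sub c2)).add
        (continuousOn_const.mul (c3.comp continuous_snd).continuousOn)
    obtain ⟨⟨t₀, x₀⟩, ⟨ht₀, hx₀⟩, hmax⟩ :=
      (isCompact_Icc.prod (isCompact_closedBall x₁ 2)).exists_isMaxOn
        ⟨(t₁, x₁), ht₁, Metric.mem_closedBall_self (by norm_num)⟩ hcont
    change t₀ ∈ Icc 0 (T - δ) at ht₀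
    change t₁ ∈ Icc 0 (T - δ) at ht₁
    have hbig : S + ε / 2 < G (t₀, x₀) + ε * η x₀ := by
      have := hmax (a := (t₁, x₁)) ⟨ht₁, Metric.mem_closedBall_self (by norm_num)⟩
      simp only [mem_ofPred_eq, hη1] at this
      linarith
    have hglob : ∀ t' ∈ Icc 0 (T - δ), ∀ x', G (t', x') + ε * η x' ≤ G (t₀, x₀) + ε * η x₀ := by
      intro t' ht' x'
      by_cases hx' : x' ∈ Metric.closedBall x₁ 2
      · exact hmax (a := (t', x')) ⟨ht', hx'⟩
      · rw [hη0 x' hx']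
        have := hGS (t', x') ⟨ht', mem_univ _⟩
        linarith
    have hG0 : S - ε / 2 < G (t₀, x₀) := by
      have := mul_le_mul_of_nonneg_left (hηle x₀) hε.le
      linarith
    have hexp := Real.exp_pos (-k * t₀)
    have hW : 0 < u t₀ x₀ - u (t₀ + δ) x₀ := by
      have : 0 < G (t₀, x₀) := by linarith
      exact pos_of_mul_pos_right this hexp.le
    -- The maximum is not at time 0, where u = ψ ≤ u(δ).
    have ht₀0 : 0 < t₀ := by
      rcases ht₀.1.eq_or_lt with h' | h'
      · exfalso
        rw [← h', zero_add, hψ0] at hW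
        have := hψ δ ⟨hδ, by linarith [ht₀.1, ht₀.2]⟩ x₀
        linarith
      · exact h'
    have ht₀m : t₀ ∈ Ioc 0 T := ⟨ht₀0, (hIcc _ ht₀).1.2⟩
    have ht₀m' : t₀ + δ ∈ Ioc 0 T := ⟨by linarith, (hIcc _ ht₀).2.2⟩
    have hinv : Real.exp (k * t₀) * Real.exp (-k * t₀) = 1 := by
      rw [← Real.exp_add]; simp
    have hmaxx : ∀ x', (u t₀ x' - u (t₀ + δ) x') + (Real.exp (k * t₀) * ε) * η x' ≤
        (u t₀ x₀ - u (t₀ + δ) x₀) + (Real.exp (k * t₀) * ε) * η x₀ := fun x' => by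
      have a1 := mul_le_mul_of_nonneg_left (hglob t₀ ht₀ x') (Real.exp_pos (k * t₀)).le
      have a2 : ∀ z, Real.exp (k * t₀) * (G (t₀, z) + ε * η z) =
          (u t₀ z - u (t₀ + δ) z) + (Real.exp (k * t₀) * ε) * η z := fun z => by
        simp only [G]
        rw [mul_add, ← mul_assoc, hinv, one_mul, mul_assoc]
      rwa [a2, a2] at a1
    have hmaxt : ∀ t' ∈ Ioo 0 t₀, Real.exp (-k * t') * (u t' x₀ - u (t' + δ) x₀) ≤
        Real.exp (-k * t₀) * (u t₀ x₀ - u (t₀ + δ) x₀) := fun t' ht' => by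
      have := hglob t' ⟨ht'.1.le, ht'.2.le.trans ht₀.2⟩ x₀
      simp only [G] at this
      linarith
    -- At the maximum u(t₀) > u(t₀+δ) ≥ ψ, so the subsolution inequality is available at t₀; the
    -- supersolution inequality at t₀ + δ needs no condition.
    have hfin := h.shift_bound (r := r) (b := b) hn hs hs1 hσ hσs h0 h1 hJ hC0 hηd hηf hηs
      (by positivity) hδ ht₀0 ht₀m'.2 (by linarith [le_abs_self r]) hW hmaxx hmaxt
      (hsub t₀ ht₀m x₀ (by linarith [hψ _ ht₀m' x₀])) (hsuper _ ht₀m' x₀)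
    have hGA : G (t₀, x₀) ≤ ε * A := by
      refine (mul_le_mul_of_nonneg_left hfin hexp.le).trans (le_of_eq ?_)
      rw [← hA, mul_assoc, ← mul_assoc, mul_comm (Real.exp (-k * t₀)), hinv, one_mul]
    linarith
  -- This ε turns the estimate into S ≤ S/2.
  have hlast := hestimate (S / (2 * (A + 1))) (by positivity)
    (div_le_self hSpos.le (by linarith))
  have : S / (2 * (A + 1)) * (A + 1) = S / 2 := by field_simp
  linarith

end Comparison

/-! ### Interpolation in time -/

section TimeRegularity

variable {n : ℕ} {s σ lam Lam T r α M D θ : ℝ} {b : E n} {u ut : ℝ → E n → ℝ}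

/-- Interpolation between the Hölder continuity of `∂ₜu` and the `C^{1,s}` regularity of `u`. -/
lemma RegularEvolution.secondDiff_time_le (h : RegularEvolution s α T M D u ut) (hs : 0 < s)
    (hs1 : s < 1) (hα : 0 < α) (hT : 0 < T) (hθ : 0 ≤ θ) (hθ1 : θ ≤ 1)
    {t τ : ℝ} (ht : t ∈ Ioc 0 T) (hτ : τ ∈ Ioc 0 T) (x y : E n) :
    |secondDiff (u t) x y - secondDiff (u τ) x y| ≤
      (4 * M * |t - τ|) ^ θ * (8 * D) ^ (1 - θ) *
        min (‖y‖ ^ ((1 - s) * θ + (1 + s) * (1 - θ))) 1 := by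
  have hM := h.nonneg hT
  have hD := (h.reg t ht).nonneg
  have hd0 : 0 ≤ 4 * M * |t - τ| := by positivity
  have h8 : 0 ≤ 8 * D := by positivity
  -- Mean value inequality in time for a spatial increment of u, whose time derivative is
  -- O(|v|^{1-s}) by the Hölder continuity of ∂ₜu in x.
  have hinc : ∀ v : E n, |(u t (x + v) - u t x) - (u τ (x + v) - u τ x)| ≤
      M * ‖v‖ ^ (1 - s) * |t - τ| := fun v => by
    refine (convex_Ioc 0 T).norm_image_sub_le_of_norm_hasDerivWithin_le
      (f := fun t' => u t' (x + v) - u t' x)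
      (fun t' ht' => (h.hasDeriv t' ht' (x + v)).sub (h.hasDeriv t' ht' x)) (fun t' ht' => ?_) hτ ht
    have := h.holder.holder t' ht' t' ht' (x + v) x
    rwa [sub_self, abs_zero, Real.zero_rpow hα.ne', zero_add, add_sub_cancel_left] at this
  have b0 : |secondDiff (u t) x y - secondDiff (u τ) x y| ≤ 4 * M * |t - τ| := by
    have l := fun z => h.lip t ⟨ht.1.le, ht.2⟩ τ ⟨hτ.1.le, hτ.2⟩ z
    have a0 := l x
    have a1 := l (x + y)
    have a2 := l (x - y)
    unfold secondDiff
    rw [abs_le] at a0 a1 a2 ⊢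
    constructor <;> linarith
  have b1 : |secondDiff (u t) x y - secondDiff (u τ) x y| ≤ 8 * D * min (‖y‖ ^ (1 + s)) 1 := by
    have a0 := (h.reg t ht).secondDiff_le hs x y
    have a1 := (h.reg τ hτ).secondDiff_le hs x y
    rw [abs_le] at a0 a1 ⊢
    constructor <;> linarith
  have b2 : |secondDiff (u t) x y - secondDiff (u τ) x y| ≤
      4 * M * |t - τ| * ‖y‖ ^ (1 - s) := by
    have a1 := hinc y
    have a2 := hinc (-y)
    rw [← sub_eq_add_neg, norm_neg] at a2
    have a3 : 0 ≤ M * ‖y‖ ^ (1 - s) * |t - τ| := by positivity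
    unfold secondDiff
    rw [abs_le] at a1 a2 ⊢
    constructor <;> linarith
  have hκ : 0 < (1 - s) * θ + (1 + s) * (1 - θ) := by
    rcases hθ.eq_or_lt with rfl | hθ0
    · linarith
    · have := mul_pos (show 0 < 1 - s by linarith) hθ0
      have := mul_nonneg (show 0 ≤ 1 + s by linarith) (show 0 ≤ 1 - θ by linarith)
      linarith
  refine mul_min_of_le ?_ (norm_nonneg y) hκ fun _ => ?_
  · exact le_rpow_mul_rpow (abs_nonneg _) b0
      (b1.trans (mul_le_of_le_one_right h8 (min_le_right _ _))) hθ hθ1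
  · have b3 := b1.trans (mul_le_mul_of_nonneg_left (min_le_left _ _) h8)
    refine (le_rpow_mul_rpow (abs_nonneg _) b2 b3 hθ hθ1).trans (le_of_eq ?_)
    rw [Real.mul_rpow h8 (by positivity), Real.mul_rpow hd0 (by positivity),
      ← Real.rpow_mul (norm_nonneg y), ← Real.rpow_mul (norm_nonneg y),
      Real.rpow_add' (norm_nonneg y) hκ.ne']
    ring

/-- The terms of order greater than one are Hölder continuous in time. -/
lemma exists_nonlocal_time_holder (hn : 1 ≤ n) (hs : 0 < s) (hs1 : s < 1) (hσ : 0 < σ)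
    (hσs : σ < s) (h0 : 0 < lam) (h1 : lam ≤ Lam) (hT : 0 < T) (hα : 0 < α) (hθ : 0 < θ)
    (hθs : θ < (1 - s) / (2 * s)) (hθ1 : θ ≤ 1) (M D : ℝ) :
    ∃ C, ∀ (u ut : ℝ → E n → ℝ) (J : (E n → ℝ) → E n → ℝ), RegularEvolution s α T M D u ut →
      IsNonlocalOp σ lam Lam J → ∀ t ∈ Ioc 0 T, ∀ τ ∈ Ioc 0 T, ∀ x,
        |(fracLap s (u t) x - J (u t) x) - (fracLap s (u τ) x - J (u τ) x)| ≤
          C * |t - τ| ^ θ := by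
  set κ : ℝ := (1 - s) * θ + (1 + s) * (1 - θ) with hκ
  -- Here κ = 1 + s - 2sθ, so the condition is exactly θ < (1-s)/(2s).
  have hκs : 2 * s < κ := by
    rw [lt_div_iff₀ (by linarith)] at hθs
    rw [hκ]; linarith
  refine ⟨(fracConst n s / 2 * truncConst n (2 * s) κ + Lam * truncConst n (2 * σ) κ) *
    ((4 * M) ^ θ * (8 * D) ^ (1 - θ)), fun u ut J h hJ t ht τ hτ x => ?_⟩
  have hM := h.nonneg hT
  have hB := h.secondDiff_time_le hs hs1 hα hT hθ.le hθ1 ht hτ x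
  rw [Real.mul_rpow (by positivity) (abs_nonneg _)] at hB
  have a1 := abs_fracLap_le hn hs hs1 hκs (f := u t - u τ) (x := x)
    (B := (4 * M) ^ θ * |t - τ| ^ θ * (8 * D) ^ (1 - θ)) fun y => by
      rw [secondDiff_sub]; exact hB y
  rw [fracLap_sub ((h.reg t ht).fracLapConverges hn hs hs1 x)
    ((h.reg τ hτ).fracLapConverges hn hs hs1 x)] at a1
  have a2 := hJ.abs_sub_le hn hσ (κ := κ) (by linarith) h0 h1
    ((h.reg t ht).inDomain hs hσ hσs hs1 x) ((h.reg τ hτ).inDomain hs hσ hσs hs1 x) hB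
  calc _ = |(fracLap s (u t) x - fracLap s (u τ) x) - (J (u t) x - J (u τ) x)| := by ring_nf
    _ ≤ _ := abs_sub _ _
    _ ≤ _ := add_le_add a1 a2
    _ = _ := by ring

end TimeRegularity

/-! ### Classical inequalities up to the final time, and the contact set -/

section Obstacle

variable {n : ℕ} {s σ lam Lam T r α M D θ : ℝ} {b : E n} {u ut : ℝ → E n → ℝ} {ψ : E n → ℝ}
  {J : (E n → ℝ) → E n → ℝ}

lemma neBot_nhdsWithin_Ioo {t : ℝ} (ht : t ∈ Ioc 0 T) : (𝓝[Ioo 0 T] t).NeBot := by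
  rw [← mem_closure_iff_nhdsWithin_neBot, closure_Ioo (ht.1.trans_le ht.2).ne]
  exact ⟨ht.1.le, ht.2⟩

lemma RegularEvolution.continuousOn_time (h : RegularEvolution s α T M D u ut) (x : E n) :
    ContinuousOn (fun t => u t x) (Icc 0 T) :=
  h.cont.comp (f := fun t : ℝ => (t, x)) (by fun_prop) fun _ ht => ⟨ht, mem_univ _⟩

lemma RegularEvolution.continuousOn_evolOp_time (hn : 1 ≤ n) (hs : 1 / 2 < s)
    (hs1 : s < 1) (hσ : 0 < σ) (hσs : σ < s) (h0 : 0 < lam) (h1 : lam ≤ Lam) (hT : 0 < T)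
    (hα : 0 < α) (h : RegularEvolution s α T M D u ut) (hJ : IsNonlocalOp σ lam Lam J) (x : E n) :
    ContinuousOn (fun t => evolOp s b r J u ut t x) (Ioc 0 T) :=
  (h.continuousOn_evolOp (b := b) (r := r) hn hs hs1 hσ hσs h0 h1 hT hα hJ).comp
    (f := fun t : ℝ => (t, x)) (by fun_prop) fun _ ht => ⟨ht, mem_univ _⟩

/-- Regular supersolutions are classical supersolutions, up to the final time. -/
lemma RegularEvolution.evolOp_nonneg (hn : 1 ≤ n) (hs : 1 / 2 < s)
    (hs1 : s < 1) (hσ : 0 < σ) (hσs : σ < s) (h0 : 0 < lam) (h1 : lam ≤ Lam) (hT : 0 < T)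
    (hα : 0 < α) (h : RegularEvolution s α T M D u ut) (hJ : IsNonlocalOp σ lam Lam J)
    (hv : ∀ t ∈ Ioc 0 T, ∀ x, ViscositySuperAt s b r J T u t x) {t : ℝ} (ht : t ∈ Ioc 0 T)
    (x : E n) : 0 ≤ evolOp s b r J u ut t x := by
  have hc := h.continuousOn_evolOp_time (b := b) (r := r) hn hs hs1 hσ hσs h0 h1 hT hα hJ x
  -- The two-sided argument in time works only for t < T; the final time follows from continuity of
  -- F.
  have := neBot_nhdsWithin_Ioo ht
  refine ge_of_tendsto ((hc t ht).mono Ioo_subset_Ioc_self).tendsto ?_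
  filter_upwards [self_mem_nhdsWithin] with t' ht'
  have h2 := h.evolOp_nonneg_of_viscosity (b := b) (r := r) hn hs hs1 hσ hσs h0 h1 hT hα hJ
    (Or.inl rfl) ht' (x₁ := x) (by
      filter_upwards [continuous_fst.continuousAt.preimage_mem_nhds (Ioo_mem_nhds ht'.1 ht'.2)]
        with q hq
      exact (hv q.1 (Ioo_subset_Ioc_self hq) q.2).viscosityAt)
  rwa [one_mul] at h2

/-- Regular subsolutions are classical subsolutions above the obstacle, up to the final time. -/
lemma RegularEvolution.evolOp_nonpos (hn : 1 ≤ n) (hs : 1 / 2 < s)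
    (hs1 : s < 1) (hσ : 0 < σ) (hσs : σ < s) (h0 : 0 < lam) (h1 : lam ≤ Lam) (hT : 0 < T)
    (hα : 0 < α) (h : RegularEvolution s α T M D u ut) (hJ : IsNonlocalOp σ lam Lam J)
    (hψ : Continuous ψ)
    (hv : ∀ t ∈ Ioc 0 T, ∀ x, ψ x < u t x → ViscositySubAt s b r J T u t x)
    {t : ℝ} (ht : t ∈ Ioc 0 T) (x : E n) (hlt : ψ x < u t x) : evolOp s b r J u ut t x ≤ 0 := by
  have hc := h.continuousOn_evolOp_time (b := b) (r := r) hn hs hs1 hσ hσs h0 h1 hT hα hJ x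
  have := neBot_nhdsWithin_Ioo ht
  have hsub : Ioo 0 T ⊆ Icc 0 T := Ioo_subset_Icc_self
  refine le_of_tendsto ((hc t ht).mono Ioo_subset_Ioc_self).tendsto ?_
  -- Being strictly above the obstacle is an open condition, so the subsolution property holds near
  -- the approximating points too.
  have hu := ((h.continuousOn_time x t ⟨ht.1.le, ht.2⟩).mono hsub).eventually
    (lt_mem_nhds hlt)
  filter_upwards [self_mem_nhdsWithin, hu] with t' ht' hlt'
  have hnhds : Icc 0 T ×ˢ (univ : Set (E n)) ∈ 𝓝 (t', x) :=
    prod_mem_nhds (Icc_mem_nhds ht'.1 ht'.2) Filter.univ_mem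
  have hcu : ContinuousAt (fun q : ℝ × E n => u q.1 q.2) (t', x) := h.cont.continuousAt hnhds
  have hcψ : ContinuousAt (fun q : ℝ × E n => ψ q.2) (t', x) :=
    (hψ.comp continuous_snd).continuousAt
  have h2 := h.evolOp_nonneg_of_viscosity (b := b) (r := r) hn hs hs1 hσ hσs h0 h1 hT hα hJ
    (Or.inr rfl) ht' (x₁ := x) (by
      filter_upwards [continuous_fst.continuousAt.preimage_mem_nhds (Ioo_mem_nhds ht'.1 ht'.2),
        hcψ.eventually_lt hcu hlt'] with q hq hq'
      exact (hv q.1 (Ioo_subset_Ioc_self hq) q.2 hq').viscosityAt)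
  linarith

/-- A function touching the obstacle from above has the gradient of the obstacle there. -/
lemma fderiv_eq_of_contact {v : E n → ℝ} {x : E n} (hv : DifferentiableAt ℝ v x)
    (hψ : DifferentiableAt ℝ ψ x) (hle : ∀ z, ψ z ≤ v z) (hx : v x = ψ x) :
    fderiv ℝ v x = fderiv ℝ ψ x := by
  have hmin : IsLocalMin (fun z => v z - ψ z) x := Filter.Eventually.of_forall fun z => by
    simp only [hx, sub_self]
    linarith [hle z]
  exact sub_eq_zero.1 (hmin.hasFDerivAt_eq_zero (hv.hasFDerivAt.sub hψ.hasFDerivAt))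

/-- Constancy at earlier times is all that contact provides; it suffices because derivatives within
(0,t] are unique at t. -/
lemma deriv_eq_zero_of_const_left {f : ℝ → ℝ} {f' c t : ℝ} (ht : t ∈ Ioc 0 T)
    (hf : HasDerivWithinAt f f' (Ioc 0 T) t) (hc : ∀ t' ∈ Ioc 0 t, f t' = c) : f' = 0 := by
  have h1 := hf.mono (Ioc_subset_Ioc_right ht.2 : Ioc 0 t ⊆ Ioc 0 T)
  have h2 : HasDerivWithinAt f 0 (Ioc 0 t) t :=
    (hasDerivWithinAt_const t (Ioc 0 t) c).congr hc (hc t ⟨ht.1, le_rfl⟩)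
  exact (uniqueDiffOn_Ioc 0 t t ⟨ht.1, le_rfl⟩).eq_deriv _ h1 h2

/-- A continuous function of time vanishing after the contact times, and Hölder continuous
along the contact times, is Hölder continuous if the contact times form an initial segment. -/
lemma holder_of_contact {F : ℝ → ℝ} {P : ℝ → Prop} {C : ℝ} (hθ : 0 ≤ θ)
    (hF : ContinuousOn F (Ioc 0 T))
    (hP : ∀ t τ, 0 < t → t ≤ τ → τ ≤ T → P τ → P t)
    (hclosed : ∀ t τ, 0 < t → τ ≤ T → IsClosed {t' ∈ Icc t τ | P t'})
    (hzero : ∀ t ∈ Ioc 0 T, ¬ P t → F t = 0)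
    (hC : ∀ t ∈ Ioc 0 T, ∀ τ ∈ Ioc 0 T, P t → P τ → |F t - F τ| ≤ C * |t - τ| ^ θ)
    (hC0 : 0 ≤ C) {t τ : ℝ} (ht : t ∈ Ioc 0 T) (hτ : τ ∈ Ioc 0 T) :
    |F t - F τ| ≤ C * |t - τ| ^ θ := by
  wlog htτ : t ≤ τ generalizing t τ
  · rw [abs_sub_comm, abs_sub_comm t]
    exact this hτ ht (le_of_not_ge htτ)
  by_cases hPt : P t
  · by_cases hPτ : P τ
    · exact hC t ht τ hτ hPt hPτ
    -- The last contact time m exists by compactness. F vanishes just after m, hence at m by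
    -- continuity, and |t - m| ≤ |t - τ| for the contact pair t, m.
    · have hcomp : IsCompact {t' ∈ Icc t τ | P t'} :=
        isCompact_Icc.of_isClosed_subset (hclosed t τ ht.1 hτ.2) fun _ h => h.1
      obtain ⟨m, ⟨⟨hm1, hm2⟩, hPm⟩, hmax⟩ := hcomp.exists_isGreatest ⟨t, ⟨le_rfl, htτ⟩, hPt⟩
      have hmτ : m < τ := hm2.lt_of_ne fun he => hPτ (he ▸ hPm)
      have hm : m ∈ Ioc 0 T := ⟨ht.1.trans_le hm1, hm2.trans hτ.2⟩
      have hFz : ∀ t' ∈ Ioc m τ, F t' = 0 := fun t' ht' =>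
        hzero t' ⟨hm.1.trans ht'.1, ht'.2.trans hτ.2⟩ fun hPt' =>
          absurd (hmax ⟨⟨hm1.trans ht'.1.le, ht'.2⟩, hPt'⟩) (not_le.2 ht'.1)
      have hne : (𝓝[Ioc m τ] m).NeBot := by
        rw [← mem_closure_iff_nhdsWithin_neBot, closure_Ioc hmτ.ne]
        exact ⟨le_rfl, hmτ.le⟩
      have hFm : F m = 0 := by
        refine tendsto_nhds_unique ((hF m hm).mono (fun t' ht' =>
          ⟨hm.1.trans ht'.1, ht'.2.trans hτ.2⟩ : Ioc m τ ⊆ Ioc 0 T)).tendsto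
          (tendsto_const_nhds.congr' ?_)
        filter_upwards [self_mem_nhdsWithin] with t' ht' using (hFz t' ht').symm
      have h1 := hC t ht m hm hPt hPm
      rw [hFz τ ⟨hmτ, le_rfl⟩, ← hFm]
      refine h1.trans (mul_le_mul_of_nonneg_left (Real.rpow_le_rpow (abs_nonneg _) ?_ hθ) hC0)
      rw [abs_sub_comm, abs_of_nonneg (by linarith), abs_sub_comm, abs_of_nonneg (by linarith)]
      linarith
  · have hPτ : ¬ P τ := fun h => hPt (hP t τ ht.1 htτ hτ.2 h)
    rw [hzero t ht hPt, hzero τ hτ hPτ, sub_self, abs_zero]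
    positivity

end Obstacle

end NonlocalObstacle

end

/-! ### Conclusion -/

open NonlocalObstacle

theorem lemma5p2 (n : ℕ) (hn : 2 ≤ n)
    (s σ lam Lam T r α M : ℝ) (b : NonlocalObstacle.E n)
    (hs : 1 / 2 < s) (hs1 : s < 1) (hσ : 0 < σ) (hσs : σ < s)
    (hlam : 0 < lam) (hLam : lam ≤ Lam) (hT : 0 < T)
    (hα : 0 < α) (hα1 : α < (1 - s) / (2 * s)) :
    ∃ C : ℝ,
      ∀ (ψ : NonlocalObstacle.E n → ℝ)
        (J : (NonlocalObstacle.E n → ℝ) → NonlocalObstacle.E n → ℝ)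
        (u ut g : ℝ → NonlocalObstacle.E n → ℝ),
        NonlocalObstacle.IsObstacle M ψ →
        NonlocalObstacle.IsNonlocalOp σ lam Lam J →
        NonlocalObstacle.IsSolution s b r J T ψ u →
        -- `ut` is the time derivative of `u`, bounded by `M` in `C^{α,1-s}_{t,x}`
        (∀ t ∈ Set.Ioc 0 T, ∀ x, HasDerivWithinAt (fun τ => u τ x) (ut t x) (Set.Ioc 0 T) t) →
        NonlocalObstacle.HolderTX T α (1 - s) M ut →
        -- `g` is `(-Δ)^s u`, bounded by `M` in `L^∞((0,T]; C^{1-s})`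
        (∀ᵐ t ∂(MeasureTheory.volume.restrict (Set.Ioc 0 T)),
          NonlocalObstacle.IsDistribFracLap s (u t) (g t) ∧
            NonlocalObstacle.HolderX (1 - s) M (g t)) →
        -- all terms are classically defined
        (∀ t ∈ Set.Ioc 0 T, ∀ x, NonlocalObstacle.FracLapConverges s (u t) x ∧
          DifferentiableAt ℝ (u t) x ∧ NonlocalObstacle.InDomain σ (u t) x) ∧
        (∀ᵐ t ∂(MeasureTheory.volume.restrict (Set.Ioc 0 T)),
          ∀ x, NonlocalObstacle.fracLap s (u t) x = g t x) ∧
        NonlocalObstacle.HolderTX T ((1 + α) * ((1 - s) / (1 + s))) (1 - s) C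
          (NonlocalObstacle.freeBoundaryTerm s b r J ψ u) := by
  have hn1 : 1 ≤ n := by omega
  have hs0 : 0 < s := by linarith
  set θ : ℝ := (1 + α) * ((1 - s) / (1 + s)) with hθd
  have hθ : 0 < θ := mul_pos (by linarith) (div_pos (by linarith) (by linarith))
  have hθs : θ < (1 - s) / (2 * s) := by
    -- The upper bound on α is what this needs: 1 + (1-s)/(2s) = (1+s)/(2s), and the factor 1+s
    -- cancels.
    calc θ < (1 + (1 - s) / (2 * s)) * ((1 - s) / (1 + s)) :=
          mul_lt_mul_of_pos_right (by linarith) (div_pos (by linarith) (by linarith))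
      _ = (1 - s) / (2 * s) := by field_simp; ring
  have hθ1 : θ ≤ 1 := hθs.le.trans ((div_le_one (by linarith)).2 (by linarith))
  obtain ⟨D, hD⟩ := exists_regularEvolution (n := n) (α := α) hn1 hs hs1 hT M
  obtain ⟨C₁, hC₁⟩ := exists_holderX_evolOp hn1 hs hs1 hσ hσs hlam hLam b r α T M D
  obtain ⟨C₂, hC₂⟩ := exists_nonlocal_time_holder (n := n) hn1 hs0 hs1 hσ hσs hlam hLam hT hα hθ
    hθs hθ1 M D
  refine ⟨max C₁ |C₂|, fun ψ J u ut g hψ hJ hu hut hutH hg => ?_⟩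
  have hu0 : ∀ x, u 0 x = ψ x := fun x => le_antisymm (hu.sub.initial x) (hu.super.initial x)
  obtain ⟨h, hae⟩ := hD u ut g hu.cont (fun x => by rw [hu0]; exact hψ.bound x) hut hutH hg
  have hdiff : ∀ t ∈ Ioc 0 T, ∀ x, DifferentiableAt ℝ (u t) x := fun t ht x =>
    (h.hasFDerivAt hs0 ht x).differentiableAt
  refine ⟨fun t ht x => ⟨(h.reg t ht).fracLapConverges hn1 hs0 hs1 x, hdiff t ht x,
    (h.reg t ht).inDomain hs0 hσ hσs hs1 x⟩, hae, ?_⟩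
  have hsuper : ∀ t ∈ Ioc 0 T, ∀ x, 0 ≤ evolOp s b r J u ut t x := fun t ht x =>
    h.evolOp_nonneg hn1 hs hs1 hσ hσs hlam hLam hT hα hJ hu.super.visc ht x
  have hsub : ∀ t ∈ Ioc 0 T, ∀ x, ψ x < u t x → evolOp s b r J u ut t x ≤ 0 := fun t ht x =>
    h.evolOp_nonpos hn1 hs hs1 hσ hσs hlam hLam hT hα hJ hψ.smooth.continuous hu.sub.visc ht x
  have hmono : ∀ t τ x, 0 < t → t ≤ τ → τ ≤ T → u t x ≤ u τ x := fun t τ x ht htτ hτ =>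
    h.monotone hn1 hs hs1 hσ hσs hlam hLam hT hJ hu.super.above hu0 hsuper hsub ht.le htτ hτ x
  -- Monotonicity in time squeezes u between ψ and its later contact value, so contact propagates
  -- backwards.
  have hback : ∀ t τ x, 0 < t → t ≤ τ → τ ≤ T → u τ x = ψ x → u t x = ψ x :=
    fun t τ x ht htτ hτ hc =>
      le_antisymm ((hmono t τ x ht htτ hτ).trans hc.le) (hu.super.above t ⟨ht, htτ.trans hτ⟩ x)
  have hut0 : ∀ t ∈ Ioc 0 T, ∀ x, u t x = ψ x → ut t x = 0 := fun t ht x hc =>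
    deriv_eq_zero_of_const_left ht (hut t ht x) fun t' ht' => hback t' t x ht'.1 ht'.2 ht.2 hc
  have hoff : ∀ t ∈ Ioc 0 T, ∀ x, u t x ≠ ψ x → evolOp s b r J u ut t x = 0 := fun t ht x hc =>
    le_antisymm (hsub t ht x (lt_of_le_of_ne (hu.super.above t ht x) hc.symm)) (hsuper t ht x)
  have hfree : ∀ t ∈ Ioc 0 T, ∀ x, freeBoundaryTerm s b r J ψ u t x = evolOp s b r J u ut t x := by
    intro t ht x
    unfold freeBoundaryTerm
    split_ifs with hc
    · rw [evolOp, hut0 t ht x hc, zero_add]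
    · exact (hoff t ht x hc).symm
  have htime : ∀ t ∈ Ioc 0 T, ∀ τ ∈ Ioc 0 T, ∀ x,
      |evolOp s b r J u ut t x - evolOp s b r J u ut τ x| ≤ |C₂| * |t - τ| ^ θ := by
    intro t ht τ hτ x
    refine holder_of_contact (F := fun t => evolOp s b r J u ut t x) (P := fun t => u t x = ψ x)
      hθ.le (h.continuousOn_evolOp_time hn1 hs hs1 hσ hσs hlam hLam hT hα hJ x)
      (fun t τ => hback t τ x) (fun t τ ht hτ => ?_) (fun t ht => hoff t ht x) ?_ (abs_nonneg _)
      ht hτ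
    · exact ((h.continuousOn_time x).mono (Icc_subset_Icc ht.le hτ)).preimage_isClosed_of_isClosed
        isClosed_Icc isClosed_singleton
    · intro t ht τ hτ hc hc'
      have hψd : DifferentiableAt ℝ ψ x := hψ.smooth.differentiable (by norm_num) x
      refine le_trans (le_of_eq ?_) ((hC₂ u ut J h hJ t ht τ hτ x).trans
        (mul_le_mul_of_nonneg_right (le_abs_self C₂) (by positivity)))
      -- At both contact times the value, the gradient and the vanishing time derivative are the
      -- same, so they cancel and only the nonlocal terms remain.
      simp only [evolOp, lowerOp, hut0 t ht x hc, hut0 τ hτ x hc', hc, hc',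
        fderiv_eq_of_contact (hdiff t ht x) hψd (hu.super.above t ht) hc,
        fderiv_eq_of_contact (hdiff τ hτ x) hψd (hu.super.above τ hτ) hc']
      congr 1
      ring
  refine ⟨fun t ht x => ?_, fun t ht τ hτ x y => ?_⟩
  · rw [hfree t ht]
    exact ((hC₁ u ut J h hα hJ t ht).bound x).trans (le_max_left _ _)
  · rw [hfree t ht, hfree τ hτ, mul_add]
    have a1 := (htime t ht τ hτ x).trans
      (mul_le_mul_of_nonneg_right (le_max_right C₁ |C₂|) (by positivity))
    have a2 := ((hC₁ u ut J h hα hJ τ hτ).holder x y).trans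
      (mul_le_mul_of_nonneg_right (le_max_left C₁ |C₂|) (by positivity))
    exact (abs_sub_le _ (evolOp s b r J u ut τ x) _).trans (add_le_add a1 a2)
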